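/- Let $\Bbbk$ be an algebraically closed field of characteristic zero and $n\ge 0$. For $x\in\Bbbk\setminus\{0\}$ let $\mathcal P_n(x)$ be the partition algebra: it has as a $\Bbbk$-basis the set partitions (partition diagrams) of the union of two copies (rows) of $\{1,\dots,n\}$, and the product of two diagrams is $\mathbf d\mathbf d'=x^r\mathbf d''$, where $\mathbf d''$ is obtained by concatenating $\mathbf d$ and $\mathbf d'$ along the common middle row and deleting the middle row, and $r$ is the number of parts of the concatenation which are contained in the middle row. The rank of a diagram is the number of its parts which meet both rows. For $0\le i\le n$ let $\mathbf d_i$ be the diagram of rank $i$ which connects the first $i$ points of the two rows by vertical lines and in which all other points are singletons, and let $\mathbf L_i$ be its left cell, i.e. the set of all diagrams of rank $i$ obtained from $\mathbf d_i$ by left concatenation with diagrams. The space $\Bbbk\mathbf L_i$ is a $\mathcal P_n(x)$-$\Bbbk[S_i]$-bimodule: a diagram acts on the left by multiplication in $\mathcal P_n(x)$, the result being replaced by $0$ if the rank drops, and $S_i$ acts on the right by concatenation with the diagrams of the permutations of the first $i$ points. For a partition $\lambda\vdash i$, with Specht module $\mathbf S^\lambda$ over $\Bbbk[S_i]$, the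 module $\mathbf C^\lambda=\Bbbk\mathbf L_i\otimes_{\Bbbk[S_i]}\mathbf S^\lambda$ is called a standard $\mathcal P_n(x)$-module. A standard filtration of a $\mathcal P_n(x)$-module is a finite filtration by submodules, from $0$ to the whole module, in which each successive subquotient is isomorphic to $\mathbf C^\lambda$ for some $\lambda\vdash i$ with $0\le i\le n$. **Proposition.** Let $a,b\in\Bbbk\setminus\{0\}$. Let $X$ be a $\mathcal P_n(a)$-module which has a standard filtration and let $Y$ be a $\mathcal P_n(b)$-module which has a standard filtration. Then the $\mathcal P_n(ab)$-module $X\otimes_\Bbbk Y$, obtained by pulling back the $\mathcal P_n(a)\otimes_\Bbbk\mathcal P_n(b)$-module structure along the algebra homomorphism $\mathcal P_n(ab)\to\mathcal P_n(a)\otimes_\Bbbk\mathcal P_n(b)$ given on diagrams by $\mathbf d\mapsto\mathbf d\otimes\mathbf d$, has a standard filtration as well. -/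

import Mathlib

open scoped TensorProduct

/-! ### Partition diagrams -/

/-- A partition diagram: a set partition (i.e. an equivalence relation) of two copies of an
`n`-element set. `Sum.inl` is the output row, `Sum.inr` is the input row: in a product `d * d'`
the input row of `d` is glued to the output row of `d'`. -/
abbrev PartitionDiagram (n : ℕ) : Type := Setoid (Fin n ⊕ Fin n)

namespace PartitionDiagram

variable {n : ℕ}

/-- The inclusion of the two rows of the left factor into the three rows (left, middle, right). -/
def leftRows : Fin n ⊕ Fin n → Fin n ⊕ Fin n ⊕ Fin n
  | Sum.inl a => Sum.inl a
  | Sum.inr a => Sum.inr (Sum.inl a)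

/-- The inclusion of the two rows of the right factor into the three rows. -/
def rightRows : Fin n ⊕ Fin n → Fin n ⊕ Fin n ⊕ Fin n
  | Sum.inl a => Sum.inr (Sum.inl a)
  | Sum.inr a => Sum.inr (Sum.inr a)

/-- The inclusion of the two outer rows into the three rows. -/
def outerRows : Fin n ⊕ Fin n → Fin n ⊕ Fin n ⊕ Fin n
  | Sum.inl a => Sum.inl a
  | Sum.inr a => Sum.inr (Sum.inr a)

/-- The concatenation of two diagrams before straightening: the set partition of three rows
generated by the two diagrams. -/
def glue (d d' : PartitionDiagram n) : Setoid (Fin n ⊕ Fin n ⊕ Fin n) :=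
  Relation.EqvGen.setoid fun p q =>
    (∃ u v, d u v ∧ leftRows u = p ∧ leftRows v = q) ∨
    (∃ u v, d' u v ∧ rightRows u = p ∧ rightRows v = q)

/-- The diagram obtained by concatenation and straightening. -/
def comp (d d' : PartitionDiagram n) : PartitionDiagram n :=
  (glue d d').comap outerRows

/-- The number of parts removed in the straightening procedure, i.e. of the parts of the
concatenation that do not meet the two outer rows. -/
noncomputable def loops (d d' : PartitionDiagram n) : ℕ :=
  Nat.card {c : Quotient (glue d d') // ∀ u, Quotient.mk (glue d d') (outerRows u) ≠ c}

/-- The diagram of a permutation `τ`: the input point `b` is joined to the output point `τ b`. -/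
def ofPerm (τ : Equiv.Perm (Fin n)) : PartitionDiagram n :=
  Setoid.ker (Sum.elim id τ : Fin n ⊕ Fin n → Fin n)

/-- The identity diagram. -/
def idDiagram (n : ℕ) : PartitionDiagram n := ofPerm (Equiv.refl (Fin n))

/-- The rank of a diagram: the number of its propagating lines, i.e. of the parts which meet
both rows. -/
noncomputable def rank (d : PartitionDiagram n) : ℕ :=
  Nat.card {c : Quotient d // (∃ a, Quotient.mk d (Sum.inl a) = c) ∧
    ∃ b, Quotient.mk d (Sum.inr b) = c}

/-- The diagram of rank `i` (for `i ≤ n`) which joins the output point `a` to the input point `a`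
for the first `i` points `a`, all other points being singletons. -/
def proj (n i : ℕ) : PartitionDiagram n :=
  Setoid.ker fun p => Sum.elim (fun a => (a, decide (i ≤ a.1))) (fun b => (b, false)) p

/-- The left cell of `proj n i`: all diagrams of rank `i` which are obtained from it by left
concatenation with other diagrams. -/
abbrev LeftCell (n i : ℕ) : Type :=
  {l : PartitionDiagram n // l.rank = i ∧ ∃ d, comp d (proj n i) = l}

/-! Concatenation is associative and counts removed parts additively. This is checked by
comparing each diagram with the zero-one matrix which it defines on functions `Fin n → Bool`. -/

theorem glue_le_iff {d d' : PartitionDiagram n} {s : Setoid (Fin n ⊕ Fin n ⊕ Fin n)} :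
    glue d d' ≤ s ↔ (∀ u v, d u v → s (leftRows u) (leftRows v)) ∧
      ∀ u v, d' u v → s (rightRows u) (rightRows v) := by
  constructor
  · intro h
    exact ⟨fun u v huv => h (Relation.EqvGen.rel _ _ (Or.inl ⟨u, v, huv, rfl, rfl⟩)),
      fun u v huv => h (Relation.EqvGen.rel _ _ (Or.inr ⟨u, v, huv, rfl, rfl⟩))⟩
  · rintro ⟨h1, h2⟩
    refine Setoid.eqvGen_le ?_
    rintro p q (⟨u, v, huv, rfl, rfl⟩ | ⟨u, v, huv, rfl, rfl⟩)
    · exact h1 u v huv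
    · exact h2 u v huv

theorem glue_left {d d' : PartitionDiagram n} {u v} (h : d u v) :
    glue d d' (leftRows u) (leftRows v) := (glue_le_iff.1 le_rfl).1 u v h

theorem glue_right {d d' : PartitionDiagram n} {u v} (h : d' u v) :
    glue d d' (rightRows u) (rightRows v) := (glue_le_iff.1 le_rfl).2 u v h

open Classical in
/-- The zero-one matrix of a diagram. -/
noncomputable def boolMatrix (d : PartitionDiagram n) :
    Matrix (Fin n → Bool) (Fin n → Bool) ℕ :=
  fun f g => if d ≤ Setoid.ker (Sum.elim f g) then 1 else 0

theorem boolMatrix_const (d : PartitionDiagram n) :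
    boolMatrix d (fun _ => true) (fun _ => true) = 1 := by
  rw [boolMatrix, if_pos]
  intro u v _
  cases u <;> cases v <;> rfl

theorem boolMatrix_injective : Function.Injective (boolMatrix (n := n)) := by
  classical
  have key : ∀ d d' : PartitionDiagram n, boolMatrix d = boolMatrix d' → d ≤ d' := by
    intro d d' h u v huv
    have h1 := congrFun (congrFun h (fun a => decide (d' u (Sum.inl a))))
      (fun a => decide (d' u (Sum.inr a)))
    have h2 : Sum.elim (fun a => decide (d' u (Sum.inl a))) (fun a => decide (d' u (Sum.inr a)))
        = fun p => decide (d' u p) := by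
      funext p; cases p <;> rfl
    simp only [boolMatrix, h2] at h1
    rw [if_pos (c := d' ≤ _)] at h1
    · by_cases hd : d ≤ Setoid.ker (fun p => decide (d' u p))
      · have h3 : decide (d' u u) = decide (d' u v) := hd huv
        rw [decide_eq_true (d'.refl' u)] at h3
        exact of_decide_eq_true h3.symm
      · simp [hd] at h1
    · intro p q hpq
      change decide _ = decide _
      rw [decide_eq_decide]
      exact ⟨fun h => d'.trans' h hpq, fun h => d'.trans' h (d'.symm' hpq)⟩
  exact fun d d' h => le_antisymm (key d d' h) (key d' d h.symm)

theorem boolMatrix_mul (d d' : PartitionDiagram n) :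
    boolMatrix d * boolMatrix d' = 2 ^ loops d d' • boolMatrix (comp d d') := by
  classical
  ext f g
  have hle : ∀ j : Fin n → Bool,
      (d ≤ Setoid.ker (Sum.elim f j) ∧ d' ≤ Setoid.ker (Sum.elim j g)) ↔
        glue d d' ≤ Setoid.ker (Sum.elim f (Sum.elim j g)) := by
    intro j
    rw [glue_le_iff]
    refine and_congr (forall₂_congr fun u v => forall_congr' fun _ => ?_)
      (forall₂_congr fun u v => forall_congr' fun _ => ?_) <;>
    cases u <;> cases v <;> rfl
  have hsum : (boolMatrix d * boolMatrix d') f g =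
      Fintype.card {j : Fin n → Bool // glue d d' ≤ Setoid.ker (Sum.elim f (Sum.elim j g))} := by
    rw [Matrix.mul_apply, Fintype.card_subtype, Finset.card_filter]
    refine Finset.sum_congr rfl fun j _ => ?_
    simp only [boolMatrix, ← hle]
    split_ifs <;> simp_all
  have hout : ∀ (j : Fin n → Bool) u,
      Sum.elim f (Sum.elim j g) (outerRows u) = Sum.elim f g u := by
    rintro j (u | u) <;> rfl
  rw [hsum, Matrix.smul_apply]
  by_cases hc : comp d d' ≤ Setoid.ker (Sum.elim f g)
  · rw [boolMatrix, if_pos hc, smul_eq_mul, mul_one, loops, ← Nat.card_eq_fintype_card]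
    have h2 : 2 = Nat.card Bool := by simp
    rw [h2, ← Nat.card_fun]
    refine Nat.card_eq_of_bijective
      (fun j c => Quotient.lift (s := glue d d') (Sum.elim f (Sum.elim j.1 g)) (fun _ _ h => j.2 h) c.1) ⟨?_, ?_⟩
    · intro j j' hjj
      ext m
      by_cases hm : ∃ u, glue d d' (outerRows u) (Sum.inr (Sum.inl m))
      · obtain ⟨u, hu⟩ := hm
        have e1 : Sum.elim f (Sum.elim j.1 g) (outerRows u) = j.1 m := j.2 hu
        have e2 : Sum.elim f (Sum.elim j'.1 g) (outerRows u) = j'.1 m := j'.2 hu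
        rw [← e1, ← e2, hout, hout]
      · exact congrFun hjj ⟨Quotient.mk _ (Sum.inr (Sum.inl m)),
          fun u hu => hm ⟨u, Quotient.exact hu⟩⟩
    · intro F
      let G : Quotient (glue d d') → Bool := fun c =>
        if h : ∀ u, Quotient.mk (glue d d') (outerRows u) ≠ c then F ⟨c, h⟩
        else Sum.elim f g (not_forall.1 h).choose
      have hG : ∀ u, G (Quotient.mk _ (outerRows u)) = Sum.elim f g u := by
        intro u
        have hn : ¬ ∀ v, Quotient.mk (glue d d') (outerRows v) ≠
          Quotient.mk (glue d d') (outerRows u) := fun h => h u rfl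
        simp only [G, dif_neg hn]
        have hv : Quotient.mk (glue d d') (outerRows (not_forall.1 hn).choose) =
            Quotient.mk (glue d d') (outerRows u) := not_not.1 (not_forall.1 hn).choose_spec
        exact hc (show glue d d' _ _ from Quotient.exact hv)
      have hG' : Sum.elim f (Sum.elim (fun m => G (Quotient.mk _ (Sum.inr (Sum.inl m)))) g)
          = fun p => G (Quotient.mk _ p) := by
        funext p
        rcases p with p | p | p
        · exact (hG (Sum.inl p)).symm
        · rfl
        · exact (hG (Sum.inr p)).symm
      refine ⟨⟨fun m => G (Quotient.mk _ (Sum.inr (Sum.inl m))), ?_⟩, ?_⟩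
      · rw [hG']
        intro p q hpq
        exact congrArg G (Quotient.sound hpq)
      · funext c
        obtain ⟨c, hcc⟩ := c
        induction c using Quotient.inductionOn with
        | h p =>
          change Sum.elim f (Sum.elim (fun m => G (Quotient.mk _ (Sum.inr (Sum.inl m)))) g) p = _
          rw [hG']
          simp only [G, dif_pos hcc]
  · rw [boolMatrix, if_neg hc, smul_zero, Fintype.card_eq_zero_iff]
    refine ⟨fun j => hc fun u v huv => ?_⟩
    have := j.2 huv
    rwa [Setoid.ker_def, hout, hout] at this

theorem comp_loops_assoc (d₁ d₂ d₃ : PartitionDiagram n) :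
    comp (comp d₁ d₂) d₃ = comp d₁ (comp d₂ d₃) ∧
      loops d₁ d₂ + loops (comp d₁ d₂) d₃ = loops d₂ d₃ + loops d₁ (comp d₂ d₃) := by
  have h := Matrix.mul_assoc (boolMatrix d₁) (boolMatrix d₂) (boolMatrix d₃)
  rw [boolMatrix_mul, boolMatrix_mul, Matrix.smul_mul, Matrix.mul_smul, boolMatrix_mul,
    boolMatrix_mul, smul_smul, smul_smul, ← pow_add, ← pow_add] at h
  have h0 := congrFun (congrFun h (fun _ => true)) (fun _ => true)
  rw [Matrix.smul_apply, Matrix.smul_apply, boolMatrix_const, boolMatrix_const] at h0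
  have h1 : loops d₁ d₂ + loops (comp d₁ d₂) d₃ = loops d₂ d₃ + loops d₁ (comp d₂ d₃) := by
    refine Nat.pow_right_injective le_rfl ?_
    simpa using h0
  refine ⟨boolMatrix_injective ?_, h1⟩
  rw [h1] at h
  ext f g
  have h2 := congrFun (congrFun h f) g
  rw [Matrix.smul_apply, Matrix.smul_apply, smul_eq_mul, smul_eq_mul] at h2
  exact Nat.eq_of_mul_eq_mul_left (by positivity) h2

theorem boolMatrix_id : boolMatrix (idDiagram n) = 1 := by
  classical
  ext f g
  rw [boolMatrix, Matrix.one_apply]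
  refine if_congr ⟨fun h => ?_, ?_⟩ rfl rfl
  · funext a
    exact h (x := Sum.inl a) (y := Sum.inr a) rfl
  · rintro rfl u v huv
    have huv' : Sum.elim id (Equiv.refl (Fin n)) u = Sum.elim id (Equiv.refl (Fin n)) v := huv
    rcases u with u | u <;> rcases v with v | v <;> exact congrArg f huv'

theorem id_comp_loops (d : PartitionDiagram n) :
    comp (idDiagram n) d = d ∧ loops (idDiagram n) d = 0 := by
  have h := boolMatrix_mul (idDiagram n) d
  rw [boolMatrix_id, one_mul] at h
  have h0 := congrFun (congrFun h (fun _ => true)) (fun _ => true)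
  rw [Matrix.smul_apply, boolMatrix_const, boolMatrix_const] at h0
  have h1 : loops (idDiagram n) d = 0 :=
    Nat.pow_right_injective le_rfl (by simpa using h0.symm)
  refine ⟨boolMatrix_injective ?_, h1⟩
  rw [h, h1, pow_zero, one_smul]

theorem comp_id_loops (d : PartitionDiagram n) :
    comp d (idDiagram n) = d ∧ loops d (idDiagram n) = 0 := by
  have h := boolMatrix_mul d (idDiagram n)
  rw [boolMatrix_id, mul_one] at h
  have h0 := congrFun (congrFun h (fun _ => true)) (fun _ => true)
  rw [Matrix.smul_apply, boolMatrix_const, boolMatrix_const] at h0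
  have h1 : loops d (idDiagram n) = 0 :=
    Nat.pow_right_injective le_rfl (by simpa using h0.symm)
  refine ⟨boolMatrix_injective ?_, h1⟩
  rw [h, h1, pow_zero, one_smul]

theorem rank_comp_le (d l : PartitionDiagram n) : (comp d l).rank ≤ l.rank := by
  -- If an input point is joined to some other row, its part in `l` is a propagating line.
  have key : ∀ p q, glue d l p q →
      ((∃ b, p = Sum.inr (Sum.inr b) ∧ ¬ ∃ a, l (Sum.inl a) (Sum.inr b)) ↔
        ∃ b, q = Sum.inr (Sum.inr b) ∧ ¬ ∃ a, l (Sum.inl a) (Sum.inr b)) := by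
    have : glue d l ≤ Setoid.ker fun p =>
        (∃ b, p = Sum.inr (Sum.inr b) ∧ ¬ ∃ a, l (Sum.inl a) (Sum.inr b)) := by
      rw [glue_le_iff]
      constructor
      · rintro (u | u) (v | v) _ <;> simp [Setoid.ker_def, leftRows]
      · rintro (u | u) (v | v) h
        · simp [Setoid.ker_def, rightRows]
        · simpa [Setoid.ker_def, rightRows] using ⟨u, h⟩
        · simpa [Setoid.ker_def, rightRows] using ⟨v, l.symm' h⟩
        · simp only [Setoid.ker_def, rightRows, Sum.inr.injEq, exists_eq_left', eq_iff_iff]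
          exact not_congr ⟨fun ⟨a, ha⟩ => ⟨a, l.trans' ha h⟩,
            fun ⟨a, ha⟩ => ⟨a, l.trans' ha (l.symm' h)⟩⟩
    intro p q h
    exact iff_of_eq (this h)
  rw [rank, rank]
  refine Nat.card_le_card_of_injective (fun c => ⟨Quotient.mk l (Sum.inr c.2.2.choose), ?_,
    c.2.2.choose, rfl⟩) ?_
  · obtain ⟨a, ha⟩ := c.2.1
    have hb := c.2.2.choose_spec
    have hg : glue d l (Sum.inl a) (Sum.inr (Sum.inr c.2.2.choose)) :=
      Quotient.exact (s := comp d l) (ha.trans hb.symm)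
    by_contra hcon
    obtain ⟨b, hb', -⟩ := (key _ _ hg).2 ⟨_, rfl, fun ⟨a', ha'⟩ => hcon ⟨a', Quotient.sound ha'⟩⟩
    cases hb'
  · intro c c' h
    have h1 : l (Sum.inr c.2.2.choose) (Sum.inr c'.2.2.choose) :=
      Quotient.exact (congrArg Subtype.val h)
    have h2 : comp d l (Sum.inr c.2.2.choose) (Sum.inr c'.2.2.choose) :=
      glue_right (d := d) h1
    exact Subtype.ext
      (c.2.2.choose_spec.symm.trans ((Quotient.sound h2).trans c'.2.2.choose_spec))

theorem comp_mem_leftCell {i : ℕ} (d : PartitionDiagram n) (l : LeftCell n i)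
    (h : (comp d l.1).rank = i) :
    (comp d l.1).rank = i ∧ ∃ d', comp d' (proj n i) = comp d l.1 := by
  obtain ⟨d', hd'⟩ := l.2.2
  exact ⟨h, comp d d', by rw [(comp_loops_assoc _ _ _).1, hd']⟩

end PartitionDiagram

open PartitionDiagram

/-! ### The partition algebra -/

/-- The partition algebra `P_n(x)`: the vector space with basis the partition diagrams. -/
def PartitionAlgebra (k : Type*) [Field k] (n : ℕ) (_x : k) : Type _ :=
  PartitionDiagram n →₀ k

namespace PartitionAlgebra

variable {k : Type*} [Field k] {n : ℕ} {x : k}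

noncomputable instance : AddCommGroup (PartitionAlgebra k n x) :=
  inferInstanceAs (AddCommGroup (PartitionDiagram n →₀ k))

noncomputable instance : Module k (PartitionAlgebra k n x) :=
  inferInstanceAs (Module k (PartitionDiagram n →₀ k))

/-- The basis element of a diagram. -/
noncomputable def diag (x : k) (d : PartitionDiagram n) : PartitionAlgebra k n x :=
  Finsupp.single d 1

/-- The linear extension of a map defined on diagrams. -/
noncomputable def linearLift {M : Type*} [AddCommGroup M] [Module k M]
    (f : PartitionDiagram n → M) : PartitionAlgebra k n x →ₗ[k] M :=
  Finsupp.linearCombination k f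

theorem linearLift_diag {M : Type*} [AddCommGroup M] [Module k M]
    (f : PartitionDiagram n → M) (d : PartitionDiagram n) :
    linearLift f (diag x d) = f d := by
  change Finsupp.linearCombination k f (Finsupp.single d 1) = f d
  simp

theorem linear_ext {M : Type*} [AddCommGroup M] [Module k M]
    {f g : PartitionAlgebra k n x →ₗ[k] M} (h : ∀ d, f (diag x d) = g (diag x d)) : f = g :=
  Finsupp.lhom_ext' fun d => LinearMap.ext_ring (h d)

/-- The product, as a bilinear map: `d * d' = x ^ r • d''`, where `d''` is the straightened
concatenation and `r` is the number of removed parts. -/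
noncomputable def mulHom :
    PartitionAlgebra k n x →ₗ[k] PartitionAlgebra k n x →ₗ[k] PartitionAlgebra k n x :=
  linearLift fun d => linearLift fun d' => x ^ loops d d' • diag x (comp d d')

theorem mulHom_diag (d d' : PartitionDiagram n) :
    mulHom (diag x d) (diag x d') = x ^ loops d d' • diag x (comp d d') := by
  rw [mulHom, linearLift_diag, linearLift_diag]

theorem mulHom_assoc (p q r : PartitionAlgebra k n x) :
    mulHom (mulHom p q) r = mulHom p (mulHom q r) := by
  have h1 : ∀ (d d' : PartitionDiagram n) (r : PartitionAlgebra k n x),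
      mulHom (mulHom (diag x d) (diag x d')) r =
      mulHom (diag x d) (mulHom (diag x d') r) := fun d d' r => by
    refine LinearMap.congr_fun (f := mulHom (mulHom (diag x d) (diag x d')))
      (g := (mulHom (diag x d)).comp (mulHom (diag x d'))) (linear_ext fun d'' => ?_) r
    obtain ⟨hc, hl⟩ := comp_loops_assoc d d' d''
    simp only [LinearMap.comp_apply, mulHom_diag, map_smul, LinearMap.smul_apply, smul_smul,
      ← pow_add, hc, hl]
  have h2 : ∀ (d : PartitionDiagram n) (q r : PartitionAlgebra k n x),
      mulHom (mulHom (diag x d) q) r = mulHom (diag x d) (mulHom q r) :=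
    fun d q r => LinearMap.congr_fun (f := (mulHom.flip r).comp (mulHom (diag x d)))
      (g := (mulHom (diag x d)).comp (mulHom.flip r)) (linear_ext fun d' => h1 d d' r) q
  exact LinearMap.congr_fun (f := (mulHom.flip r).comp (mulHom.flip q))
    (g := mulHom.flip (mulHom q r)) (linear_ext fun d => h2 d q r) p

theorem one_mulHom (p : PartitionAlgebra k n x) : mulHom (diag x (idDiagram n)) p = p := by
  refine LinearMap.congr_fun (f := mulHom (diag x (idDiagram n))) (g := LinearMap.id)
    (linear_ext fun d => ?_) p
  rw [mulHom_diag, (id_comp_loops d).1, (id_comp_loops d).2, pow_zero, one_smul,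
    LinearMap.id_apply]

theorem mulHom_one (p : PartitionAlgebra k n x) : mulHom p (diag x (idDiagram n)) = p := by
  refine LinearMap.congr_fun (f := mulHom.flip (diag x (idDiagram n))) (g := LinearMap.id)
    (linear_ext fun d => ?_) p
  rw [LinearMap.flip_apply, mulHom_diag, (comp_id_loops d).1, (comp_id_loops d).2, pow_zero,
    one_smul, LinearMap.id_apply]

noncomputable instance : Ring (PartitionAlgebra k n x) :=
  { (inferInstance : AddCommGroup (PartitionAlgebra k n x)) with
    mul := fun p q => mulHom p q
    one := diag x (idDiagram n)
    left_distrib := fun p q r => map_add (mulHom p) q r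
    right_distrib := fun p q r => LinearMap.map_add₂ mulHom p q r
    zero_mul := fun p => LinearMap.map_zero₂ mulHom p
    mul_zero := fun p => map_zero (mulHom p)
    mul_assoc := mulHom_assoc
    one_mul := one_mulHom
    mul_one := mulHom_one }

noncomputable instance : Algebra k (PartitionAlgebra k n x) :=
  Algebra.ofModule (fun c p q => LinearMap.map_smul₂ mulHom c p q)
    (fun c p q => map_smul (mulHom p) c q)

theorem one_def : (1 : PartitionAlgebra k n x) = diag x (idDiagram n) := rfl

theorem diag_mul_diag (d d' : PartitionDiagram n) :
    diag x d * diag x d' = x ^ loops d d' • diag x (comp d d') := mulHom_diag d d'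

/-- A map on diagrams which respects the defining multiplication rule extends to a homomorphism
of algebras. -/
noncomputable def lift {A : Type*} [Ring A] [Algebra k A] (f : PartitionDiagram n → A)
    (h1 : f (idDiagram n) = 1)
    (hmul : ∀ d d', x ^ loops d d' • f (comp d d') = f d * f d') :
    PartitionAlgebra k n x →ₐ[k] A :=
  AlgHom.ofLinearMap (linearLift f) (by rw [one_def, linearLift_diag, h1]) (by
    intro p q
    refine LinearMap.congr_fun (f := (linearLift f).comp ((LinearMap.mul k _).flip q))
      (g := ((LinearMap.mul k A).flip (linearLift f q)).comp (linearLift f))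
      (linear_ext fun d => ?_) p
    refine LinearMap.congr_fun (f := (linearLift f).comp (LinearMap.mul k _ (diag x d)))
      (g := (LinearMap.mul k A (linearLift f (diag x d))).comp (linearLift f))
      (linear_ext fun d' => ?_) q
    simp only [LinearMap.comp_apply, LinearMap.mul_apply', diag_mul_diag, map_smul,
      linearLift_diag, hmul])

theorem lift_diag {A : Type*} [Ring A] [Algebra k A] (f : PartitionDiagram n → A)
    (h1 : f (idDiagram n) = 1)
    (hmul : ∀ d d', x ^ loops d d' • f (comp d d') = f d * f d') (d : PartitionDiagram n) :
    lift f h1 hmul (diag x d) = f d := linearLift_diag f d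

/-- The generalized comultiplication `P_n(ab) → P_n(a) ⊗ P_n(b)`, `d ↦ d ⊗ d`. -/
noncomputable def comul (k : Type*) [Field k] (n : ℕ) (a b : k) :
    PartitionAlgebra k n (a * b) →ₐ[k] PartitionAlgebra k n a ⊗[k] PartitionAlgebra k n b :=
  lift (fun d => diag a d ⊗ₜ[k] diag b d) rfl (fun d d' => by
    rw [Algebra.TensorProduct.tmul_mul_tmul, diag_mul_diag, diag_mul_diag,
      TensorProduct.smul_tmul_smul, mul_pow])

/-- The representation of `P_n(a) ⊗ P_n(b)` on `X ⊗ Y`. -/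
noncomputable def outerTensor {k : Type*} [Field k] (n : ℕ) (a b : k) (X Y : Type*)
    [AddCommGroup X] [Module k X] [Module (PartitionAlgebra k n a) X]
    [IsScalarTower k (PartitionAlgebra k n a) X]
    [AddCommGroup Y] [Module k Y] [Module (PartitionAlgebra k n b) Y]
    [IsScalarTower k (PartitionAlgebra k n b) Y] :
    PartitionAlgebra k n a ⊗[k] PartitionAlgebra k n b →ₐ[k] Module.End k (X ⊗[k] Y) :=
  (Module.endTensorEndAlgHom (R := k) (S := k) (A := k) (M := X) (N := Y)).comp
    (Algebra.TensorProduct.map (Algebra.lsmul k k X) (Algebra.lsmul k k Y))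

/-- The `P_n(ab)`-module structure on `X ⊗ Y`, pulled back along `d ↦ d ⊗ d`. -/
noncomputable abbrev tensorModule {k : Type*} [Field k] (n : ℕ) (a b : k) (X Y : Type*)
    [AddCommGroup X] [Module k X] [Module (PartitionAlgebra k n a) X]
    [IsScalarTower k (PartitionAlgebra k n a) X]
    [AddCommGroup Y] [Module k Y] [Module (PartitionAlgebra k n b) Y]
    [IsScalarTower k (PartitionAlgebra k n b) Y] :
    Module (PartitionAlgebra k n (a * b)) (X ⊗[k] Y) :=
  Module.compHom (X ⊗[k] Y) ((outerTensor n a b X Y).comp (comul k n a b)).toRingHom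

end PartitionAlgebra

/-! ### Cell modules, Specht modules and standard modules -/

/-- The linearization of the left cell of `proj n i`. -/
def CellModule (k : Type*) [Field k] (n i : ℕ) (_x : k) : Type _ := LeftCell n i →₀ k

namespace CellModule

variable {k : Type*} [Field k] {n i : ℕ} {x : k}

noncomputable instance : AddCommGroup (CellModule k n i x) :=
  inferInstanceAs (AddCommGroup (LeftCell n i →₀ k))

noncomputable instance : Module k (CellModule k n i x) :=
  inferInstanceAs (Module k (LeftCell n i →₀ k))

/-- The basis element of an element of the left cell. -/
noncomputable def basisElem (x : k) (l : LeftCell n i) : CellModule k n i x :=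
  Finsupp.single l 1

open Classical in
/-- The action of a diagram on a basis element: concatenation as in the partition algebra, with
result zero if the left cell is left, i.e. if the rank drops. -/
noncomputable def actBasis (x : k) (d : PartitionDiagram n) (l : LeftCell n i) :
    CellModule k n i x :=
  if h : (comp d l.1).rank = i then
    x ^ loops d l.1 • basisElem x ⟨comp d l.1, comp_mem_leftCell d l h⟩
  else 0

/-- The action of a diagram. -/
noncomputable def act (x : k) (d : PartitionDiagram n) : Module.End k (CellModule k n i x) :=
  Finsupp.linearCombination k (actBasis x d)

theorem act_basisElem (d : PartitionDiagram n) (l : LeftCell n i) :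
    act x d (basisElem x l) = actBasis x d l := by
  change Finsupp.linearCombination k (actBasis x d) (Finsupp.single l 1) = _
  simp

theorem linear_ext {M : Type*} [AddCommGroup M] [Module k M]
    {f g : CellModule k n i x →ₗ[k] M} (h : ∀ l, f (basisElem x l) = g (basisElem x l)) :
    f = g :=
  Finsupp.lhom_ext' fun l => LinearMap.ext_ring (h l)

theorem act_id : act x (idDiagram n) = (1 : Module.End k (CellModule k n i x)) := by
  refine linear_ext fun l => ?_
  obtain ⟨h1, h2⟩ := id_comp_loops l.1
  rw [act_basisElem, actBasis, dif_pos (by rw [h1]; exact l.2.1), h2, pow_zero, one_smul]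
  exact congrArg (basisElem x) (Subtype.ext h1)

theorem act_mul (d d' : PartitionDiagram n) :
    x ^ loops d d' • act x (comp d d') =
      (act x d * act x d' : Module.End k (CellModule k n i x)) := by
  refine linear_ext fun l => ?_
  obtain ⟨hc, hl⟩ := comp_loops_assoc d d' l.1
  rw [LinearMap.smul_apply, Module.End.mul_apply, act_basisElem, act_basisElem]
  by_cases h' : (comp d' l.1).rank = i
  · rw [actBasis, actBasis, dif_pos h', map_smul, act_basisElem, actBasis]
    by_cases h : (comp d (comp d' l.1)).rank = i
    · rw [dif_pos (by rw [hc]; exact h), dif_pos h, smul_smul, smul_smul, ← pow_add, ← pow_add,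
        hl]
      exact congrArg _ (congrArg (basisElem x) (Subtype.ext hc))
    · rw [dif_neg (by rw [hc]; exact h), dif_neg h, smul_zero, smul_zero]
  · have h : ¬ (comp (comp d d') l.1).rank = i := by
      intro h
      rw [hc] at h
      refine h' (le_antisymm ((rank_comp_le d' l.1).trans l.2.1.le) ?_)
      exact h.symm.le.trans (rank_comp_le _ _)
    rw [actBasis, actBasis, dif_neg h', dif_neg h, map_zero, smul_zero]

/-- The representation of the partition algebra on the cell module. -/
noncomputable def rep (k : Type*) [Field k] (n i : ℕ) (x : k) :
    PartitionAlgebra k n x →ₐ[k] Module.End k (CellModule k n i x) :=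
  PartitionAlgebra.lift (act x) act_id act_mul

noncomputable instance : Module (PartitionAlgebra k n x) (CellModule k n i x) :=
  Module.compHom (CellModule k n i x) (rep k n i x).toRingHom

theorem smul_def (p : PartitionAlgebra k n x) (v : CellModule k n i x) :
    p • v = rep k n i x p v := rfl

instance : IsScalarTower k (PartitionAlgebra k n x) (CellModule k n i x) :=
  ⟨fun c p v => by rw [smul_def, smul_def, map_smul, LinearMap.smul_apply]⟩

instance : SMulCommClass (PartitionAlgebra k n x) k (CellModule k n i x) :=
  ⟨fun p c v => by rw [smul_def, smul_def, map_smul]⟩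

end CellModule

section Specht

variable (k : Type*) [Field k] {i : ℕ} {lam : YoungDiagram}

open Classical in
/-- The Young symmetrizer of a bijective tableau `t` of shape `lam`: the signed sum over the column
stabilizer of `t` times the sum over the row stabilizer of `t`. -/
noncomputable def youngSymmetrizer (t : lam.cells ≃ Fin i) :
    MonoidAlgebra k (Equiv.Perm (Fin i)) :=
  (∑ σ : Equiv.Perm (Fin i) with ∀ j, (t.symm (σ j)).1.2 = (t.symm j).1.2,
      MonoidAlgebra.single σ (((Equiv.Perm.sign σ : ℤˣ) : ℤ) : k)) *
    ∑ ρ : Equiv.Perm (Fin i) with ∀ j, (t.symm (ρ j)).1.1 = (t.symm j).1.1,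
      MonoidAlgebra.single ρ (1 : k)

/-- The Specht module of shape `lam`, realized (by means of a tableau `t` of shape `lam`) as the left
ideal generated by the Young symmetrizer. This is the span of the polytabloids inside the
permutation module on tabloids, the latter being the left ideal generated by the sum over the
row stabilizer. -/
noncomputable abbrev Specht (t : lam.cells ≃ Fin i) :
    Submodule (MonoidAlgebra k (Equiv.Perm (Fin i))) (MonoidAlgebra k (Equiv.Perm (Fin i))) :=
  Submodule.span _ {youngSymmetrizer k t}

end Specht

section Standard

variable (k : Type*) [Field k] {n i : ℕ} (x : k) {lam : YoungDiagram}

/-- The relations `l σ ⊗ v - l ⊗ σ v` in `k[L] ⊗ₖ S` defining the tensor product over the group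
algebra of `S_i`. Here `S_i` acts on the left cell `L` on the right by concatenation with
permutation diagrams, permuting the first `i` points (the ends of the propagating lines). -/
def balancingRelations (hi : i ≤ n) (t : lam.cells ≃ Fin i) :
    Set (CellModule k n i x ⊗[k] Specht k t) :=
  {z | ∃ (l l' : LeftCell n i) (σ : Equiv.Perm (Fin i)) (v : Specht k t),
    l'.1 = comp l.1 (ofPerm (σ.viaFintypeEmbedding (Fin.castLEEmb hi))) ∧
    z = CellModule.basisElem x l' ⊗ₜ[k] v -
      CellModule.basisElem x l ⊗ₜ[k] (MonoidAlgebra.single σ (1 : k) • v)}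

/-- The standard module `k[L] ⊗_{k[S_i]} S`, where `L` is the left cell of rank `i` and `S` is the
Specht module of shape `lam`, with the action of the partition algebra on the left factor. -/
abbrev StandardModule (hi : i ≤ n) (t : lam.cells ≃ Fin i) : Type _ :=
  (CellModule k n i x ⊗[k] Specht k t) ⧸
    Submodule.span (PartitionAlgebra k n x) (balancingRelations k x hi t)

end Standard

/-- A standard filtration of a module over the partition algebra: a finite filtration by submodules
whose subquotients are isomorphic to standard modules. -/
def HasStandardFiltration (k : Type*) [Field k] (n : ℕ) (x : k) (M : Type*) [AddCommGroup M]
    [Module (PartitionAlgebra k n x) M] : Prop :=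
  ∃ (m : ℕ) (F : Fin (m + 1) → Submodule (PartitionAlgebra k n x) M),
    Monotone F ∧ F 0 = ⊥ ∧ F (Fin.last m) = ⊤ ∧
    ∀ j : Fin m, ∃ (i : ℕ) (hi : i ≤ n) (lam : YoungDiagram) (t : lam.cells ≃ Fin i),
      Nonempty ((F j.succ ⧸ (F j.castSucc).submoduleOf (F j.succ)) ≃ₗ[PartitionAlgebra k n x]
        StandardModule k x hi t)

/-! Tensoring over a field is exact, and modules with a standard filtration are closed under
extensions, so it suffices to treat the tensor product of two standard modules. In characteristic
zero a Specht module is a left ideal generated by an idempotent; hence a standard module is a direct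
summand of a cell module, and the tensor product of two standard modules is a direct summand of `M`,
the tensor product of two cell modules. The module `M` has a basis of pairs of diagrams, on which
diagrams act by concatenation up to nonzero scalars; a result that leaves the index set counts as
zero.

Write `d_i` for `proj n i` and filter every module by the submodules `rankPart` generated by the
images of the `d_i` with `i < m`. Choose one representative `r_c` for each orbit of `S_m` on the
left cell of `d_m`. The decisive property is `IsLayered`: if `∑ r_c w_c` lies in step `m` of the
filtration, then so does every `d_m w_c`. It says that each layer is as free over the left cell as
an induced module. By functoriality of the rank filtration it passes to direct summands
(`IsLayered.of_retract`), even though these need not have a basis of diagrams.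

A layered finite-dimensional module has a standard filtration (`hasStandardFiltration_of_layer`). In
a nonzero layer some Young symmetrizer does not kill some suitable `w` in the image of `d_m`. As
Specht modules are simple, `l ⊗ v ↦ l v w` is an injection of a standard module. The quotient is
again free in the above sense, and induction on the dimension applies. The facts on symmetric groups
are proved by the classical arguments with dominance and Young symmetrizers.

That `M` is layered is combinatorics (`IsMonomial.isLayered`). Call a part of the common refinement
of the output rows of a pair live if its points are not `Dead`. Step `m` of the rank filtration is
spanned by the pairs with fewer than `m` live parts. If `r` in the left cell of `d_m` carries a pair
`q` to a pair with exactly `m` live parts, the result determines the orbit of `r`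
(`key_eq_of_liveRank`). If moreover `d_m` fixes `q`, the reflection of `r` recovers `q`. So no
cancellation occurs in `∑ r_c w_c` modulo step `m`. -/

/-! ### Young tableaux -/

namespace YoungDiagram

variable {m : ℕ} {lam mu : YoungDiagram}

/-- The row of an entry of a tableau. -/
def rowOf (t : lam.cells ≃ Fin m) (x : Fin m) : ℕ := (t.symm x).1.1

/-- The column of an entry of a tableau. -/
def colOf (t : lam.cells ≃ Fin m) (x : Fin m) : ℕ := (t.symm x).1.2

theorem rowOf_colOf_mem (t : lam.cells ≃ Fin m) (x : Fin m) : (rowOf t x, colOf t x) ∈ lam :=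
  (YoungDiagram.mem_cells _).1 (t.symm x).2

theorem eq_of_rowOf_colOf (t : lam.cells ≃ Fin m) {x y : Fin m} (h1 : rowOf t x = rowOf t y)
    (h2 : colOf t x = colOf t y) : x = y :=
  t.symm.injective (Subtype.ext (Prod.ext h1 h2))

/-- The number of cells in the first `r` rows. -/
def headCard (lam : YoungDiagram) (r : ℕ) : ℕ := (lam.cells.filter fun c => c.1 < r).card

theorem card_rowOf_lt (t : lam.cells ≃ Fin m) (r : ℕ) :
    (Finset.univ.filter fun x => rowOf t x < r).card = lam.headCard r := by
  refine Finset.card_bij (fun x _ => (t.symm x).1) ?_ ?_ ?_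
  · intro x hx
    rw [Finset.mem_filter] at hx ⊢
    exact ⟨(t.symm x).2, hx.2⟩
  · intro x _ y _ h
    exact t.symm.injective (Subtype.ext h)
  · intro c hc
    rw [Finset.mem_filter] at hc
    exact ⟨t ⟨c, hc.1⟩, Finset.mem_filter.2 ⟨Finset.mem_univ _, by simpa [rowOf] using hc.2⟩,
      by simp⟩

theorem card_head_col (lam : YoungDiagram) (r c : ℕ) :
    ((lam.cells.filter fun p => p.1 < r).filter fun p => p.2 = c).card = min r (lam.colLen c) := by
  rw [← Finset.card_range (min r (lam.colLen c))]
  refine Finset.card_bij (fun p _ => p.1) ?_ ?_ ?_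
  · rintro ⟨i, j⟩ h
    simp only [Finset.mem_filter, mem_cells] at h
    obtain ⟨⟨h1, h2⟩, rfl⟩ := h
    rw [Finset.mem_range, lt_min_iff]
    exact ⟨h2, mem_iff_lt_colLen.1 h1⟩
  · rintro ⟨i, j⟩ h ⟨i', j'⟩ h' hh
    simp only [Finset.mem_filter] at h h'
    exact Prod.ext hh (h.2.trans h'.2.symm)
  · intro i hi
    rw [Finset.mem_range, lt_min_iff] at hi
    refine ⟨(i, c), ?_, rfl⟩
    simp only [Finset.mem_filter, mem_cells, and_true]
    exact ⟨mem_iff_lt_colLen.2 hi.2, hi.1⟩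

/-! ### The dominance order on shapes -/

section Dominance

variable {t : lam.cells ≃ Fin m} {s : mu.cells ≃ Fin m}

/-- Each of the first `r` rows of `t` contributes at most one entry to a given column of `s`, and
that column has only `mu.colLen c` cells. -/
theorem card_fiber_le
    (h : ∀ x y, x ≠ y → rowOf t x = rowOf t y → colOf s x ≠ colOf s y) (r c : ℕ) :
    ((Finset.univ.filter fun x => rowOf t x < r).filter fun x => colOf s x = c).card ≤
      min r (mu.colLen c) := by
  refine le_min ?_ ?_
  · rw [← Finset.card_range r]
    refine Finset.card_le_card_of_injOn (rowOf t) ?_ ?_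
    · intro x hx
      simp only [Finset.coe_filter, Finset.mem_filter, Set.mem_ofPred_eq] at hx
      simpa using hx.1.2
    · intro x hx y hy hxy
      simp only [Finset.coe_filter, Finset.mem_filter, Set.mem_ofPred_eq] at hx hy
      by_contra hne
      exact h x y hne hxy (hx.2.trans hy.2.symm)
  · rw [← Finset.card_range (mu.colLen c)]
    refine Finset.card_le_card_of_injOn (rowOf s) ?_ ?_
    · intro x hx
      simp only [Finset.coe_filter, Finset.mem_filter, Set.mem_ofPred_eq] at hx
      have := rowOf_colOf_mem s x
      rw [hx.2] at this
      simpa using mem_iff_lt_colLen.1 this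
    · intro x hx y hy hxy
      simp only [Finset.coe_filter, Finset.mem_filter, Set.mem_ofPred_eq] at hx hy
      exact eq_of_rowOf_colOf s hxy (hx.2.trans hy.2.symm)

theorem headCard_eq_sum (mu : YoungDiagram) (r : ℕ) :
    mu.headCard r = ∑ c ∈ mu.cells.image Prod.snd, min r (mu.colLen c) := by
  rw [headCard, Finset.card_eq_sum_card_fiberwise (f := Prod.snd) (t := mu.cells.image Prod.snd)]
  · exact Finset.sum_congr rfl fun c _ => card_head_col mu r c
  · intro p hp
    simp only [Finset.coe_filter, Set.mem_ofPred_eq] at hp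
    exact Finset.mem_coe.2 (Finset.mem_image_of_mem _ hp.1)

theorem headCard_eq_sum_fiber (t : lam.cells ≃ Fin m) (s : mu.cells ≃ Fin m) (r : ℕ) :
    lam.headCard r = ∑ c ∈ mu.cells.image Prod.snd,
      ((Finset.univ.filter fun x => rowOf t x < r).filter fun x => colOf s x = c).card := by
  rw [← card_rowOf_lt t, Finset.card_eq_sum_card_fiberwise (f := colOf s)]
  intro x _
  exact Finset.mem_coe.2 (Finset.mem_image_of_mem _ (s.symm x).2)

/-- Sum the bound of `card_fiber_le` over the columns of `mu`; the right-hand sides add up to the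
number of cells in the first `r` rows of `mu`. -/
theorem headCard_le
    (h : ∀ x y, x ≠ y → rowOf t x = rowOf t y → colOf s x ≠ colOf s y) (r : ℕ) : lam.headCard r ≤ mu.headCard r := by
  rw [headCard_eq_sum_fiber t s, headCard_eq_sum]
  exact Finset.sum_le_sum fun c _ => card_fiber_le h r c

end Dominance

theorem headCard_succ (lam : YoungDiagram) (r : ℕ) :
    lam.headCard (r + 1) = lam.headCard r + lam.rowLen r := by
  rw [headCard, headCard, rowLen_eq_card, ← Finset.card_union_of_disjoint]
  · congr 1
    ext c
    simp only [Finset.mem_filter, Finset.mem_union, mem_row_iff, mem_cells, Nat.lt_succ_iff_lt_or_eq]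
    tauto
  · rw [Finset.disjoint_left]
    intro c hc hc'
    rw [Finset.mem_filter] at hc
    rw [mem_row_iff] at hc'
    exact hc.2.ne hc'.2

theorem eq_of_headCard (h : ∀ r, lam.headCard r = mu.headCard r) : lam = mu := by
  have h1 : ∀ r, lam.rowLen r = mu.rowLen r := fun r => by
    have := headCard_succ lam r
    have := headCard_succ mu r
    have := h r
    have := h (r + 1)
    omega
  refine YoungDiagram.ext (Finset.ext ?_)
  rintro ⟨i, j⟩
  rw [mem_cells, mem_cells, mem_iff_lt_rowLen, mem_iff_lt_rowLen, h1]

/-- If no two entries share a row of `t` and a column of `t ∘ g`, then `g` is the product of a row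
permutation and a column permutation of `t`. -/
theorem exists_row_perm (t : lam.cells ≃ Fin m) (g : Equiv.Perm (Fin m))
    (h : ∀ x y, x ≠ y → rowOf t x = rowOf t y → colOf t (g⁻¹ x) ≠ colOf t (g⁻¹ y)) :
    ∃ p : Equiv.Perm (Fin m), (∀ x, rowOf t (p x) = rowOf t x) ∧
      ∀ x, colOf t ((p * g) x) = colOf t x := by
  have hs : ∀ x, colOf (t.trans g) x = colOf t (g⁻¹ x) := fun x => rfl
  have h' : ∀ x y, x ≠ y → rowOf t x = rowOf t y → colOf (t.trans g) x ≠ colOf (t.trans g) y := h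
  have hmem : ∀ x, (rowOf t x, colOf t (g⁻¹ x)) ∈ lam := by
    intro x
    -- Both tableaux have shape `lam`, so the column bounds add up to an equality and each of them
    -- is sharp.
    have heq : ∀ r, ∀ c ∈ lam.cells.image Prod.snd,
        ((Finset.univ.filter fun x => rowOf t x < r).filter
          fun x => colOf (t.trans g) x = c).card = min r (lam.colLen c) := by
      intro r
      refine (Finset.sum_eq_sum_iff_of_le fun c _ => card_fiber_le h' r c).1 ?_
      rw [← headCard_eq_sum_fiber t (t.trans g), headCard_eq_sum]
    -- If the cell were outside `lam`, the counts for `rowOf t x` and `rowOf t x + 1` rows would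
    -- both equal the column length, although `x` is counted only in the second.
    by_contra hn
    have hc : colOf t (g⁻¹ x) ∈ lam.cells.image Prod.snd :=
      Finset.mem_image_of_mem _ (t.symm (g⁻¹ x)).2
    have h1 := heq (rowOf t x) _ hc
    have h2 := heq (rowOf t x + 1) _ hc
    rw [mem_iff_lt_colLen, not_lt] at hn
    rw [min_eq_right hn] at h1
    rw [min_eq_right (by omega), ← h1] at h2
    have hsub : ((Finset.univ.filter fun y => rowOf t y < rowOf t x).filter
          fun y => colOf (t.trans g) y = colOf t (g⁻¹ x)) ⊆
        ((Finset.univ.filter fun y => rowOf t y < rowOf t x + 1).filter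
          fun y => colOf (t.trans g) y = colOf t (g⁻¹ x)) := by
      intro y hy
      simp only [Finset.mem_filter, Finset.mem_univ, true_and] at hy ⊢
      exact ⟨by omega, hy.2⟩
    have h3 := Finset.eq_of_subset_of_card_le hsub h2.le
    have h4 : x ∈ ((Finset.univ.filter fun y => rowOf t y < rowOf t x + 1).filter
          fun y => colOf (t.trans g) y = colOf t (g⁻¹ x)) := by
      simp [hs]
    rw [← h3] at h4
    simp at h4
  -- The permutation `p` moves `x` within its row of `t` to the column that `g⁻¹ x` occupies; the
  -- hypothesis makes this injective.
  have hinj : Function.Injective fun x =>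
      t ⟨(rowOf t x, colOf t (g⁻¹ x)), (mem_cells _).2 (hmem x)⟩ := by
    intro x y hxy
    have := Subtype.ext_iff.1 (t.injective hxy)
    obtain ⟨h1, h2⟩ := Prod.ext_iff.1 this
    by_contra hne
    exact h x y hne h1 h2
  refine ⟨Equiv.ofBijective _ (Finite.injective_iff_bijective.1 hinj), fun x => ?_, fun x => ?_⟩
  · simp [rowOf]
  · simp [colOf]

end YoungDiagram

/-! ### Young symmetrizers and Specht modules -/

namespace YoungDiagram

open MonoidAlgebra (single)

variable (k : Type*) [Field k] {m : ℕ} {lam mu : YoungDiagram}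

open Classical in
/-- The sum over the row stabilizer of a tableau. -/
noncomputable def rowSum (t : lam.cells ≃ Fin m) : MonoidAlgebra k (Equiv.Perm (Fin m)) :=
  ∑ ρ : Equiv.Perm (Fin m) with ∀ j, (t.symm (ρ j)).1.1 = (t.symm j).1.1, single ρ (1 : k)

open Classical in
/-- The signed sum over the column stabilizer of a tableau. -/
noncomputable def colSum (t : lam.cells ≃ Fin m) : MonoidAlgebra k (Equiv.Perm (Fin m)) :=
  ∑ σ : Equiv.Perm (Fin m) with ∀ j, (t.symm (σ j)).1.2 = (t.symm j).1.2,
    single σ (((Equiv.Perm.sign σ : ℤˣ) : ℤ) : k)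

theorem youngSymmetrizer_eq (t : lam.cells ≃ Fin m) :
    youngSymmetrizer k t = colSum k t * rowSum k t := rfl

theorem rowSum_mul_single (t : lam.cells ≃ Fin m) (p : Equiv.Perm (Fin m))
    (hp : ∀ x, rowOf t (p x) = rowOf t x) : rowSum k t * single p 1 = rowSum k t := by
  classical
  rw [rowSum, Finset.sum_mul]
  refine Finset.sum_equiv (Equiv.mulRight p) (fun ρ => ?_) fun ρ _ => ?_
  · simp only [Finset.mem_filter, Finset.mem_univ, true_and, Equiv.coe_mulRight,
      Equiv.Perm.mul_apply]
    refine ⟨fun h j => (h (p j)).trans (hp j), fun h j => ?_⟩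
    have h1 := h (p.symm j)
    have h2 : (t.symm (p (p.symm j))).1.1 = (t.symm (p.symm j)).1.1 := hp (p.symm j)
    rw [p.apply_symm_apply] at h1 h2
    exact h1.trans h2.symm
  · rw [MonoidAlgebra.single_mul_single, mul_one, Equiv.coe_mulRight]

theorem single_mul_colSum (t : lam.cells ≃ Fin m) (q : Equiv.Perm (Fin m))
    (hq : ∀ x, colOf t (q x) = colOf t x) :
    single q 1 * colSum k t = (((Equiv.Perm.sign q : ℤˣ) : ℤ) : k) • colSum k t := by
  classical
  rw [colSum, Finset.mul_sum, Finset.smul_sum]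
  refine Finset.sum_equiv (Equiv.mulLeft q) (fun ρ => ?_) fun ρ _ => ?_
  · simp only [Finset.mem_filter, Finset.mem_univ, true_and, Equiv.coe_mulLeft,
      Equiv.Perm.mul_apply]
    exact forall_congr' fun j => ⟨fun h => (hq _).trans h, fun h => (hq _).symm.trans h⟩
  · rw [MonoidAlgebra.single_mul_single, one_mul, Equiv.coe_mulLeft, MonoidAlgebra.smul_single,
      smul_eq_mul, Equiv.Perm.sign_mul, Units.val_mul, Int.cast_mul, ← mul_assoc]
    have : (((Equiv.Perm.sign q : ℤˣ) : ℤ) : k) * (((Equiv.Perm.sign q : ℤˣ) : ℤ) : k) = 1 := by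
      rw [← Int.cast_mul, ← Units.val_mul, Int.units_mul_self, Units.val_one, Int.cast_one]
    rw [this, one_mul]

/-- The transposition of `x` and `y` is absorbed by the row sum. Moved past `g`, it becomes a
transposition in the column stabilizer of `s` and produces the sign `-1`. So the product equals its
own negative. -/
theorem rowSum_mul_single_mul_colSum_eq_zero [CharZero k] (t : lam.cells ≃ Fin m)
    (s : mu.cells ≃ Fin m) (g : Equiv.Perm (Fin m)) {x y : Fin m} (hxy : x ≠ y)
    (hr : rowOf t x = rowOf t y) (hc : colOf s (g⁻¹ x) = colOf s (g⁻¹ y)) :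
    rowSum k t * single g 1 * colSum k s = 0 := by
  have h1 : rowSum k t * single (Equiv.swap x y) 1 = rowSum k t := by
    refine rowSum_mul_single k t _ fun z => ?_
    by_cases h1 : z = x
    · rw [h1, Equiv.swap_apply_left, hr]
    by_cases h2 : z = y
    · rw [h2, Equiv.swap_apply_right, hr]
    · rw [Equiv.swap_apply_of_ne_of_ne h1 h2]
  have h2 : single (Equiv.swap (g⁻¹ x) (g⁻¹ y)) 1 * colSum k s = - colSum k s := by
    rw [single_mul_colSum, Equiv.Perm.sign_swap (fun h => hxy (g⁻¹.injective h))]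
    · simp
    · intro z
      by_cases h1 : z = g⁻¹ x
      · rw [h1, Equiv.swap_apply_left, hc]
      by_cases h2 : z = g⁻¹ y
      · rw [h2, Equiv.swap_apply_right, hc]
      · rw [Equiv.swap_apply_of_ne_of_ne h1 h2]
  have h3 : rowSum k t * single g 1 * colSum k s = - (rowSum k t * single g 1 * colSum k s) := by
    conv_lhs => rw [← h1]
    rw [mul_assoc (rowSum k t), MonoidAlgebra.single_mul_single, Equiv.swap_mul_eq_mul_swap,
      ← MonoidAlgebra.single_mul_single, ← mul_assoc, mul_assoc _ _ (colSum k s), h2, mul_neg]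
  have h4 : (2 : k) • (rowSum k t * single g 1 * colSum k s) = 0 := by
    rw [two_smul]
    nth_rewrite 1 [h3]
    exact neg_add_cancel _
  exact (smul_eq_zero.1 h4).resolve_left two_ne_zero

theorem headCard_le_of_mul_ne_zero [CharZero k] (t : lam.cells ≃ Fin m) (s : mu.cells ≃ Fin m)
    (g : Equiv.Perm (Fin m)) (h : rowSum k t * single g 1 * colSum k s ≠ 0) (r : ℕ) :
    lam.headCard r ≤ mu.headCard r := by
  refine headCard_le (t := t) (s := s.trans g) (fun x y hxy hr hc => h ?_) r
  exact rowSum_mul_single_mul_colSum_eq_zero k t s g hxy hr hc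

/-- Von Neumann's lemma. For a group element `g`, either two entries share a row of `t` and a column
of `t ∘ g`, and the product vanishes, or `p * g` is a column permutation for some row permutation
`p`, and the product is `sign (p * g)` times `rowSum * colSum`. -/
theorem exists_rowSum_mul_colSum [CharZero k] (t : lam.cells ≃ Fin m)
    (u : MonoidAlgebra k (Equiv.Perm (Fin m))) :
    ∃ c : k, rowSum k t * u * colSum k t = c • (rowSum k t * colSum k t) := by
  induction u using MonoidAlgebra.induction_on with
  | of g =>
    rw [MonoidAlgebra.of_apply]
    by_cases h : ∀ x y, x ≠ y → rowOf t x = rowOf t y → colOf t (g⁻¹ x) ≠ colOf t (g⁻¹ y)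
    · obtain ⟨p, hp, hq⟩ := exists_row_perm t g h
      refine ⟨(((Equiv.Perm.sign (p * g) : ℤˣ) : ℤ) : k), ?_⟩
      rw [← rowSum_mul_single k t p hp, mul_assoc (rowSum k t), MonoidAlgebra.single_mul_single,
        one_mul, mul_assoc (rowSum k t), single_mul_colSum k t _ hq,
        rowSum_mul_single k t p hp, mul_smul_comm]
    · push Not at h
      obtain ⟨x, y, hxy, hr, hc⟩ := h
      exact ⟨0, by rw [rowSum_mul_single_mul_colSum_eq_zero k t t g hxy hr hc, zero_smul]⟩
  | add u v hu hv =>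
    obtain ⟨c, hc⟩ := hu
    obtain ⟨d, hd⟩ := hv
    exact ⟨c + d, by rw [mul_add, add_mul, hc, hd, add_smul]⟩
  | smul r u hu =>
    obtain ⟨c, hc⟩ := hu
    exact ⟨r * c, by rw [mul_smul_comm, smul_mul_assoc, hc, smul_smul]⟩

theorem exists_youngSymmetrizer_mul_mul [CharZero k] (t : lam.cells ≃ Fin m)
    (u : MonoidAlgebra k (Equiv.Perm (Fin m))) :
    ∃ c : k, youngSymmetrizer k t * u * youngSymmetrizer k t =
      c • (youngSymmetrizer k t * youngSymmetrizer k t) := by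
  obtain ⟨c, hc⟩ := exists_rowSum_mul_colSum k t u
  refine ⟨c, ?_⟩
  have : youngSymmetrizer k t * u * youngSymmetrizer k t =
      colSum k t * (rowSum k t * u * colSum k t) * rowSum k t := by
    simp only [youngSymmetrizer_eq, mul_assoc]
  rw [this, hc]
  simp only [youngSymmetrizer_eq, mul_assoc, mul_smul_comm, smul_mul_assoc]

/-- The row and column stabilizers meet only in the identity, so `1` arises just once in the
product. -/
theorem coeff_one_youngSymmetrizer (t : lam.cells ≃ Fin m) :
    (youngSymmetrizer k t).coeff 1 = 1 := by
  classical
  rw [youngSymmetrizer_eq, colSum, Finset.sum_mul, MonoidAlgebra.coeff_sum, Finsupp.finsetSum_apply,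
    Finset.sum_eq_single 1]
  · rw [MonoidAlgebra.coeff_single_mul_apply, rowSum, MonoidAlgebra.coeff_sum,
      Finsupp.finsetSum_apply, Finset.sum_eq_single 1]
    · simp
    · intro ρ _ hρ
      rw [MonoidAlgebra.coeff_single, Finsupp.single_apply, if_neg]
      simpa using hρ
    · simp
  · intro σ hσ hne
    rw [Finset.mem_filter] at hσ
    rw [MonoidAlgebra.coeff_single_mul_apply, rowSum, MonoidAlgebra.coeff_sum,
      Finsupp.finsetSum_apply, Finset.sum_eq_zero, mul_zero]
    intro ρ hρ
    rw [Finset.mem_filter] at hρ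
    rw [MonoidAlgebra.coeff_single, Finsupp.single_apply, if_neg]
    rintro rfl
    refine hne (Equiv.ext fun x => eq_of_rowOf_colOf t ?_ (hσ.2 x))
    have := hρ.2 (σ x)
    rw [mul_one] at this
    have h2 : σ⁻¹ (σ x) = x := σ.symm_apply_apply x
    rw [h2] at this
    exact this.symm
  · simp

theorem youngSymmetrizer_ne_zero (t : lam.cells ≃ Fin m) : youngSymmetrizer k t ≠ 0 := by
  intro h
  have := coeff_one_youngSymmetrizer k t
  rw [h] at this
  simp at this

/-- In a semisimple ring, a left ideal with vanishing square vanishes. -/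
theorem _root_.IsSemisimpleRing.ideal_eq_bot_of_mul {R : Type*} [Ring R] [IsSemisimpleRing R]
    (N : Ideal R) (h : ∀ u ∈ N, ∀ v ∈ N, u * v = 0) : N = ⊥ := by
  obtain ⟨e, he, rfl⟩ := IsSemisimpleRing.ideal_eq_span_idempotent N
  have h1 : e ∈ Ideal.span {e} := Ideal.subset_span rfl
  have h2 := h e h1 e h1
  rw [he.eq] at h2
  rw [h2, Ideal.span_singleton_eq_bot]

/-- If the square of the symmetrizer `y` vanished, every `y * b * y` would, so the left ideal
generated by `y` would have square zero, which semisimplicity forbids. -/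
theorem youngSymmetrizer_mul_self_ne_zero [CharZero k] (t : lam.cells ≃ Fin m) :
    youngSymmetrizer k t * youngSymmetrizer k t ≠ 0 := by
  intro h
  refine youngSymmetrizer_ne_zero k t (Ideal.span_singleton_eq_bot.1
    (IsSemisimpleRing.ideal_eq_bot_of_mul _ fun u hu v hv => ?_))
  obtain ⟨a, rfl⟩ := Ideal.mem_span_singleton'.1 hu
  obtain ⟨b, rfl⟩ := Ideal.mem_span_singleton'.1 hv
  obtain ⟨c, hc⟩ := exists_youngSymmetrizer_mul_mul k t b
  rw [mul_assoc, ← mul_assoc (youngSymmetrizer k t), hc, h, smul_zero, mul_zero]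

/-- By semisimplicity `N` contains `a * y` and `b * y` with nonzero product. Then `y * b * y`, which
lies in `N`, is a nonzero multiple of `y * y`. -/
theorem youngSymmetrizer_mul_self_mem [CharZero k] (t : lam.cells ≃ Fin m)
    (N : Ideal (MonoidAlgebra k (Equiv.Perm (Fin m)))) (hN : N ≤ Specht k t) (h0 : N ≠ ⊥) :
    youngSymmetrizer k t * youngSymmetrizer k t ∈ N := by
  have : ∃ u ∈ N, ∃ v ∈ N, u * v ≠ 0 := by
    by_contra hcon
    push Not at hcon
    exact h0 (IsSemisimpleRing.ideal_eq_bot_of_mul _ hcon)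
  obtain ⟨u, hu, v, hv, huv⟩ := this
  obtain ⟨a, rfl⟩ := Ideal.mem_span_singleton'.1 (hN hu)
  obtain ⟨b, rfl⟩ := Ideal.mem_span_singleton'.1 (hN hv)
  obtain ⟨c, hc⟩ := exists_youngSymmetrizer_mul_mul k t b
  have h1 : youngSymmetrizer k t * b * youngSymmetrizer k t ∈ N := by
    rw [mul_assoc]; exact N.mul_mem_left _ hv
  have hc0 : c ≠ 0 := by
    rintro rfl
    refine huv ?_
    rw [mul_assoc, ← mul_assoc (youngSymmetrizer k t), hc, zero_smul, mul_zero]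
  rw [hc] at h1
  have h2 := N.mul_mem_left (algebraMap k _ c⁻¹) h1
  rwa [← Algebra.smul_def, smul_smul, inv_mul_cancel₀ hc0, one_smul] at h2

/-- A submodule of a Specht module is trivial. -/
theorem eq_bot_or_eq_top_of_specht [CharZero k] (t : lam.cells ≃ Fin m)
    (N : Submodule (MonoidAlgebra k (Equiv.Perm (Fin m))) (Specht k t)) : N = ⊥ ∨ N = ⊤ := by
  -- If `N` and its complement were both nonzero, both would contain the nonzero square of the Young
  -- symmetrizer.
  obtain ⟨N', hN'⟩ := exists_isCompl N
  have hle : ∀ M : Submodule (MonoidAlgebra k (Equiv.Perm (Fin m))) (Specht k t),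
      M ≠ ⊥ → youngSymmetrizer k t * youngSymmetrizer k t ∈ M.map (Specht k t).subtype := by
    intro M hM
    refine youngSymmetrizer_mul_self_mem k t _ (Submodule.map_subtype_le _ _) ?_
    intro h
    exact hM (Submodule.map_injective_of_injective (Submodule.subtype_injective _)
      (h.trans (Submodule.map_bot _).symm))
  by_cases h1 : N = ⊥
  · exact Or.inl h1
  by_cases h2 : N' = ⊥
  · right
    simpa [h2] using hN'.sup_eq_top
  exfalso
  obtain ⟨v, hv, hv'⟩ := hle N h1
  obtain ⟨w, hw, hw'⟩ := hle N' h2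
  have hvw : v = w := Subtype.ext (hv'.trans hw'.symm)
  subst hvw
  have : v = 0 := (Submodule.disjoint_def.1 hN'.disjoint) v hv hw
  rw [this, map_zero] at hv'
  exact youngSymmetrizer_mul_self_ne_zero k t hv'.symm

end YoungDiagram

/-! ### Completeness of the Young symmetrizers -/

namespace YoungDiagram

open MonoidAlgebra (single)

theorem card_cellsOfRowLens (w : List ℕ) : (YoungDiagram.cellsOfRowLens w).card = w.sum := by
  induction w with
  | nil => rfl
  | cons a w ih =>
    rw [YoungDiagram.cellsOfRowLens, Finset.card_union_of_disjoint, Finset.card_map, ih,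
      List.sum_cons]
    · simp
    · rw [Finset.disjoint_left]
      rintro ⟨i, j⟩ h h'
      simp at h h'
      omega

/-- The shape is given by the cycle type. This bounds the number of conjugacy classes by the number
of shapes; surjectivity of `f` is not needed. -/
theorem exists_shape (m : ℕ) : ∃ f : Equiv.Perm (Fin m) → {lam : YoungDiagram // lam.card = m},
    ∀ σ τ, f σ = f τ → IsConj σ τ := by
  classical
  refine ⟨fun σ => ⟨ofRowLens (σ.partition.parts.sort (· ≥ ·)) ?_, ?_⟩, ?_⟩
  · exact (Multiset.pairwise_sort _ _).sortedGE
  · change (YoungDiagram.cellsOfRowLens _).card = m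
    rw [card_cellsOfRowLens, ← Multiset.sum_coe, Multiset.sort_eq, σ.partition.parts_sum,
      Fintype.card_fin]
  · intro σ τ h
    rw [Equiv.Perm.partition_eq_of_isConj]
    refine Nat.Partition.ext ?_
    have h1 := congrArg rowLens (congrArg Subtype.val h)
    have hpos : ∀ σ : Equiv.Perm (Fin m), ∀ x ∈ σ.partition.parts.sort (· ≥ ·), 0 < x :=
      fun σ x hx => σ.partition.parts_pos ((Multiset.mem_sort _).1 hx)
    simp only at h1
    rw [rowLens_ofRowLens_eq_self (hpos σ), rowLens_ofRowLens_eq_self (hpos τ)] at h1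
    rw [← Multiset.sort_eq σ.partition.parts (· ≥ ·), h1, Multiset.sort_eq]

variable (k : Type*) [Field k] {m : ℕ} {lam mu : YoungDiagram}

/-- The sum of the conjugates of a Young symmetrizer. -/
noncomputable def centralSum (t : lam.cells ≃ Fin m) : MonoidAlgebra k (Equiv.Perm (Fin m)) :=
  ∑ g : Equiv.Perm (Fin m), single g 1 * youngSymmetrizer k t * single g⁻¹ 1

theorem single_mul_centralSum (t : lam.cells ≃ Fin m) (h : Equiv.Perm (Fin m)) :
    single h 1 * centralSum k t = centralSum k t * single h 1 := by
  rw [centralSum, Finset.mul_sum, Finset.sum_mul]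
  refine Fintype.sum_equiv (Equiv.mulLeft h) _ _ fun g => ?_
  rw [Equiv.coe_mulLeft, mul_assoc _ _ (single h 1), MonoidAlgebra.single_mul_single, mul_inv_rev,
    inv_mul_cancel_right, mul_one, ← mul_assoc, ← mul_assoc, MonoidAlgebra.single_mul_single,
    mul_one]

theorem mul_centralSum (t : lam.cells ≃ Fin m) (u : MonoidAlgebra k (Equiv.Perm (Fin m))) :
    u * centralSum k t = centralSum k t * u := by
  induction u using MonoidAlgebra.induction_on with
  | of g => exact single_mul_centralSum k t g
  | add u v hu hv => rw [add_mul, mul_add, hu, hv]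
  | smul r u hu => rw [smul_mul_assoc, mul_smul_comm, hu]

theorem coeff_one_centralSum (t : lam.cells ≃ Fin m) :
    (centralSum k t).coeff 1 = (m.factorial : k) := by
  rw [centralSum, MonoidAlgebra.coeff_sum, Finsupp.finsetSum_apply]
  have : ∀ g : Equiv.Perm (Fin m),
      (single g 1 * youngSymmetrizer k t * single g⁻¹ 1).coeff 1 = 1 := by
    intro g
    rw [MonoidAlgebra.coeff_mul_single_apply, MonoidAlgebra.coeff_single_mul_apply, one_mul,
      mul_one, inv_inv, one_mul, inv_mul_cancel, coeff_one_youngSymmetrizer]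
  rw [Finset.sum_congr rfl fun g _ => this g]
  simp [Fintype.card_perm]

variable [CharZero k]

theorem centralSum_mul_ne_zero_headCard_le (t : lam.cells ≃ Fin m) (s : mu.cells ≃ Fin m)
    (h : centralSum k t * centralSum k s ≠ 0) (r : ℕ) : lam.headCard r ≤ mu.headCard r := by
  by_contra hr
  refine h ?_
  rw [centralSum, centralSum, Finset.sum_mul]
  refine Finset.sum_eq_zero fun g _ => ?_
  rw [Finset.mul_sum]
  refine Finset.sum_eq_zero fun g' _ => ?_
  have h0 : rowSum k t * single (g⁻¹ * g') 1 * colSum k s = 0 := by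
    by_contra hne
    exact hr (headCard_le_of_mul_ne_zero k t s _ hne r)
  have : single g (1 : k) * youngSymmetrizer k t * single g⁻¹ 1 *
      (single g' 1 * youngSymmetrizer k s * single g'⁻¹ 1) =
      single g 1 * colSum k t * (rowSum k t * (single g⁻¹ 1 * single g' 1) * colSum k s) *
        rowSum k s * single g'⁻¹ 1 := by
    simp only [youngSymmetrizer_eq, mul_assoc]
  rw [this, MonoidAlgebra.single_mul_single, mul_one, h0]
  simp

/-- A nonzero product forces one shape to dominate the other. Central sums commute, so dominance
then holds both ways and the shapes agree. -/
theorem centralSum_mul_eq_zero (t : lam.cells ≃ Fin m) (s : mu.cells ≃ Fin m) (h : lam ≠ mu) :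
    centralSum k t * centralSum k s = 0 := by
  by_contra hne
  refine h (eq_of_headCard fun r => le_antisymm
    (centralSum_mul_ne_zero_headCard_le k t s hne r)
    (centralSum_mul_ne_zero_headCard_le k s t ?_ r))
  rwa [mul_centralSum]

/-- A central element of square zero generates a left ideal of square zero, so it vanishes by
semisimplicity; but the coefficient of `1` is `m!`, nonzero in characteristic zero. -/
theorem centralSum_mul_self_ne_zero (t : lam.cells ≃ Fin m) :
    centralSum k t * centralSum k t ≠ 0 := by
  intro h
  have h0 : centralSum k t = 0 := by
    refine Ideal.span_singleton_eq_bot.1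
      (IsSemisimpleRing.ideal_eq_bot_of_mul _ fun u hu v hv => ?_)
    obtain ⟨a, rfl⟩ := Ideal.mem_span_singleton'.1 hu
    obtain ⟨b, rfl⟩ := Ideal.mem_span_singleton'.1 hv
    rw [mul_centralSum k t b, mul_assoc, ← mul_assoc (centralSum k t), h, zero_mul, mul_zero]
  have := coeff_one_centralSum k t
  rw [h0] at this
  exact Nat.cast_ne_zero.2 m.factorial_ne_zero this.symm

/-- A tableau for each Young diagram with `m` cells. -/
noncomputable def someTableau (y : {lam : YoungDiagram // lam.card = m}) : y.1.cells ≃ Fin m :=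
  Finset.equivFinOfCardEq y.2

theorem linearIndependent_centralSum :
    LinearIndependent k fun y : {lam : YoungDiagram // lam.card = m} =>
      centralSum k (someTableau y) := by
  rw [linearIndependent_iff']
  intro s c hc y hy
  have h1 := congrArg (fun u => u * centralSum k (someTableau y)) hc
  simp only [Finset.sum_mul, zero_mul] at h1
  rw [Finset.sum_eq_single y] at h1
  · rw [smul_mul_assoc] at h1
    exact (smul_eq_zero.1 h1).resolve_right (centralSum_mul_self_ne_zero k _)
  · intro z _ hz
    rw [smul_mul_assoc, centralSum_mul_eq_zero k _ _ fun h => hz (Subtype.ext h), smul_zero]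
  · exact fun h => absurd hy h

/-- The central sums are linearly independent in the center, whose dimension is at most the number
of shapes because a class function is determined by one value on each conjugacy class. Hence they
form a basis of the center. -/
theorem one_mem_span_centralSum :
    (1 : MonoidAlgebra k (Equiv.Perm (Fin m))) ∈
      Submodule.span k (Set.range fun y : {lam : YoungDiagram // lam.card = m} =>
        centralSum k (someTableau y)) := by
  classical
  have hfd : FiniteDimensional k (MonoidAlgebra k (Equiv.Perm (Fin m))) :=
    Module.Finite.equiv (MonoidAlgebra.coeffLinearEquiv k).symm
  have hfin : Finite {lam : YoungDiagram // lam.card = m} :=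
    (linearIndependent_centralSum k (m := m)).finite
  have := Fintype.ofFinite {lam : YoungDiagram // lam.card = m}
  let V : Submodule k (MonoidAlgebra k (Equiv.Perm (Fin m))) :=
    { carrier := {v | ∀ g, single g 1 * v = v * single g 1}
      add_mem' := fun hu hv g => by rw [mul_add, add_mul, hu g, hv g]
      zero_mem' := fun g => by rw [mul_zero, zero_mul]
      smul_mem' := fun r u hu g => by rw [smul_mul_assoc, mul_smul_comm, hu g] }
  obtain ⟨f, hf⟩ := exists_shape m
  -- At a shape outside the range of `f`, `invFun` takes an arbitrary value; injectivity uses only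
  -- the shapes `f g`.
  let Φ : V →ₗ[k] ({lam : YoungDiagram // lam.card = m} → k) :=
    LinearMap.pi fun y => (Finsupp.lapply (Function.invFun f y)).comp
      ((MonoidAlgebra.coeffLinearEquiv k).toLinearMap.comp V.subtype)
  have hΦ : ∀ v y, Φ v y = v.1.coeff (Function.invFun f y) := fun v y => rfl
  have hinj : Function.Injective Φ := by
    rw [injective_iff_map_eq_zero]
    intro v hv
    refine Subtype.ext (MonoidAlgebra.ext (Finsupp.ext fun g => ?_))
    have h1 : IsConj (Function.invFun f (f g)) g := hf _ _ (Function.invFun_eq ⟨g, rfl⟩)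
    obtain ⟨h, hh⟩ := isConj_iff.1 h1
    have h2 := congrArg (fun u => u.coeff (g * h)) (v.2 h)
    simp only [MonoidAlgebra.coeff_mul_single_apply, MonoidAlgebra.coeff_single_mul_apply] at h2
    rw [one_mul, mul_one, mul_inv_cancel_right, ← hh, inv_mul_cancel_right, mul_assoc,
      inv_mul_cancel_left] at h2
    have h3 := congrFun hv (f g)
    rw [hΦ] at h3
    rw [← hh, mul_assoc, ← h2, h3]
    rfl
  have hrank : Module.finrank k V ≤ Fintype.card {lam : YoungDiagram // lam.card = m} := by
    rw [← Module.finrank_fintype_fun_eq_card k]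
    exact LinearMap.finrank_le_finrank_of_injective hinj
  let b : {lam : YoungDiagram // lam.card = m} → V := fun y =>
    ⟨centralSum k (someTableau y), fun g => single_mul_centralSum k _ g⟩
  have hb : LinearIndependent k b :=
    LinearIndependent.of_comp V.subtype (linearIndependent_centralSum k)
  have hspan := hb.span_eq_top_of_card_eq_finrank'
    (le_antisymm hb.fintype_card_le_finrank hrank)
  have h1 : (⟨1, fun g => by rw [mul_one, one_mul]⟩ : V) ∈ Submodule.span k (Set.range b) := by
    rw [hspan]; trivial
  have h2 := Submodule.mem_map_of_mem (f := V.subtype) h1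
  rw [Submodule.map_span, ← Set.range_comp] at h2
  exact h2

/-- Every nonzero element of a representation of a symmetric group has a translate on which some
Young symmetrizer does not vanish. -/
theorem exists_youngSymmetrizer_smul_ne_zero {V : Type*} [AddCommGroup V]
    [Module (MonoidAlgebra k (Equiv.Perm (Fin m))) V] {w : V} (hw : w ≠ 0) :
    ∃ (lam : YoungDiagram) (t : lam.cells ≃ Fin m) (u : MonoidAlgebra k (Equiv.Perm (Fin m))),
      youngSymmetrizer k t • u • w ≠ 0 := by
  by_contra hcon
  push Not at hcon
  refine hw ?_
  -- Here `1` is a combination of sums of conjugates of Young symmetrizers, and all these conjugates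
  -- kill `w`.
  rw [← one_smul (MonoidAlgebra k (Equiv.Perm (Fin m))) w]
  have h1 := one_mem_span_centralSum k (m := m)
  generalize (1 : MonoidAlgebra k (Equiv.Perm (Fin m))) = v at h1 ⊢
  induction h1 using Submodule.span_induction with
  | mem z hz =>
    obtain ⟨y, rfl⟩ := hz
    simp only [centralSum, Finset.sum_smul, mul_smul, hcon, smul_zero, Finset.sum_const_zero]
  | zero => exact zero_smul _ _
  | add u v _ _ hu hv => rw [add_smul, hu, hv, add_zero]
  | smul r u _ hu => rw [Algebra.smul_def, mul_smul, hu, smul_zero]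

end YoungDiagram

/-! ### Combinatorics of partition diagrams -/

namespace PartitionDiagram

variable {n i : ℕ}

/-- The tool for showing that points are not joined in a concatenation: exhibit a labelling of the
three rows that is constant on the parts of both factors and separates them. -/
theorem comp_le_ker {α : Type*} {d d' : PartitionDiagram n} (F : Fin n ⊕ Fin n ⊕ Fin n → α)
    (h1 : ∀ u v, d u v → F (leftRows u) = F (leftRows v))
    (h2 : ∀ u v, d' u v → F (rightRows u) = F (rightRows v)) {u v : Fin n ⊕ Fin n}
    (h : comp d d' u v) : F (outerRows u) = F (outerRows v) :=
  glue_le_iff (s := Setoid.ker F).2 ⟨h1, h2⟩ h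

theorem comp_mono_left {d d' : PartitionDiagram n} {x y : Fin n} (h : d (Sum.inl x) (Sum.inl y)) :
    comp d d' (Sum.inl x) (Sum.inl y) := glue_left (d' := d') h

theorem comp_mono_right {d d' : PartitionDiagram n} {x y : Fin n}
    (h : d' (Sum.inr x) (Sum.inr y)) : comp d d' (Sum.inr x) (Sum.inr y) := glue_right (d := d) h

theorem comp_of_middle {d d' : PartitionDiagram n} {x y z : Fin n}
    (h : d (Sum.inl x) (Sum.inr y)) (h' : d' (Sum.inl y) (Sum.inr z)) :
    comp d d' (Sum.inl x) (Sum.inr z) :=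
  (glue d d').trans' (glue_left (d' := d') h) (glue_right (d := d) h')

/-! #### Permutations -/

theorem comp_ofPerm (d : PartitionDiagram n) (τ : Equiv.Perm (Fin n)) :
    comp d (ofPerm τ) = d.comap (Sum.map id τ) := by
  have hp : ∀ u, glue d (ofPerm τ) (outerRows u) (leftRows (Sum.map id τ u)) := by
    rintro (a | b)
    · exact (glue d (ofPerm τ)).refl' _
    · exact (glue d (ofPerm τ)).symm' (glue_right (d := d)
        (show ofPerm τ (Sum.inl (τ b)) (Sum.inr b) from rfl))
  refine Setoid.ext fun u v => ⟨fun h => ?_, fun h => ?_⟩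
  · have := comp_le_ker (Sum.elim (fun a => Quotient.mk d (Sum.inl a))
      (Sum.elim (fun a => Quotient.mk d (Sum.inr a)) fun a => Quotient.mk d (Sum.inr (τ a))))
      (d := d) (d' := ofPerm τ) ?_ ?_ h
    · have hF : ∀ u, (Sum.elim (fun a => Quotient.mk d (Sum.inl a))
        (Sum.elim (fun a => Quotient.mk d (Sum.inr a)) fun a => Quotient.mk d (Sum.inr (τ a))))
        (outerRows u) = Quotient.mk d (Sum.map id τ u) := by rintro (u | u) <;> rfl
      rw [hF, hF] at this
      exact (Quotient.exact (s := d) this : d _ _)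
    · rintro (u | u) (v | v) h <;> exact Quotient.sound h
    · have hF : ∀ u, (Sum.elim (fun a => Quotient.mk d (Sum.inl a))
        (Sum.elim (fun a => Quotient.mk d (Sum.inr a)) fun a => Quotient.mk d (Sum.inr (τ a))))
        (rightRows u) = Quotient.mk d (Sum.inr (Sum.elim id τ u)) := by rintro (u | u) <;> rfl
      intro u v h
      rw [hF, hF]
      exact congrArg _ (congrArg _ h)
  · exact (glue d (ofPerm τ)).trans' (hp u)
      ((glue d (ofPerm τ)).trans' (glue_left h) ((glue d (ofPerm τ)).symm' (hp v)))

theorem ofPerm_comp (d : PartitionDiagram n) (τ : Equiv.Perm (Fin n)) :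
    comp (ofPerm τ) d = d.comap (Sum.map τ.symm id) := by
  have hp : ∀ u, glue (ofPerm τ) d (outerRows u) (rightRows (Sum.map τ.symm id u)) := by
    rintro (a | b)
    · exact glue_left (d' := d)
        (show ofPerm τ (Sum.inl a) (Sum.inr (τ.symm a)) from (τ.apply_symm_apply a).symm)
    · exact (glue (ofPerm τ) d).refl' _
  refine Setoid.ext fun u v => ⟨fun h => ?_, fun h => ?_⟩
  · have := comp_le_ker (Sum.elim (fun a => Quotient.mk d (Sum.inl (τ.symm a)))
      (Sum.elim (fun a => Quotient.mk d (Sum.inl a)) fun a => Quotient.mk d (Sum.inr a)))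
      (d := ofPerm τ) (d' := d) ?_ ?_ h
    · have hF : ∀ u, (Sum.elim (fun a => Quotient.mk d (Sum.inl (τ.symm a)))
        (Sum.elim (fun a => Quotient.mk d (Sum.inl a)) fun a => Quotient.mk d (Sum.inr a)))
        (outerRows u) = Quotient.mk d (Sum.map τ.symm id u) := by rintro (u | u) <;> rfl
      rw [hF, hF] at this
      exact (Quotient.exact (s := d) this : d _ _)
    · have hF : ∀ u, (Sum.elim (fun a => Quotient.mk d (Sum.inl (τ.symm a)))
        (Sum.elim (fun a => Quotient.mk d (Sum.inl a)) fun a => Quotient.mk d (Sum.inr a)))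
        (leftRows u) = Quotient.mk d (Sum.inl (τ.symm (Sum.elim id τ u))) := by
        rintro (u | u)
        · rfl
        · exact congrArg _ (congrArg _ (τ.symm_apply_apply u).symm)
      intro u v h
      rw [hF, hF]
      exact congrArg _ (congrArg _ (congrArg _ h))
    · rintro (u | u) (v | v) h <;> exact Quotient.sound h
  · exact (glue (ofPerm τ) d).trans' (hp u)
      ((glue (ofPerm τ) d).trans' (glue_right h) ((glue (ofPerm τ) d).symm' (hp v)))

theorem ofPerm_mul (σ τ : Equiv.Perm (Fin n)) :
    comp (ofPerm σ) (ofPerm τ) = ofPerm (σ * τ) := by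
  rw [comp_ofPerm]
  refine Setoid.ext fun u v => ?_
  rcases u with u | u <;> rcases v with v | v <;> rfl

theorem loops_eq_zero {d d' : PartitionDiagram n}
    (h : ∀ m, ∃ u, glue d d' (outerRows u) (Sum.inr (Sum.inl m))) : loops d d' = 0 := by
  rw [loops, Nat.card_eq_zero]
  left
  refine ⟨fun ⟨c, hc⟩ => ?_⟩
  induction c using Quotient.inductionOn with
  | h p =>
    rcases p with p | p | p
    · exact hc (Sum.inl p) rfl
    · obtain ⟨u, hu⟩ := h p
      exact hc u (Quotient.sound hu)
    · exact hc (Sum.inr p) rfl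

theorem loops_ofPerm (d : PartitionDiagram n) (τ : Equiv.Perm (Fin n)) :
    loops d (ofPerm τ) = 0 :=
  loops_eq_zero fun m => ⟨Sum.inr (τ.symm m), glue_right (d := d)
    (show ofPerm τ (Sum.inr (τ.symm m)) (Sum.inl m) from τ.apply_symm_apply m)⟩

theorem ofPerm_loops (d : PartitionDiagram n) (τ : Equiv.Perm (Fin n)) :
    loops (ofPerm τ) d = 0 :=
  loops_eq_zero fun m => ⟨Sum.inl (τ m), glue_left (d' := d)
    (show ofPerm τ (Sum.inl (τ m)) (Sum.inr m) from rfl)⟩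

/-! #### The standard diagrams -/

theorem proj_inl_inl {a b : Fin n} : proj n i (Sum.inl a) (Sum.inl b) ↔ a = b := by
  refine ⟨fun h => congrArg Prod.fst (show (a, decide (i ≤ a.1)) = (b, decide (i ≤ b.1)) from h), ?_⟩
  rintro rfl
  exact (proj n i).refl' _

theorem proj_inr_inr {a b : Fin n} : proj n i (Sum.inr a) (Sum.inr b) ↔ a = b := by
  refine ⟨fun h => congrArg Prod.fst (show (a, false) = (b, false) from h), ?_⟩
  rintro rfl
  exact (proj n i).refl' _

theorem proj_inl_inr {a b : Fin n} :
    proj n i (Sum.inl a) (Sum.inr b) ↔ a = b ∧ a.1 < i := by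
  change (a, decide (i ≤ a.1)) = (b, false) ↔ _
  rw [Prod.mk.injEq, decide_eq_false_iff_not, not_le]

theorem proj_self (n : ℕ) : proj n n = idDiagram n := by
  refine Setoid.ext fun u v => ?_
  rcases u with a | a <;> rcases v with b | b
  · exact proj_inl_inl
  · exact proj_inl_inr.trans ⟨fun h => h.1, fun h => ⟨h, a.2⟩⟩
  · exact ((proj n n).comm' ).trans (proj_inl_inr.trans
      ⟨fun h => h.1.symm, fun h => ⟨Eq.symm h, b.2⟩⟩)
  · exact proj_inr_inr

theorem rank_proj (hi : i ≤ n) : (proj n i).rank = i := by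
  rw [rank]
  have key : ∀ c : {c : Quotient (proj n i) // (∃ a, Quotient.mk _ (Sum.inl a) = c) ∧
      ∃ b, Quotient.mk _ (Sum.inr b) = c}, c.2.1.choose.1 < i := by
    intro c
    have h : proj n i (Sum.inl c.2.1.choose) (Sum.inr c.2.2.choose) :=
      Quotient.exact (c.2.1.choose_spec.trans c.2.2.choose_spec.symm)
    exact (proj_inl_inr.1 h).2
  refine le_antisymm ?_ ?_
  · refine (Nat.card_le_card_of_injective (fun c => (⟨_, key c⟩ : Fin i)) ?_).trans
      (Nat.card_fin i).le
    intro c c' h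
    have h1 : c.2.1.choose = c'.2.1.choose := Fin.ext (Fin.mk.inj h)
    refine Subtype.ext (c.2.1.choose_spec.symm.trans ?_)
    rw [h1]
    exact c'.2.1.choose_spec
  · refine (Nat.card_fin i).symm.le.trans (Nat.card_le_card_of_injective
      (fun a : Fin i => ⟨Quotient.mk _ (Sum.inl (Fin.castLE hi a)), ⟨_, rfl⟩,
        Fin.castLE hi a, Quotient.sound ((proj n i).symm' (proj_inl_inr.2 ⟨rfl, a.2⟩))⟩) ?_)
    intro a b h
    have h1 : proj n i (Sum.inl (Fin.castLE hi a)) (Sum.inl (Fin.castLE hi b)) :=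
      Quotient.exact (congrArg Subtype.val h)
    exact Fin.castLE_injective hi (proj_inl_inl.1 h1)

theorem rank_le (d : PartitionDiagram n) : d.rank ≤ n := by
  refine (Nat.card_le_card_of_injective (fun c => c.2.1.choose) ?_).trans (Nat.card_fin n).le
  intro c c' h
  refine Subtype.ext (c.2.1.choose_spec.symm.trans ?_)
  rw [show c.2.1.choose = c'.2.1.choose from h]
  exact c'.2.1.choose_spec

/-- Composition with a standard diagram on the right cuts off the input points beyond `i`. -/
theorem comp_proj_eq_self {d : PartitionDiagram n}
    (h : ∀ (b : Fin n) u, i ≤ b.1 → d (Sum.inr b) u → u = Sum.inr b) : comp d (proj n i) = d := by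
  have hp : ∀ u v, d u v → u ≠ v → glue d (proj n i) (leftRows u) (outerRows u) := by
    rintro (a | b) v huv hne
    · exact (glue d (proj n i)).refl' _
    · by_cases hb : b.1 < i
      · exact glue_right (d := d) (proj_inl_inr.2 ⟨rfl, hb⟩)
      · exact absurd (h b v (not_lt.1 hb) huv).symm hne
  refine Setoid.ext fun u v => ⟨fun h => ?_, fun huv => ?_⟩
  · have := comp_le_ker (Sum.elim (fun a => Quotient.mk d (Sum.inl a))
      (Sum.elim (fun a => Quotient.mk d (Sum.inr a)) fun a => Quotient.mk d (Sum.inr a)))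
      (d := d) (d' := proj n i) ?_ ?_ h
    · rcases u with u | u <;> rcases v with v | v <;> exact Quotient.exact this
    · rintro (u | u) (v | v) h <;> exact Quotient.sound h
    · rintro (u | u) (v | v) h
      · rw [proj_inl_inl.1 h]
      · obtain ⟨rfl, _⟩ := proj_inl_inr.1 h
        rfl
      · obtain ⟨rfl, _⟩ := proj_inl_inr.1 ((proj n i).symm' h)
        rfl
      · rw [proj_inr_inr.1 h]
  · by_cases hne : u = v
    · rw [hne]
    · exact (glue d (proj n i)).trans' ((glue d (proj n i)).symm' (hp u v huv hne))
        ((glue d (proj n i)).trans' (glue_left huv) (hp v u (d.symm' huv) (Ne.symm hne)))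

theorem comp_proj_inr {d : PartitionDiagram n} {b : Fin n} (hb : i ≤ b.1) {u : Fin n ⊕ Fin n}
    (h : comp d (proj n i) (Sum.inr b) u) : u = Sum.inr b := by
  have := comp_le_ker (fun p => p = Sum.inr (Sum.inr b)) (d := d) (d' := proj n i) ?_ ?_ h
  · have h1 : outerRows u = Sum.inr (Sum.inr b) := (iff_of_eq this).1 rfl
    rcases u with u | u
    · cases h1
    · exact congrArg Sum.inr (Sum.inr.inj (Sum.inr.inj h1))
  · rintro (u | u) (v | v) _ <;> simp [leftRows]
  · have key : ∀ a c : Fin n, proj n i (Sum.inl a) (Sum.inr c) → c ≠ b := by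
      rintro a c hac rfl
      obtain ⟨rfl, h2⟩ := proj_inl_inr.1 hac
      omega
    rintro (u | u) (v | v) h
    · simp [rightRows]
    · simpa [rightRows] using key _ _ h
    · simpa [rightRows] using key _ _ ((proj n i).symm' h)
    · rw [proj_inr_inr.1 h]

theorem comp_proj_proj (d : PartitionDiagram n) :
    comp (comp d (proj n i)) (proj n i) = comp d (proj n i) :=
  comp_proj_eq_self fun _ _ hb h => comp_proj_inr hb h

theorem proj_comp_proj (n i : ℕ) : comp (proj n i) (proj n i) = proj n i := by
  have h : comp (idDiagram n) (proj n i) = proj n i := (id_comp_loops _).1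
  have := comp_proj_proj (i := i) (idDiagram n)
  rwa [h] at this

/-- Every diagram factors through the standard diagram of the same rank. -/
theorem exists_factor (d : PartitionDiagram n) :
    ∃ d₁ d₂, comp d₁ (comp (proj n d.rank) d₂) = d := by
  classical
  let P := {c : Quotient d // (∃ a, Quotient.mk d (Sum.inl a) = c) ∧
    ∃ b, Quotient.mk d (Sum.inr b) = c}
  let e : P ≃ Fin d.rank := Finite.equivFin P
  -- Labels of the middle row: the first `d.rank` points enumerate the propagating parts of `d`,
  -- every other point gets a private label. Each factor has this row labelled by `f` and its other
  -- row by the parts of `d`.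
  let f : Fin n → Quotient d ⊕ Fin n := fun c =>
    if h : c.1 < d.rank then Sum.inl (e.symm ⟨c.1, h⟩).1 else Sum.inr c
  let d₁ : PartitionDiagram n := Setoid.ker (Sum.elim (fun a => Sum.inl (Quotient.mk d (Sum.inl a))) f)
  let d₂ : PartitionDiagram n := Setoid.ker (Sum.elim f (fun a => Sum.inl (Quotient.mk d (Sum.inr a))))
  have hf : ∀ c c', f c = f c' → c = c' := by
    intro c c' h
    by_cases h1 : c.1 < d.rank <;> by_cases h2 : c'.1 < d.rank
    · simp only [f, dif_pos h1, dif_pos h2, Sum.inl.injEq] at h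
      exact Fin.ext (Fin.mk.inj_iff.1 (e.symm.injective (Subtype.ext h)))
    · simp only [f, dif_pos h1, dif_neg h2] at h
      cases h
    · simp only [f, dif_neg h1, dif_pos h2] at h
      cases h
    · simpa only [f, dif_neg h1, dif_neg h2, Sum.inr.injEq] using h
  refine ⟨d₁, d₂, ?_⟩
  rw [← (comp_loops_assoc _ _ _).1]
  have hd₁ : comp d₁ (proj n d.rank) = d₁ := by
    refine comp_proj_eq_self fun b u hb h => ?_
    have hfb : f b = Sum.inr b := dif_neg (not_lt.2 hb)
    have h' : f b = Sum.elim (fun a => Sum.inl (Quotient.mk d (Sum.inl a))) f u := h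
    rcases u with u | u
    · rw [hfb] at h'
      cases h'
    · rw [hf _ _ h']
  rw [hd₁]
  have hmid : ∀ a b, d (Sum.inl a) (Sum.inr b) →
      comp d₁ d₂ (Sum.inl a) (Sum.inr b) := by
    intro a b hab
    let c : P := ⟨Quotient.mk d (Sum.inl a), ⟨a, rfl⟩, b, (Quotient.sound hab).symm⟩
    have hc : f (Fin.castLE d.rank_le (e c)) = Sum.inl (Quotient.mk d (Sum.inl a)) := by
      have h1 : (Fin.castLE d.rank_le (e c)).1 < d.rank := (e c).2
      have h2 : (⟨(Fin.castLE d.rank_le (e c)).1, h1⟩ : Fin d.rank) = e c := rfl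
      simp only [f, dif_pos h1, h2, Equiv.symm_apply_apply, c]
    exact comp_of_middle (y := Fin.castLE d.rank_le (e c)) hc.symm
      (hc.trans (congrArg Sum.inl (Quotient.sound hab)))
  refine Setoid.ext fun u v => ⟨fun h => ?_, fun h => ?_⟩
  · have := comp_le_ker (Sum.elim (fun a => Sum.inl (Quotient.mk d (Sum.inl a))) (Sum.elim f
      (fun a => Sum.inl (Quotient.mk d (Sum.inr a))))) (d := d₁) (d' := d₂) ?_ ?_ h
    · rcases u with u | u <;> rcases v with v | v <;> exact Quotient.exact (Sum.inl.inj this)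
    · rintro (u | u) (v | v) h <;> exact h
    · rintro (u | u) (v | v) h <;> exact h
  · rcases u with u | u <;> rcases v with v | v
    · exact comp_mono_left (congrArg Sum.inl (Quotient.sound h))
    · exact hmid _ _ h
    · exact Setoid.symm' _ (hmid _ _ (d.symm' h))
    · exact comp_mono_right (congrArg Sum.inl (Quotient.sound h))

end PartitionDiagram

namespace PartitionDiagram

variable {n i : ℕ}

/-! #### Left cells -/

namespace LeftCell

theorem comp_proj (r : LeftCell n i) : comp r.1 (proj n i) = r.1 := by
  obtain ⟨d, hd⟩ := r.2.2
  rw [← hd, comp_proj_proj]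

theorem eq_of_inr (r : LeftCell n i) {b : Fin n} (hb : i ≤ b.1) {u : Fin n ⊕ Fin n}
    (h : r.1 (Sum.inr b) u) : u = Sum.inr b := by
  rw [← comp_proj r] at h
  exact comp_proj_inr hb h

theorem lt_of_inl_inr (r : LeftCell n i) {a b : Fin n} (h : r.1 (Sum.inl a) (Sum.inr b)) :
    b.1 < i := by
  by_contra hb
  cases eq_of_inr r (not_lt.1 hb) (r.1.symm' h)

/-- An input point on a propagating line is one of the first `i`, and there are exactly `i`
propagating parts. Hence choosing an input point in each part is a bijection onto the first `i`
points. -/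
theorem exists_mk_inr (r : LeftCell n i) (b : Fin n) (hb : b.1 < i) :
    ∃ c : {c : Quotient r.1 // (∃ a, Quotient.mk r.1 (Sum.inl a) = c) ∧
      ∃ b, Quotient.mk r.1 (Sum.inr b) = c}, c.2.2.choose = b := by
  have key : ∀ c : {c : Quotient r.1 // (∃ a, Quotient.mk r.1 (Sum.inl a) = c) ∧
      ∃ b, Quotient.mk r.1 (Sum.inr b) = c}, c.2.2.choose.1 < i := by
    intro c
    exact lt_of_inl_inr r (a := c.2.1.choose)
      (Quotient.exact (c.2.1.choose_spec.trans c.2.2.choose_spec.symm))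
  have hinj : Function.Injective fun c => (⟨_, key c⟩ : Fin i) := by
    intro c c' h
    have h1 : c.2.2.choose = c'.2.2.choose := Fin.ext (Fin.mk.inj h)
    refine Subtype.ext (c.2.2.choose_spec.symm.trans ?_)
    rw [h1]
    exact c'.2.2.choose_spec
  have hbij := (Function.Injective.bijective_of_nat_card_le hinj
    (by rw [Nat.card_fin]; exact r.2.1.ge))
  obtain ⟨c, hc⟩ := hbij.2 ⟨b.1, hb⟩
  exact ⟨c, Fin.ext (Fin.mk.inj hc)⟩

theorem exists_inl_inr (r : LeftCell n i) {b : Fin n} (hb : b.1 < i) :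
    ∃ a, r.1 (Sum.inl a) (Sum.inr b) := by
  obtain ⟨c, rfl⟩ := exists_mk_inr r b hb
  exact ⟨c.2.1.choose, Quotient.exact (c.2.1.choose_spec.trans c.2.2.choose_spec.symm)⟩

theorem inr_inr (r : LeftCell n i) {b b' : Fin n} :
    r.1 (Sum.inr b) (Sum.inr b') ↔ b = b' := by
  refine ⟨fun h => ?_, ?_⟩
  · by_cases hb : b.1 < i
    · by_cases hb' : b'.1 < i
      · obtain ⟨c, rfl⟩ := exists_mk_inr r b hb
        obtain ⟨c', rfl⟩ := exists_mk_inr r b' hb'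
        have h1 : c = c' := Subtype.ext
          (c.2.2.choose_spec.symm.trans ((Quotient.sound h).trans c'.2.2.choose_spec))
        rw [h1]
      · exact Sum.inr.inj (eq_of_inr r (not_lt.1 hb') (r.1.symm' h))
    · exact (Sum.inr.inj (eq_of_inr r (not_lt.1 hb) h)).symm
  · rintro rfl
    exact r.1.refl' _

/-- The reflected diagram is a left inverse of an element of the left cell. -/
theorem comap_swap_comp (r : LeftCell n i) :
    comp (r.1.comap Sum.swap) r.1 = proj n i := by
  have hmid : ∀ a b, proj n i (Sum.inl a) (Sum.inr b) →
      comp (r.1.comap Sum.swap) r.1 (Sum.inl a) (Sum.inr b) := by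
    intro a b h
    obtain ⟨rfl, ha⟩ := proj_inl_inr.1 h
    obtain ⟨x, hx⟩ := exists_inl_inr r ha
    exact comp_of_middle (y := x) (show r.1 (Sum.inr a) (Sum.inl x) from r.1.symm' hx) hx
  refine Setoid.ext fun u v => ⟨fun h => ?_, fun h => ?_⟩
  -- All three rows are labelled by parts of `r`, except that output points beyond `i` get private
  -- labels, which keeps them apart from the corresponding input points.
  · have := comp_le_ker (Sum.elim
      (fun a => if a.1 < i then Sum.inl (Quotient.mk r.1 (Sum.inr a)) else Sum.inr a)
      (Sum.elim (fun a => Sum.inl (Quotient.mk r.1 (Sum.inl a)))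
        fun a => Sum.inl (Quotient.mk r.1 (Sum.inr a))))
      (d := r.1.comap Sum.swap) (d' := r.1) ?_ ?_ h
    · have hio : ∀ a b : Fin n,
          (if a.1 < i then Sum.inl (Quotient.mk r.1 (Sum.inr a)) else Sum.inr a) =
          Sum.inl (Quotient.mk r.1 (Sum.inr b)) → proj n i (Sum.inl a) (Sum.inr b) := by
        intro a b hab
        by_cases ha : a.1 < i
        · rw [if_pos ha] at hab
          exact proj_inl_inr.2 ⟨(inr_inr r).1 (Quotient.exact (Sum.inl.inj hab)), ha⟩
        · rw [if_neg ha] at hab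
          cases hab
      rcases u with u | u <;> rcases v with v | v
      · have hab : (if u.1 < i then Sum.inl (Quotient.mk r.1 (Sum.inr u)) else Sum.inr u) =
          if v.1 < i then Sum.inl (Quotient.mk r.1 (Sum.inr v)) else Sum.inr v := this
        rw [proj_inl_inl]
        by_cases hv : v.1 < i
        · rw [if_pos hv] at hab
          exact (proj_inl_inr.1 (hio _ _ hab)).1
        · by_cases hu : u.1 < i
          · rw [if_pos hu, if_neg hv] at hab
            cases hab
          · rw [if_neg hu, if_neg hv] at hab
            exact Sum.inr.inj hab
      · exact hio _ _ this
      · exact (proj n i).symm' (hio _ _ this.symm)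
      · exact proj_inr_inr.2 ((inr_inr r).1 (Quotient.exact (Sum.inl.inj this)))
    · have hF : ∀ a b : Fin n, r.1 (Sum.inr a) (Sum.inl b) →
          (if a.1 < i then Sum.inl (Quotient.mk r.1 (Sum.inr a)) else Sum.inr a) =
          (Sum.inl (Quotient.mk r.1 (Sum.inl b)) : Quotient r.1 ⊕ Fin n) := by
        intro a b hab
        rw [if_pos (lt_of_inl_inr r (r.1.symm' hab))]
        exact congrArg Sum.inl (Quotient.sound hab)
      rintro (u | u) (v | v) h
      · have h1 : u = v := (inr_inr r).1 h
        rw [h1]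
      · exact hF _ _ h
      · exact (hF _ _ (r.1.symm' h)).symm
      · exact congrArg Sum.inl (Quotient.sound h)
    · rintro (u | u) (v | v) h <;> exact congrArg Sum.inl (Quotient.sound h)
  · rcases u with u | u <;> rcases v with v | v
    · rw [proj_inl_inl.1 h]
    · exact hmid _ _ h
    · exact Setoid.symm' _ (hmid _ _ ((proj n i).symm' h))
    · rw [proj_inr_inr.1 h]

/-- The set partition of the output row induced by an element of the left cell, and the set of
output points on propagating lines. -/
def key (r : LeftCell n i) : Setoid (Fin n) × Set (Fin n) :=
  (r.1.comap Sum.inl, {a | ∃ b, r.1 (Sum.inl a) (Sum.inr b)})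

/-- With equal keys, `r` and `l` have the same output parts on propagating lines, each joined to
exactly one of the first `i` input points. They differ only in how these ends are numbered. -/
theorem exists_comp_ofPerm (hi : i ≤ n) (r l : LeftCell n i) (h : key r = key l) :
    ∃ σ : Equiv.Perm (Fin i),
      l.1 = comp r.1 (ofPerm (σ.viaFintypeEmbedding (Fin.castLEEmb hi))) := by
  have h1 : ∀ a b, r.1 (Sum.inl a) (Sum.inl b) ↔ l.1 (Sum.inl a) (Sum.inl b) := fun a b =>
    iff_of_eq (congrFun (congrFun (congrArg (fun s : Setoid (Fin n) => s.r) (Prod.ext_iff.1 h).1) a) b)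
  have h2 : ∀ a, (∃ b, r.1 (Sum.inl a) (Sum.inr b)) ↔ ∃ b, l.1 (Sum.inl a) (Sum.inr b) :=
    fun a => iff_of_eq (congrFun (Prod.ext_iff.1 h).2 a)
  -- Follow the line of `l` from the input point `c` to an output point `x`, then the line of `r`
  -- back to an input point `d`; `c ↦ d` is the required permutation.
  have h3 : ∀ c : Fin i, ∃ d : Fin i, ∃ x, l.1 (Sum.inl x) (Sum.inr (Fin.castLE hi c)) ∧
      r.1 (Sum.inl x) (Sum.inr (Fin.castLE hi d)) := by
    intro c
    obtain ⟨x, hx⟩ := exists_inl_inr l (b := Fin.castLE hi c) c.2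
    obtain ⟨b, hb⟩ := (h2 x).2 ⟨_, hx⟩
    exact ⟨⟨b.1, lt_of_inl_inr r hb⟩, x, hx, hb⟩
  choose f x hl hr using h3
  have hf : Function.Injective f := by
    intro c c' hcc
    have e1 : r.1 (Sum.inl (x c)) (Sum.inl (x c')) :=
      r.1.trans' (hr c) (r.1.symm' (hcc ▸ hr c'))
    have e2 : l.1 (Sum.inr (Fin.castLE hi c)) (Sum.inr (Fin.castLE hi c')) :=
      l.1.trans' (l.1.symm' (hl c)) (l.1.trans' ((h1 _ _).1 e1) (hl c'))
    exact Fin.castLE_injective hi ((inr_inr l).1 e2)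
  let σ : Equiv.Perm (Fin i) := Equiv.ofBijective f (Finite.injective_iff_bijective.1 hf)
  refine ⟨σ, ?_⟩
  rw [comp_ofPerm]
  have hσ : ∀ c : Fin i, (σ.viaFintypeEmbedding (Fin.castLEEmb hi)) (Fin.castLE hi c) =
      Fin.castLE hi (f c) := fun c =>
    Equiv.Perm.viaFintypeEmbedding_apply_image σ (Fin.castLEEmb hi) c
  have hσ' : ∀ b : Fin n, i ≤ b.1 → (σ.viaFintypeEmbedding (Fin.castLEEmb hi)) b = b := by
    intro b hb
    refine Equiv.Perm.viaFintypeEmbedding_apply_notMem_range σ (Fin.castLEEmb hi) ?_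
    rintro ⟨c, rfl⟩
    exact absurd c.2 (not_lt.2 hb)
  have hio : ∀ a b, l.1 (Sum.inl a) (Sum.inr b) ↔
      r.1 (Sum.inl a) (Sum.inr (σ.viaFintypeEmbedding (Fin.castLEEmb hi) b)) := by
    intro a b
    by_cases hb : b.1 < i
    · obtain ⟨c, rfl⟩ : ∃ c : Fin i, Fin.castLE hi c = b := ⟨⟨b.1, hb⟩, rfl⟩
      rw [hσ]
      refine ⟨fun hab => r.1.trans' ((h1 _ _).2 (l.1.trans' hab (l.1.symm' (hl c)))) (hr c),
        fun hab => l.1.trans' ((h1 _ _).1 (r.1.trans' hab (r.1.symm' (hr c)))) (hl c)⟩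
    · rw [hσ' b (not_lt.1 hb)]
      exact ⟨fun hab => absurd (lt_of_inl_inr l hab) hb, fun hab => absurd (lt_of_inl_inr r hab) hb⟩
  refine Setoid.ext fun u v => ?_
  rcases u with u | u <;> rcases v with v | v
  · exact (h1 u v).symm
  · exact hio u v
  · exact l.1.comm'.trans ((hio v u).trans r.1.comm')
  · exact (inr_inr l).trans ((inr_inr r).trans (Equiv.injective _).eq_iff).symm

end LeftCell

/-! #### Pairs of diagrams -/

/-- Left concatenation on pairs of diagrams. -/
def compPair (d : PartitionDiagram n) (q : PartitionDiagram n × PartitionDiagram n) :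
    PartitionDiagram n × PartitionDiagram n := (comp d q.1, comp d q.2)

theorem compPair_compPair (d d' : PartitionDiagram n)
    (q : PartitionDiagram n × PartitionDiagram n) :
    compPair d (compPair d' q) = compPair (comp d d') q :=
  Prod.ext (comp_loops_assoc _ _ _).1.symm (comp_loops_assoc _ _ _).1.symm

/-- The common refinement of the partitions of the output row. -/
def meetRow (q : PartitionDiagram n × PartitionDiagram n) : Setoid (Fin n) :=
  (q.1 ⊓ q.2).comap Sum.inl

/-- An output point is dead if its parts in the two diagrams coincide and do not meet the
input row. -/
def Dead (q : PartitionDiagram n × PartitionDiagram n) (x : Fin n) : Prop :=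
  ∀ z, q.1 (Sum.inl x) z ∨ q.2 (Sum.inl x) z →
    (∃ y, z = Sum.inl y) ∧ q.1 (Sum.inl x) z ∧ q.2 (Sum.inl x) z

theorem Dead.congr {q : PartitionDiagram n × PartitionDiagram n} {x y : Fin n}
    (h : meetRow q x y) (hx : Dead q x) : Dead q y := by
  intro z hz
  have h1 : q.1 (Sum.inl x) (Sum.inl y) := h.1
  have h2 : q.2 (Sum.inl x) (Sum.inl y) := h.2
  obtain ⟨h3, h4, h5⟩ := hx z (hz.imp (q.1.trans' h1) (q.2.trans' h2))
  exact ⟨h3, q.1.trans' (q.1.symm' h1) h4, q.2.trans' (q.2.symm' h2) h5⟩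

theorem dead_congr {q : PartitionDiagram n × PartitionDiagram n} {x y : Fin n}
    (h : meetRow q x y) : Dead q x ↔ Dead q y :=
  ⟨Dead.congr h, Dead.congr ((meetRow q).symm' h)⟩

/-- The diagram whose rows are both partitioned by the common refinement, the parts which are not
dead being joined by vertical lines. -/
def liveDiagram (q : PartitionDiagram n × PartitionDiagram n) : PartitionDiagram n :=
  Setoid.ker (Sum.elim (fun x => (Quotient.mk (meetRow q) x, Dead q x))
    fun y => (Quotient.mk (meetRow q) y, False))

variable {q : PartitionDiagram n × PartitionDiagram n}

theorem liveDiagram_inl_inl {x y : Fin n} :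
    liveDiagram q (Sum.inl x) (Sum.inl y) ↔ meetRow q x y := by
  refine ⟨fun h => Quotient.exact (Prod.ext_iff.1 h).1, fun h => ?_⟩
  exact Prod.ext (Quotient.sound h) (propext (dead_congr h))

theorem liveDiagram_inr_inr {x y : Fin n} :
    liveDiagram q (Sum.inr x) (Sum.inr y) ↔ meetRow q x y :=
  ⟨fun h => Quotient.exact (Prod.ext_iff.1 h).1, fun h => Prod.ext (Quotient.sound h) rfl⟩

theorem liveDiagram_inl_inr {x y : Fin n} :
    liveDiagram q (Sum.inl x) (Sum.inr y) ↔ meetRow q x y ∧ ¬ Dead q x := by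
  refine ⟨fun h => ⟨Quotient.exact (Prod.ext_iff.1 h).1, fun hd => ?_⟩, fun h => ?_⟩
  · exact (iff_of_eq (Prod.ext_iff.1 h).2).1 hd
  · exact Prod.ext (Quotient.sound h.1) (eq_false h.2)

/-- Vertical lines transport `d` unchanged through the live points. At a dead point the line is
missing, but there the part in `d` is already a part of the common refinement, which the output row
of `liveDiagram q` reproduces. -/
theorem comp_liveDiagram_aux {d : PartitionDiagram n} (h : d = q.1 ∨ d = q.2) :
    comp (liveDiagram q) d = d := by
  have hE : ∀ x y, meetRow q x y → d (Sum.inl x) (Sum.inl y) := by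
    rcases h with rfl | rfl
    · exact fun x y h => h.1
    · exact fun x y h => h.2
  have hD : ∀ x z, Dead q x → d (Sum.inl x) z → ∃ y, z = Sum.inl y ∧ meetRow q x y := by
    intro x z hx hz
    obtain ⟨⟨y, rfl⟩, h3⟩ := hx z (by rcases h with rfl | rfl <;> simp [hz])
    exact ⟨y, rfl, h3⟩
  have hp : ∀ u, (∀ x, u = Sum.inl x → ¬ Dead q x) →
      glue (liveDiagram q) d (outerRows u) (rightRows u) := by
    rintro (x | x) hx
    · exact glue_left (d' := d) (liveDiagram_inl_inr.2 ⟨(meetRow q).refl' x, hx x rfl⟩)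
    · exact Setoid.refl' _ _
  refine Setoid.ext fun u v => ⟨fun h => ?_, fun h => ?_⟩
  · have := comp_le_ker (Sum.elim (fun a => Quotient.mk d (Sum.inl a))
      (Sum.elim (fun a => Quotient.mk d (Sum.inl a)) fun a => Quotient.mk d (Sum.inr a)))
      (d := liveDiagram q) (d' := d) ?_ ?_ h
    · rcases u with u | u <;> rcases v with v | v <;> exact Quotient.exact this
    · rintro (u | u) (v | v) h
      · exact Quotient.sound (hE _ _ (liveDiagram_inl_inl.1 h))
      · exact Quotient.sound (hE _ _ (liveDiagram_inl_inr.1 h).1)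
      · exact (Quotient.sound (hE _ _ (liveDiagram_inl_inr.1 (Setoid.symm' _ h)).1)).symm
      · exact Quotient.sound (hE _ _ (liveDiagram_inr_inr.1 h))
    · rintro (u | u) (v | v) h <;> exact Quotient.sound h
  · by_cases hu : ∃ x, u = Sum.inl x ∧ Dead q x
    · obtain ⟨x, rfl, hx⟩ := hu
      obtain ⟨y, rfl, hy⟩ := hD x v hx h
      exact comp_mono_left (liveDiagram_inl_inl.2 hy)
    by_cases hv : ∃ x, v = Sum.inl x ∧ Dead q x
    · obtain ⟨x, rfl, hx⟩ := hv
      obtain ⟨y, rfl, hy⟩ := hD x u hx (d.symm' h)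
      exact Setoid.symm' _ (comp_mono_left (liveDiagram_inl_inl.2 hy))
    · push Not at hu hv
      exact (glue (liveDiagram q) d).trans' (hp u hu)
        ((glue (liveDiagram q) d).trans' (glue_right h)
          ((glue (liveDiagram q) d).symm' (hp v hv)))

theorem compPair_liveDiagram (q : PartitionDiagram n × PartitionDiagram n) :
    compPair (liveDiagram q) q = q :=
  Prod.ext (comp_liveDiagram_aux (Or.inl rfl)) (comp_liveDiagram_aux (Or.inr rfl))

/-- An output point not on a propagating line keeps its part in a concatenation. -/
theorem comp_inl_of_forall_not {s d : PartitionDiagram n} {x : Fin n}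
    (hx : ∀ b, ¬ s (Sum.inl x) (Sum.inr b)) {z : Fin n ⊕ Fin n}
    (h : comp s d (Sum.inl x) z) : ∃ y, z = Sum.inl y ∧ s (Sum.inl x) (Sum.inl y) := by
  have := comp_le_ker (fun p => ∃ y, p = Sum.inl y ∧ s (Sum.inl x) (Sum.inl y)) (d := s) (d' := d)
    ?_ ?_ h
  · obtain ⟨y, hy, h1⟩ := (iff_of_eq this).1 ⟨x, rfl, s.refl' _⟩
    rcases z with z | z
    · cases hy
      exact ⟨_, rfl, h1⟩
    · cases hy
  · rintro (u | u) (v | v) h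
    · simp only [leftRows, Sum.inl.injEq, exists_eq_left', eq_iff_iff]
      exact ⟨fun h1 => s.trans' h1 h, fun h1 => s.trans' h1 (s.symm' h)⟩
    · simpa [leftRows] using fun h1 => hx v (s.trans' h1 h)
    · simpa [leftRows] using fun h1 => hx u (s.trans' h1 (s.symm' h))
    · simp [leftRows]
  · rintro (u | u) (v | v) _ <;> simp [rightRows]

theorem meetRow_compPair {s : PartitionDiagram n} {x y : Fin n}
    (h : s (Sum.inl x) (Sum.inl y)) : meetRow (compPair s q) x y :=
  ⟨comp_mono_left h, comp_mono_left h⟩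

/-- A part of `s` that does not propagate survives unchanged in both concatenations, so its points
are dead. -/
theorem exists_of_not_dead {s : PartitionDiagram n} {x : Fin n} (h : ¬ Dead (compPair s q) x) :
    ∃ b, s (Sum.inl x) (Sum.inr b) := by
  by_contra hx
  push Not at hx
  refine h fun z hz => ?_
  obtain ⟨y, rfl, hy⟩ : ∃ y, z = Sum.inl y ∧ s (Sum.inl x) (Sum.inl y) :=
    hz.elim (comp_inl_of_forall_not hx) (comp_inl_of_forall_not hx)
  exact ⟨⟨y, rfl⟩, meetRow_compPair hy⟩

theorem exists_rep (c : {c : Quotient (liveDiagram q) // (∃ a, Quotient.mk _ (Sum.inl a) = c) ∧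
      ∃ b, Quotient.mk _ (Sum.inr b) = c}) :
    ∃ x, Quotient.mk (liveDiagram q) (Sum.inl x) = c.1 ∧ ¬ Dead q x := by
  obtain ⟨⟨a, ha⟩, ⟨b, hb⟩⟩ := c.2
  exact ⟨a, ha, (liveDiagram_inl_inr.1 (Quotient.exact (ha.trans hb.symm))).2⟩

/-- A live point of `compPair s q` lies on a propagating line of `s`. The output parts of `s` refine
the common refinement, so distinct live parts select distinct lines. -/
theorem exists_injective_live (s : PartitionDiagram n)
    (q : PartitionDiagram n × PartitionDiagram n) :
    ∃ f : {c : Quotient (liveDiagram (compPair s q)) // (∃ a, Quotient.mk _ (Sum.inl a) = c) ∧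
      ∃ b, Quotient.mk _ (Sum.inr b) = c} → {c : Quotient s // (∃ a, Quotient.mk _ (Sum.inl a) = c) ∧
      ∃ b, Quotient.mk _ (Sum.inr b) = c}, Function.Injective f ∧
      ∀ c, ∃ x, Quotient.mk s (Sum.inl x) = (f c).1 ∧
        Quotient.mk (liveDiagram (compPair s q)) (Sum.inl x) = c.1 ∧ ¬ Dead (compPair s q) x := by
  choose x hx hd using fun c => exists_rep (q := compPair s q) c
  refine ⟨fun c => ⟨Quotient.mk s (Sum.inl (x c)), ⟨x c, rfl⟩, ?_⟩, ?_, ?_⟩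
  · obtain ⟨b, hb⟩ := exists_of_not_dead (hd c)
    exact ⟨b, Quotient.sound (s.symm' hb)⟩
  · intro c c' h
    have h1 : s (Sum.inl (x c)) (Sum.inl (x c')) := Quotient.exact (congrArg Subtype.val h)
    have h2 : liveDiagram (compPair s q) (Sum.inl (x c)) (Sum.inl (x c')) :=
      liveDiagram_inl_inl.2 (meetRow_compPair h1)
    exact Subtype.ext ((hx c).symm.trans ((Quotient.sound h2).trans (hx c')))
  · exact fun c => ⟨x c, rfl, hx c, hd c⟩

/-- The number of live parts of the common refinement. -/
noncomputable def liveRank (q : PartitionDiagram n × PartitionDiagram n) : ℕ :=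
  (liveDiagram q).rank

theorem liveRank_compPair_le_rank (s : PartitionDiagram n)
    (q : PartitionDiagram n × PartitionDiagram n) : liveRank (compPair s q) ≤ s.rank := by
  obtain ⟨f, hf, -⟩ := exists_injective_live s q
  exact Nat.card_le_card_of_injective f hf

/-- As `liveDiagram q` fixes `q`, the pair is also obtained from `q` by `comp s (liveDiagram q)`,
whose rank is at most the live rank of `q`. -/
theorem liveRank_compPair_le (s : PartitionDiagram n)
    (q : PartitionDiagram n × PartitionDiagram n) : liveRank (compPair s q) ≤ liveRank q := by
  conv_lhs => rw [← compPair_liveDiagram q, compPair_compPair]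
  exact (liveRank_compPair_le_rank _ _).trans (rank_comp_le _ _)

/-- An element of a left cell is determined, up to a permutation, by the result of its
concatenation with a pair of diagrams, if the number of live parts is maximal. -/
theorem key_eq_of_liveRank (r : LeftCell n i) (q : PartitionDiagram n × PartitionDiagram n)
    (h : liveRank (compPair r.1 q) = i) :
    LeftCell.key r = (meetRow (compPair r.1 q), {x | ¬ Dead (compPair r.1 q) x}) := by
  obtain ⟨f, hf, hx⟩ := exists_injective_live r.1 q
  -- There are as many live parts as propagating lines of `r`, so each line is selected by exactly
  -- one live part.
  have hbij := Function.Injective.bijective_of_nat_card_le hf (r.2.1.trans h.symm).le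
  have hprop : ∀ x b, r.1 (Sum.inl x) (Sum.inr b) → ¬ Dead (compPair r.1 q) x := by
    intro x b hxb
    obtain ⟨c, hc⟩ := hbij.2 ⟨Quotient.mk r.1 (Sum.inl x), ⟨x, rfl⟩, b,
      Quotient.sound (r.1.symm' hxb)⟩
    obtain ⟨y, hy, -, hd⟩ := hx c
    rw [hc] at hy
    exact fun hd' => hd (hd'.congr (meetRow_compPair (r.1.symm' (Quotient.exact hy))))
  -- Two lines inside one live part would be selected by the same part, so they coincide; parts off
  -- the propagating lines are unchanged by concatenation.
  have hmeet : ∀ x y, meetRow (compPair r.1 q) x y → r.1 (Sum.inl x) (Sum.inl y) := by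
    intro x y hxy
    by_cases hxp : ∃ b, r.1 (Sum.inl x) (Sum.inr b)
    · by_cases hyp : ∃ b, r.1 (Sum.inl y) (Sum.inr b)
      · obtain ⟨b, hb⟩ := hxp
        obtain ⟨b', hb'⟩ := hyp
        obtain ⟨c, hc⟩ := hbij.2 ⟨Quotient.mk r.1 (Sum.inl x), ⟨x, rfl⟩, b,
          Quotient.sound (r.1.symm' hb)⟩
        obtain ⟨c', hc'⟩ := hbij.2 ⟨Quotient.mk r.1 (Sum.inl y), ⟨y, rfl⟩, b',
          Quotient.sound (r.1.symm' hb')⟩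
        obtain ⟨x', hx1, hx2, -⟩ := hx c
        obtain ⟨y', hy1, hy2, -⟩ := hx c'
        rw [hc] at hx1
        rw [hc'] at hy1
        have h1 : meetRow (compPair r.1 q) x' x := meetRow_compPair (Quotient.exact hx1)
        have h2 : meetRow (compPair r.1 q) y' y := meetRow_compPair (Quotient.exact hy1)
        have h3 : meetRow (compPair r.1 q) x' y' :=
          Setoid.trans' _ h1 (Setoid.trans' _ hxy (Setoid.symm' _ h2))
        have h4 : c = c' := Subtype.ext
          (hx2.symm.trans ((Quotient.sound (liveDiagram_inl_inl.2 h3)).trans hy2))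
        rw [h4] at hc
        exact Quotient.exact (congrArg Subtype.val (hc.symm.trans hc'))
      · push Not at hyp
        obtain ⟨z, hz, h1⟩ := comp_inl_of_forall_not hyp (Setoid.symm' _ hxy.1)
        cases hz
        exact r.1.symm' h1
    · push Not at hxp
      obtain ⟨z, hz, h1⟩ := comp_inl_of_forall_not hxp hxy.1
      cases hz
      exact h1
  refine Prod.ext (Setoid.ext fun x y => ⟨meetRow_compPair, hmeet x y⟩) (Set.ext fun x => ?_)
  exact ⟨fun ⟨b, hb⟩ => hprop x b hb, exists_of_not_dead⟩

end PartitionDiagram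

/-! ### Standard filtrations -/

section Filtration

variable {k : Type*} [Field k] {n : ℕ} {x : k}

/-- A pair of nested submodules whose subquotient is a standard module. -/
def StandardStep (k : Type*) [Field k] (n : ℕ) (x : k) {M : Type*} [AddCommGroup M]
    [Module (PartitionAlgebra k n x) M] (N N' : Submodule (PartitionAlgebra k n x) M) : Prop :=
  N ≤ N' ∧ ∃ (i : ℕ) (hi : i ≤ n) (lam : YoungDiagram) (t : lam.cells ≃ Fin i)
    (g : N' →ₗ[PartitionAlgebra k n x] StandardModule k x hi t),
    Function.Surjective g ∧ ∀ v, g v = 0 ↔ v.1 ∈ N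

variable {M M' M'' : Type*} [AddCommGroup M] [Module (PartitionAlgebra k n x) M]
  [AddCommGroup M'] [Module (PartitionAlgebra k n x) M']
  [AddCommGroup M''] [Module (PartitionAlgebra k n x) M'']

theorem standardStep_iff {N N' : Submodule (PartitionAlgebra k n x) M} :
    StandardStep k n x N N' ↔ N ≤ N' ∧
      ∃ (i : ℕ) (hi : i ≤ n) (lam : YoungDiagram) (t : lam.cells ≃ Fin i),
      Nonempty ((N' ⧸ N.submoduleOf N') ≃ₗ[PartitionAlgebra k n x] StandardModule k x hi t) := by
  refine and_congr_right fun _ => ⟨?_, ?_⟩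
  · rintro ⟨i, hi, lam, t, g, hg, hk⟩
    have hker : N.submoduleOf N' = LinearMap.ker g := by
      ext v
      rw [LinearMap.mem_ker, hk]
      rfl
    exact ⟨i, hi, lam, t, ⟨(Submodule.quotEquivOfEq _ _ hker).trans
      (g.quotKerEquivOfSurjective hg)⟩⟩
  · rintro ⟨i, hi, lam, t, ⟨e⟩⟩
    refine ⟨i, hi, lam, t, e.toLinearMap.comp (Submodule.mkQ _),
      e.surjective.comp (Submodule.mkQ_surjective _), fun v => ?_⟩
    rw [LinearMap.comp_apply, LinearEquiv.coe_coe, e.map_eq_zero_iff, Submodule.mkQ_apply,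
      Submodule.Quotient.mk_eq_zero]
    rfl

/-- As chains of steps, filtrations can be transported along images and preimages and concatenated
without reindexing. -/
theorem hasStandardFiltration_iff :
    HasStandardFiltration k n x M ↔
      Relation.ReflTransGen (StandardStep k n x) (⊥ : Submodule (PartitionAlgebra k n x) M) ⊤ := by
  constructor
  · rintro ⟨m, F, hF, h0, h1, hs⟩
    rw [← h0, ← h1]
    have key : ∀ j, Relation.ReflTransGen (StandardStep k n x) (F 0) (F j) := by
      intro j
      induction j using Fin.induction with
      | zero => exact Relation.ReflTransGen.refl
      | succ j ih => exact ih.tail (standardStep_iff.2 ⟨hF (Fin.castSucc_lt_succ).le, hs j⟩)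
    exact key _
  · intro h
    have key : ∀ N : Submodule (PartitionAlgebra k n x) M,
        Relation.ReflTransGen (StandardStep k n x) ⊥ N →
        ∃ (m : ℕ) (F : Fin (m + 1) → Submodule (PartitionAlgebra k n x) M),
          F 0 = ⊥ ∧ F (Fin.last m) = N ∧
          ∀ j : Fin m, StandardStep k n x (F j.castSucc) (F j.succ) := by
      intro N hN
      induction hN with
      | refl => exact ⟨0, fun _ => ⊥, rfl, rfl, fun j => j.elim0⟩
      | @tail N N' _ hs ih =>
        obtain ⟨m, F, h0, h1, h2⟩ := ih
        refine ⟨m + 1, Fin.snoc (α := fun _ => Submodule (PartitionAlgebra k n x) M) F N', ?_, ?_, ?_⟩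
        · rw [← Fin.castSucc_zero, Fin.snoc_castSucc, h0]
        · rw [Fin.snoc_last]
        · intro j
          rw [Fin.snoc_castSucc]
          induction j using Fin.lastCases with
          | last => rwa [Fin.succ_last, Fin.snoc_last, h1]
          | cast j => rw [Fin.succ_castSucc, Fin.snoc_castSucc]; exact h2 j
    obtain ⟨m, F, h0, h1, h2⟩ := key _ h
    exact ⟨m, F, Fin.monotone_iff_le_succ.2 fun j => (h2 j).1, h0, h1,
      fun j => (standardStep_iff.1 (h2 j)).2⟩

theorem StandardStep.map {N N' : Submodule (PartitionAlgebra k n x) M}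
    (h : StandardStep k n x N N') (f : M →ₗ[PartitionAlgebra k n x] M')
    (hf : Function.Injective f) : StandardStep k n x (N.map f) (N'.map f) := by
  obtain ⟨hle, i, hi, lam, t, g, hg, hk⟩ := h
  refine ⟨Submodule.map_mono hle, i, hi, lam, t,
    g.comp (Submodule.equivMapOfInjective f hf N').symm.toLinearMap,
    hg.comp (LinearEquiv.surjective _), fun v => ?_⟩
  obtain ⟨w, rfl⟩ := (Submodule.equivMapOfInjective f hf N').surjective v
  rw [LinearMap.comp_apply, LinearEquiv.coe_coe, LinearEquiv.symm_apply_apply, hk,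
    Submodule.coe_equivMapOfInjective_apply, Submodule.mem_map]
  exact ⟨fun h => ⟨_, h, rfl⟩, fun ⟨u, hu, huw⟩ => hf huw ▸ hu⟩

theorem StandardStep.comap {N N' : Submodule (PartitionAlgebra k n x) M'}
    (h : StandardStep k n x N N') (f : M →ₗ[PartitionAlgebra k n x] M')
    (hf : Function.Surjective f) : StandardStep k n x (N.comap f) (N'.comap f) := by
  obtain ⟨hle, i, hi, lam, t, g, hg, hk⟩ := h
  refine ⟨Submodule.comap_mono hle, i, hi, lam, t,
    g.comp (f.restrict (p := N'.comap f) (q := N') fun v hv => hv), fun y => ?_, fun v => ?_⟩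
  · obtain ⟨w, rfl⟩ := hg y
    obtain ⟨v, hv⟩ := hf w.1
    exact ⟨⟨v, show f v ∈ N' by rw [hv]; exact w.2⟩, congrArg g (Subtype.ext hv)⟩
  · rw [LinearMap.comp_apply, hk]
    rfl

/-- Modules with a standard filtration are closed under extensions. -/
theorem HasStandardFiltration.of_exact (f : M →ₗ[PartitionAlgebra k n x] M')
    (g : M' →ₗ[PartitionAlgebra k n x] M'') (hf : Function.Injective f)
    (hg : Function.Surjective g) (hfg : LinearMap.range f = LinearMap.ker g)
    (h : HasStandardFiltration k n x M) (h'' : HasStandardFiltration k n x M'') :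
    HasStandardFiltration k n x M' := by
  rw [hasStandardFiltration_iff] at *
  -- The image of the filtration of `M` runs from `⊥` to `range f = ker g`; the preimage of the
  -- filtration of `M''` continues from there to `⊤`.
  have h1 : Relation.ReflTransGen (StandardStep k n x) (Submodule.map f ⊥) (Submodule.map f ⊤) :=
    Relation.ReflTransGen.lift (r := StandardStep k n x)
    (p := StandardStep k n x) (Submodule.map f) (fun N N' hs => StandardStep.map hs f hf) _ _ h
  have h2 : Relation.ReflTransGen (StandardStep k n x) (Submodule.comap g ⊥) (Submodule.comap g ⊤) :=
    Relation.ReflTransGen.lift (r := StandardStep k n x)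
    (p := StandardStep k n x) (Submodule.comap g) (fun N N' hs => StandardStep.comap hs g hg) _ _ h''
  rw [Submodule.map_bot, Submodule.map_top, hfg] at h1
  rw [Submodule.comap_bot, Submodule.comap_top] at h2
  exact h1.trans h2

theorem HasStandardFiltration.of_submodule (N : Submodule (PartitionAlgebra k n x) M)
    (h : HasStandardFiltration k n x N) (h' : HasStandardFiltration k n x (M ⧸ N)) :
    HasStandardFiltration k n x M :=
  HasStandardFiltration.of_exact N.subtype N.mkQ N.subtype_injective N.mkQ_surjective
    (by rw [Submodule.range_subtype, Submodule.ker_mkQ]) h h'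

theorem HasStandardFiltration.of_subsingleton [Subsingleton M] :
    HasStandardFiltration k n x M := by
  rw [hasStandardFiltration_iff, Subsingleton.elim (⊤ : Submodule (PartitionAlgebra k n x) M) ⊥]

theorem HasStandardFiltration.of_equiv (e : M ≃ₗ[PartitionAlgebra k n x] M')
    (h : HasStandardFiltration k n x M) : HasStandardFiltration k n x M' := by
  refine HasStandardFiltration.of_exact (M'' := PUnit) e.toLinearMap 0 e.injective
    (fun _ => ⟨0, rfl⟩) ?_ h HasStandardFiltration.of_subsingleton
  rw [LinearMap.ker_zero, LinearEquiv.range]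

theorem HasStandardFiltration.standardModule {i : ℕ} (hi : i ≤ n) {lam : YoungDiagram}
    (t : lam.cells ≃ Fin i) : HasStandardFiltration k n x (StandardModule k x hi t) := by
  rw [hasStandardFiltration_iff]
  refine Relation.ReflTransGen.single ⟨bot_le, i, hi, lam, t, Submodule.subtype ⊤,
    fun v => ⟨⟨v, trivial⟩, rfl⟩, fun v => ?_⟩
  exact (Submodule.mem_bot _).symm

end Filtration

/-! ### Tensor products -/

namespace PartitionAlgebra

variable {k : Type*} [Field k] {n : ℕ} {x a b : k}

/-- A linear map which commutes with the action of the diagrams. -/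
noncomputable def linearMapOfDiag {M M' : Type*} [AddCommGroup M] [Module k M]
    [Module (PartitionAlgebra k n x) M] [IsScalarTower k (PartitionAlgebra k n x) M]
    [AddCommGroup M'] [Module k M']
    [Module (PartitionAlgebra k n x) M'] [IsScalarTower k (PartitionAlgebra k n x) M']
    (f : M →ₗ[k] M') (hf : ∀ (d : PartitionDiagram n) v, f (diag x d • v) = diag x d • f v) :
    M →ₗ[PartitionAlgebra k n x] M' :=
  { f with
    map_smul' := fun p v => by
      refine LinearMap.congr_fun
        (f := f.comp ((LinearMap.toSpanSingleton (PartitionAlgebra k n x) M v).restrictScalars k))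
        (g := (LinearMap.toSpanSingleton (PartitionAlgebra k n x) M' (f v)).restrictScalars k)
        (linear_ext fun d => hf d v) p }

variable (n a b)
variable (X Y : Type*)
    [AddCommGroup X] [Module k X] [Module (PartitionAlgebra k n a) X]
    [IsScalarTower k (PartitionAlgebra k n a) X]
    [AddCommGroup Y] [Module k Y] [Module (PartitionAlgebra k n b) Y]
    [IsScalarTower k (PartitionAlgebra k n b) Y]
    {X' Y' : Type*}
    [AddCommGroup X'] [Module k X'] [Module (PartitionAlgebra k n a) X']
    [IsScalarTower k (PartitionAlgebra k n a) X']
    [AddCommGroup Y'] [Module k Y'] [Module (PartitionAlgebra k n b) Y']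
    [IsScalarTower k (PartitionAlgebra k n b) Y']

/-- The tensor product of modules over `P_n(a)` and `P_n(b)`, as a module over `P_n(ab)`. -/
def TensorRep {k : Type*} [Field k] (n : ℕ) (a b : k) (X Y : Type*)
    [AddCommGroup X] [Module k X] [Module (PartitionAlgebra k n a) X]
    [IsScalarTower k (PartitionAlgebra k n a) X]
    [AddCommGroup Y] [Module k Y] [Module (PartitionAlgebra k n b) Y]
    [IsScalarTower k (PartitionAlgebra k n b) Y] : Type _ := X ⊗[k] Y

noncomputable instance : AddCommGroup (TensorRep n a b X Y) :=
  inferInstanceAs (AddCommGroup (X ⊗[k] Y))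

noncomputable instance : Module k (TensorRep n a b X Y) :=
  inferInstanceAs (Module k (X ⊗[k] Y))

noncomputable instance : Module (PartitionAlgebra k n (a * b)) (TensorRep n a b X Y) :=
  tensorModule n a b X Y

variable {X Y}

/-- A pure tensor. -/
def TensorRep.tmul (v : X) (w : Y) : TensorRep n a b X Y := v ⊗ₜ[k] w

theorem TensorRep.smul_def (p : PartitionAlgebra k n (a * b)) (z : TensorRep n a b X Y) :
    p • z = outerTensor n a b X Y (comul k n a b p) z := rfl

instance : IsScalarTower k (PartitionAlgebra k n (a * b)) (TensorRep n a b X Y) :=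
  ⟨fun c p z => by
    rw [TensorRep.smul_def, TensorRep.smul_def, map_smul, map_smul]
    rfl⟩

theorem TensorRep.diag_smul_tmul (d : PartitionDiagram n) (v : X) (w : Y) :
    diag (a * b) d • TensorRep.tmul n a b v w =
      TensorRep.tmul n a b (diag a d • v) (diag b d • w) := by
  rw [TensorRep.smul_def, comul, lift_diag]
  rfl

@[elab_as_elim]
theorem TensorRep.induction_on {p : TensorRep n a b X Y → Prop} (z : TensorRep n a b X Y)
    (zero : p 0) (tmul : ∀ v w, p (TensorRep.tmul n a b v w))
    (add : ∀ z z', p z → p z' → p (z + z')) : p z :=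
  TensorProduct.induction_on z zero tmul add

/-- The linear map underlying the functoriality of the tensor product. -/
noncomputable def TensorRep.linearMap (f : X →ₗ[PartitionAlgebra k n a] X')
    (g : Y →ₗ[PartitionAlgebra k n b] Y') : TensorRep n a b X Y →ₗ[k] TensorRep n a b X' Y' :=
  TensorProduct.map (f.restrictScalars k) (g.restrictScalars k)

theorem TensorRep.linearMap_tmul (f : X →ₗ[PartitionAlgebra k n a] X')
    (g : Y →ₗ[PartitionAlgebra k n b] Y') (v : X) (w : Y) :
    TensorRep.linearMap n a b f g (TensorRep.tmul n a b v w) =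
      TensorRep.tmul n a b (f v) (g w) := rfl

/-- Functoriality of the tensor product. -/
noncomputable def TensorRep.map (f : X →ₗ[PartitionAlgebra k n a] X')
    (g : Y →ₗ[PartitionAlgebra k n b] Y') :
    TensorRep n a b X Y →ₗ[PartitionAlgebra k n (a * b)] TensorRep n a b X' Y' :=
  linearMapOfDiag (TensorRep.linearMap n a b f g) (fun d z => by
    induction z using TensorRep.induction_on with
    | zero => rw [smul_zero, map_zero, smul_zero]
    | tmul v w => rw [diag_smul_tmul, linearMap_tmul, linearMap_tmul, diag_smul_tmul, map_smul,
        map_smul]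
    | add v w hv hw => rw [smul_add, map_add, map_add, smul_add, hv, hw])

theorem TensorRep.map_tmul (f : X →ₗ[PartitionAlgebra k n a] X')
    (g : Y →ₗ[PartitionAlgebra k n b] Y') (v : X) (w : Y) :
    TensorRep.map n a b f g (TensorRep.tmul n a b v w) = TensorRep.tmul n a b (f v) (g w) := rfl

/-- Tensoring with a fixed module preserves the existence of a standard filtration, if the
tensor product with every standard module has a standard filtration. -/
theorem hasStandardFiltration_tensorRep_left
    (H : ∀ (i : ℕ) (hi : i ≤ n) (lam : YoungDiagram) (t : lam.cells ≃ Fin i),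
      HasStandardFiltration k n (a * b) (TensorRep n a b (StandardModule k a hi t) Y))
    (hX : HasStandardFiltration k n a X) :
    HasStandardFiltration k n (a * b) (TensorRep n a b X Y) := by
  rw [hasStandardFiltration_iff] at hX
  have key : ∀ N : Submodule (PartitionAlgebra k n a) X,
      Relation.ReflTransGen (StandardStep k n a) ⊥ N →
      HasStandardFiltration k n (a * b) (TensorRep n a b N Y) := by
    intro N hN
    induction hN with
    | refl =>
      have : Subsingleton (TensorRep n a b (⊥ : Submodule (PartitionAlgebra k n a) X) Y) :=
        inferInstanceAs (Subsingleton ((⊥ : Submodule (PartitionAlgebra k n a) X) ⊗[k] Y))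
      exact HasStandardFiltration.of_subsingleton
    | @tail N N' _ hs ih =>
      obtain ⟨hle, i, hi, lam, t, g, hg, hk⟩ := hs
      have hex : Function.Exact ((Submodule.inclusion hle).restrictScalars k)
          (g.restrictScalars k) := by
        intro v
        rw [LinearMap.restrictScalars_apply, hk]
        exact ⟨fun h => ⟨⟨v.1, h⟩, rfl⟩, fun ⟨u, hu⟩ => hu ▸ u.2⟩
      refine HasStandardFiltration.of_exact
        (TensorRep.map n a b (Submodule.inclusion hle) (LinearMap.id (M := Y)))
        (TensorRep.map n a b g (LinearMap.id (M := Y))) ?_ ?_ ?_ ih (H i hi lam t)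
      · exact Module.Flat.rTensor_preserves_injective_linearMap (M := Y)
          ((Submodule.inclusion hle).restrictScalars k) (Submodule.inclusion_injective hle)
      · exact LinearMap.rTensor_surjective Y (g := g.restrictScalars k) hg
      · have := rTensor_exact Y hex hg
        ext z
        exact (this z).symm
  refine (key ⊤ hX).of_equiv (LinearEquiv.ofBijective
    (TensorRep.map n a b (Submodule.topEquiv (R := PartitionAlgebra k n a) (M := X)).toLinearMap
      (LinearMap.id (M := Y))) ⟨?_, ?_⟩)
  · exact Module.Flat.rTensor_preserves_injective_linearMap (M := Y)
      ((Submodule.topEquiv (R := PartitionAlgebra k n a) (M := X)).toLinearMap.restrictScalars k)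
      (LinearEquiv.injective _)
  · exact LinearMap.rTensor_surjective Y
      (g := (Submodule.topEquiv (R := PartitionAlgebra k n a) (M := X)).toLinearMap.restrictScalars k)
      (LinearEquiv.surjective _)

theorem hasStandardFiltration_tensorRep_right
    (H : ∀ (i : ℕ) (hi : i ≤ n) (lam : YoungDiagram) (t : lam.cells ≃ Fin i),
      HasStandardFiltration k n (a * b) (TensorRep n a b X (StandardModule k b hi t)))
    (hY : HasStandardFiltration k n b Y) :
    HasStandardFiltration k n (a * b) (TensorRep n a b X Y) := by
  rw [hasStandardFiltration_iff] at hY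
  have key : ∀ N : Submodule (PartitionAlgebra k n b) Y,
      Relation.ReflTransGen (StandardStep k n b) ⊥ N →
      HasStandardFiltration k n (a * b) (TensorRep n a b X N) := by
    intro N hN
    induction hN with
    | refl =>
      have : Subsingleton (TensorRep n a b X (⊥ : Submodule (PartitionAlgebra k n b) Y)) :=
        inferInstanceAs (Subsingleton (X ⊗[k] (⊥ : Submodule (PartitionAlgebra k n b) Y)))
      exact HasStandardFiltration.of_subsingleton
    | @tail N N' _ hs ih =>
      obtain ⟨hle, i, hi, lam, t, g, hg, hk⟩ := hs
      have hex : Function.Exact ((Submodule.inclusion hle).restrictScalars k)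
          (g.restrictScalars k) := by
        intro v
        rw [LinearMap.restrictScalars_apply, hk]
        exact ⟨fun h => ⟨⟨v.1, h⟩, rfl⟩, fun ⟨u, hu⟩ => hu ▸ u.2⟩
      refine HasStandardFiltration.of_exact
        (TensorRep.map n a b (LinearMap.id (M := X)) (Submodule.inclusion hle))
        (TensorRep.map n a b (LinearMap.id (M := X)) g) ?_ ?_ ?_ ih (H i hi lam t)
      · exact Module.Flat.lTensor_preserves_injective_linearMap (M := X)
          ((Submodule.inclusion hle).restrictScalars k) (Submodule.inclusion_injective hle)
      · exact LinearMap.lTensor_surjective X (g := g.restrictScalars k) hg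
      · have := lTensor_exact X hex hg
        ext z
        exact (this z).symm
  refine (key ⊤ hY).of_equiv (LinearEquiv.ofBijective
    (TensorRep.map n a b (LinearMap.id (M := X))
      (Submodule.topEquiv (R := PartitionAlgebra k n b) (M := Y)).toLinearMap) ⟨?_, ?_⟩)
  · exact Module.Flat.lTensor_preserves_injective_linearMap (M := X)
      ((Submodule.topEquiv (R := PartitionAlgebra k n b) (M := Y)).toLinearMap.restrictScalars k)
      (LinearEquiv.injective _)
  · exact LinearMap.lTensor_surjective X
      (g := (Submodule.topEquiv (R := PartitionAlgebra k n b) (M := Y)).toLinearMap.restrictScalars k)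
      (LinearEquiv.surjective _)

end PartitionAlgebra

/-! ### Layers -/

namespace PartitionDiagram

instance (n : ℕ) : Finite (PartitionDiagram n) :=
  Finite.of_injective (fun d : PartitionDiagram n => fun u v => d u v) fun _ _ h =>
    Setoid.ext fun u v => iff_of_eq (congrFun (congrFun h u) v)

/-- The orbits of the symmetric group on a left cell. -/
abbrev KeyClass (n m : ℕ) : Type := Quotient (Setoid.ker (LeftCell.key : LeftCell n m → _))

noncomputable instance (n m : ℕ) : Fintype (KeyClass n m) := Fintype.ofFinite _

theorem LeftCell.exists_eq_out_comp {n m : ℕ} (hm : m ≤ n) (l : LeftCell n m) :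
    ∃ (c : KeyClass n m) (σ : Equiv.Perm (Fin m)),
      l.1 = comp c.out.1 (ofPerm (σ.viaFintypeEmbedding (Fin.castLEEmb hm))) := by
  obtain ⟨σ, hσ⟩ := LeftCell.exists_comp_ofPerm hm
    (Quotient.mk (Setoid.ker LeftCell.key) l).out l (Quotient.mk_out (s := Setoid.ker LeftCell.key) l)
  exact ⟨_, σ, hσ⟩

/-- The diagram `proj n m` as an element of its left cell. -/
def LeftCell.projElem {n m : ℕ} (hm : m ≤ n) : LeftCell n m :=
  ⟨proj n m, rank_proj hm, idDiagram n, (id_comp_loops _).1⟩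

theorem proj_comp_ofPerm {n m : ℕ} (hm : m ≤ n) (σ : Equiv.Perm (Fin m)) :
    comp (proj n m) (ofPerm (σ.viaFintypeEmbedding (Fin.castLEEmb hm))) =
      comp (ofPerm (σ.viaFintypeEmbedding (Fin.castLEEmb hm))) (proj n m) := by
  set τ := σ.viaFintypeEmbedding (Fin.castLEEmb hm) with hτ
  have hlt : ∀ b : Fin n, b.1 < m → (τ b).1 < m := by
    intro b hb
    have : τ (Fin.castLEEmb hm ⟨b.1, hb⟩) = Fin.castLEEmb hm (σ ⟨b.1, hb⟩) :=
      Equiv.Perm.viaFintypeEmbedding_apply_image σ (Fin.castLEEmb hm) ⟨b.1, hb⟩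
    change τ b = _ at this
    rw [this]
    exact (σ ⟨b.1, hb⟩).2
  have hge : ∀ b : Fin n, ¬ b.1 < m → τ b = b := by
    intro b hb
    refine Equiv.Perm.viaFintypeEmbedding_apply_notMem_range σ (Fin.castLEEmb hm) ?_
    rintro ⟨c, rfl⟩
    exact hb c.2
  have hlt' : ∀ b : Fin n, (τ b).1 < m ↔ b.1 < m := fun b =>
    ⟨fun h => by by_contra hb; rw [hge b hb] at h; exact hb h, hlt b⟩
  rw [comp_ofPerm, ofPerm_comp]
  have hio : ∀ a b : Fin n, proj n m (Sum.inl a) (Sum.inr (τ b)) ↔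
      proj n m (Sum.inl (τ.symm a)) (Sum.inr b) := by
    intro a b
    rw [proj_inl_inr, proj_inl_inr, Equiv.symm_apply_eq]
    refine and_congr_right fun h => ?_
    subst h
    rw [Equiv.symm_apply_apply, hlt']
  refine Setoid.ext fun u v => ?_
  rcases u with u | u <;> rcases v with v | v
  · exact proj_inl_inl.trans (proj_inl_inl.trans (Equiv.injective _).eq_iff).symm
  · exact hio u v
  · exact (proj n m).comm'.trans ((hio v u).trans (proj n m).comm')
  · exact (proj_inr_inr.trans (Equiv.injective _).eq_iff).trans proj_inr_inr.symm

end PartitionDiagram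

/-! ### Homomorphisms out of standard modules -/

namespace PartitionAlgebra

variable {k : Type*} [Field k] {n m : ℕ} (x : k)

/-- The group algebra of `S_m`, acting on the first `m` points. -/
noncomputable def ofPermAlg (k : Type*) [Field k] {n m : ℕ} (x : k) (hm : m ≤ n) :
    MonoidAlgebra k (Equiv.Perm (Fin m)) →ₐ[k] PartitionAlgebra k n x :=
  MonoidAlgebra.lift k _ _
    { toFun := fun σ => diag x (ofPerm (σ.viaFintypeEmbedding (Fin.castLEEmb hm)))
      map_one' := by
        rw [Equiv.Perm.viaFintypeEmbedding, Equiv.Perm.extendDomain_one]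
        rfl
      map_mul' := fun σ τ => by
        rw [diag_mul_diag, loops_ofPerm, pow_zero, one_smul, ofPerm_mul,
          Equiv.Perm.viaFintypeEmbedding, Equiv.Perm.viaFintypeEmbedding,
          Equiv.Perm.viaFintypeEmbedding, Equiv.Perm.extendDomain_mul] }

theorem ofPermAlg_single (hm : m ≤ n) (σ : Equiv.Perm (Fin m)) :
    ofPermAlg k x hm (MonoidAlgebra.single σ 1) =
      diag x (ofPerm (σ.viaFintypeEmbedding (Fin.castLEEmb hm))) := by
  rw [ofPermAlg, MonoidAlgebra.lift_single, one_smul]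
  rfl

theorem diag_proj_mul_ofPermAlg (hm : m ≤ n) (u : MonoidAlgebra k (Equiv.Perm (Fin m))) :
    diag x (proj n m) * ofPermAlg k x hm u = ofPermAlg k x hm u * diag x (proj n m) := by
  induction u using MonoidAlgebra.induction_on with
  | of σ =>
    rw [MonoidAlgebra.of_apply, ofPermAlg_single, diag_mul_diag, diag_mul_diag, loops_ofPerm,
      ofPerm_loops, proj_comp_ofPerm]
  | add u v hu hv => rw [map_add, mul_add, add_mul, hu, hv]
  | smul r u hu => rw [map_smul, mul_smul_comm, smul_mul_assoc, hu]

theorem diag_proj_mul_self : diag x (proj n m) * diag x (proj n m) =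
    x ^ loops (proj n m) (proj n m) • diag x (proj n m) := by
  rw [diag_mul_diag, proj_comp_proj]

/-- The linear map from the cell module to the partition algebra which identifies the bases. -/
noncomputable def ofCell : CellModule k n m x →ₗ[k] PartitionAlgebra k n x :=
  Finsupp.linearCombination k fun l : LeftCell n m => diag x l.1

theorem ofCell_basisElem (l : LeftCell n m) : ofCell x (CellModule.basisElem x l) = diag x l.1 := by
  change Finsupp.linearCombination k _ (Finsupp.single l 1) = _
  simp

/-- The map `ofCell` is not linear over the algebra: the cell module replaces products of rank below
`m` by zero. The discrepancy is invisible on `N`, where such diagrams act as zero. -/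
theorem ofCell_diag_smul {N : Type*} [AddCommGroup N] [Module k N]
    [Module (PartitionAlgebra k n x) N] [IsScalarTower k (PartitionAlgebra k n x) N]
    (h : ∀ d : PartitionDiagram n, d.rank < m → ∀ v : N, diag x d • v = 0)
    (d : PartitionDiagram n) (y : CellModule k n m x) (v : N) :
    ofCell x (diag x d • y) • v = diag x d • ofCell x y • v := by
  have key : ((LinearMap.toSpanSingleton (PartitionAlgebra k n x) N v).restrictScalars k).comp
        ((ofCell x).comp (CellModule.rep k n m x (diag x d))) =
      (Algebra.lsmul k k N (diag x d)).comp
        (((LinearMap.toSpanSingleton (PartitionAlgebra k n x) N v).restrictScalars k).comp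
          (ofCell x)) := by
    refine CellModule.linear_ext fun l => ?_
    change ofCell x (CellModule.rep k n m x (diag x d) (CellModule.basisElem x l)) • v =
      diag x d • ofCell x (CellModule.basisElem x l) • v
    rw [ofCell_basisElem, CellModule.rep, lift_diag, CellModule.act_basisElem,
      CellModule.actBasis, ← mul_smul, diag_mul_diag]
    split_ifs with hr
    · rw [map_smul, ofCell_basisElem]
    · rw [map_zero, zero_smul, smul_assoc, h _ (lt_of_le_of_ne ((rank_comp_le _ _).trans l.2.1.le) hr),
        smul_zero]
  exact LinearMap.congr_fun key y

variable {lam : YoungDiagram}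

/-- Every element of the left cell is an orbit representative followed by a permutation, and the
permutation moves across the tensor sign. -/
theorem exists_eq_sum_out (hm : m ≤ n) (t : lam.cells ≃ Fin m) (z : StandardModule k x hm t) :
    ∃ v : KeyClass n m → Specht k t, z = Submodule.Quotient.mk
      (∑ c, CellModule.basisElem x (Quotient.out c) ⊗ₜ[k] v c) := by
  classical
  obtain ⟨z, rfl⟩ := Submodule.Quotient.mk_surjective _ z
  have hadd : ∀ z z' : CellModule k n m x ⊗[k] Specht k t,
      (∃ v : KeyClass n m → Specht k t, (Submodule.Quotient.mk z : StandardModule k x hm t) =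
        Submodule.Quotient.mk (∑ c, CellModule.basisElem x (Quotient.out c) ⊗ₜ[k] v c)) →
      (∃ v : KeyClass n m → Specht k t, (Submodule.Quotient.mk z' : StandardModule k x hm t) =
        Submodule.Quotient.mk (∑ c, CellModule.basisElem x (Quotient.out c) ⊗ₜ[k] v c)) →
      ∃ v : KeyClass n m → Specht k t, (Submodule.Quotient.mk (z + z') : StandardModule k x hm t) =
        Submodule.Quotient.mk (∑ c, CellModule.basisElem x (Quotient.out c) ⊗ₜ[k] v c) := by
    rintro z z' ⟨v, hv⟩ ⟨v', hv'⟩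
    refine ⟨v + v', ?_⟩
    rw [Submodule.Quotient.mk_add, hv, hv', ← Submodule.Quotient.mk_add, ← Finset.sum_add_distrib]
    exact congrArg _ (Finset.sum_congr rfl fun c _ => (TensorProduct.tmul_add _ _ _).symm)
  have hzero : ∃ v : KeyClass n m → Specht k t,
      (Submodule.Quotient.mk 0 : StandardModule k x hm t) =
        Submodule.Quotient.mk (∑ c, CellModule.basisElem x (Quotient.out c) ⊗ₜ[k] v c) :=
    ⟨0, by simp⟩
  induction z using TensorProduct.induction_on with
  | zero => exact hzero
  | add z z' hz hz' => exact hadd z z' hz hz'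
  | tmul y v =>
    refine Finsupp.induction_linear (motive := fun y : LeftCell n m →₀ k =>
      ∃ v' : KeyClass n m → Specht k t,
      (Submodule.Quotient.mk ((y : CellModule k n m x) ⊗ₜ[k] v) : StandardModule k x hm t) =
        Submodule.Quotient.mk (∑ c, CellModule.basisElem x (Quotient.out c) ⊗ₜ[k] v' c)) y ?_ ?_ ?_
    · obtain ⟨v', hv'⟩ := hzero
      refine ⟨v', hv' ▸ congrArg _ ?_⟩
      exact TensorProduct.zero_tmul (CellModule k n m x) v
    · intro y y' hy hy'
      obtain ⟨v', hv'⟩ := hadd _ _ hy hy'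
      refine ⟨v', hv' ▸ congrArg _ ?_⟩
      exact TensorProduct.add_tmul (M := CellModule k n m x) y y' v
    · intro l r
      obtain ⟨c, σ, hσ⟩ := LeftCell.exists_eq_out_comp hm l
      refine ⟨Pi.single c (MonoidAlgebra.single σ (1 : k) • r • v), ?_⟩
      rw [Finset.sum_eq_single c]
      · rw [Pi.single_eq_same]
        have h1 : ((Finsupp.single l r : LeftCell n m →₀ k) : CellModule k n m x) =
            r • CellModule.basisElem x l := by
          change _ = r • (Finsupp.single l 1 : LeftCell n m →₀ k)
          rw [Finsupp.smul_single, smul_eq_mul, mul_one]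
        rw [Submodule.Quotient.eq, h1, TensorProduct.smul_tmul]
        exact Submodule.subset_span ⟨_, l, σ, r • v, hσ, rfl⟩
      · intro c' _ hc
        rw [Pi.single_eq_of_ne hc, TensorProduct.tmul_zero]
      · exact fun h => absurd (Finset.mem_univ c) h

section StandardMap

variable {N : Type*} [AddCommGroup N] [Module k N]
  [Module (PartitionAlgebra k n x) N] [IsScalarTower k (PartitionAlgebra k n x) N]

/-- The bilinear map `(l, v) ↦ l v w`. -/
noncomputable def preStandardMap (hm : m ≤ n) (t : lam.cells ≃ Fin m) (w : N) :
    CellModule k n m x ⊗[k] Specht k t →ₗ[k] N :=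
  TensorProduct.lift (((Algebra.lsmul k k N).toLinearMap.comp (ofCell x)).compl₂
    (((LinearMap.toSpanSingleton (PartitionAlgebra k n x) N w).restrictScalars k).comp
      ((ofPermAlg k x hm).toLinearMap.comp ((Specht k t).subtype.restrictScalars k))))

theorem preStandardMap_tmul (hm : m ≤ n) (t : lam.cells ≃ Fin m) (w : N)
    (y : CellModule k n m x) (v : Specht k t) :
    preStandardMap x hm t w (y ⊗ₜ v) = ofCell x y • ofPermAlg k x hm v.1 • w := rfl

theorem preStandardMap_diag_smul
    (h : ∀ d : PartitionDiagram n, d.rank < m → ∀ v : N, diag x d • v = 0)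
    (hm : m ≤ n) (t : lam.cells ≃ Fin m) (w : N) (d : PartitionDiagram n)
    (z : CellModule k n m x ⊗[k] Specht k t) :
    preStandardMap x hm t w (diag x d • z) = diag x d • preStandardMap x hm t w z := by
  induction z using TensorProduct.induction_on with
  | zero => rw [smul_zero, map_zero, smul_zero]
  | tmul y v =>
    rw [TensorProduct.smul_tmul', preStandardMap_tmul, preStandardMap_tmul,
      ofCell_diag_smul x h]
  | add z z' hz hz' => rw [smul_add, map_add, map_add, smul_add, hz, hz']

theorem preStandardMap_balancingRelations (hm : m ≤ n) (t : lam.cells ≃ Fin m) (w : N)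
    (z : CellModule k n m x ⊗[k] Specht k t) (hz : z ∈ balancingRelations k x hm t) :
    preStandardMap x hm t w z = 0 := by
  obtain ⟨l, l', σ, v, hl, rfl⟩ := hz
  have hv : (MonoidAlgebra.single σ (1 : k) • v).1 = MonoidAlgebra.single σ 1 * v.1 := rfl
  rw [map_sub, preStandardMap_tmul, preStandardMap_tmul, ofCell_basisElem, ofCell_basisElem,
    sub_eq_zero, hl, hv, map_mul, ofPermAlg_single, mul_smul, ← mul_smul (diag x l.1), diag_mul_diag, loops_ofPerm,
    pow_zero, one_smul]

/-- The homomorphism from a standard module to a module killed by the diagrams of smaller rank,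
`l ⊗ v ↦ l v w`. -/
noncomputable def standardMap
    (h : ∀ d : PartitionDiagram n, d.rank < m → ∀ v : N, diag x d • v = 0)
    (hm : m ≤ n) (t : lam.cells ≃ Fin m) (w : N) :
    StandardModule k x hm t →ₗ[PartitionAlgebra k n x] N :=
  Submodule.liftQ _ (linearMapOfDiag (preStandardMap x hm t w)
    (preStandardMap_diag_smul x h hm t w))
    (Submodule.span_le.2 (preStandardMap_balancingRelations x hm t w))

theorem standardMap_mk (h : ∀ d : PartitionDiagram n, d.rank < m → ∀ v : N, diag x d • v = 0)
    (hm : m ≤ n) (t : lam.cells ≃ Fin m) (w : N) (z : CellModule k n m x ⊗[k] Specht k t) :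
    standardMap x h hm t w (Submodule.Quotient.mk z) = preStandardMap x hm t w z := rfl

end StandardMap

end PartitionAlgebra

/-! ### Standard filtration of a single layer -/

namespace PartitionAlgebra

universe u

variable {k : Type*} [Field k] [CharZero k] {n m : ℕ} {x : k}

/-- The map `v ↦ v w` on the Specht module is linear over the group algebra and nonzero at the Young
symmetrizer, so it is injective by simplicity. -/
theorem ofPermAlg_smul_eq_zero {N : Type*} [AddCommGroup N] [Module (PartitionAlgebra k n x) N]
    (hm : m ≤ n) {lam : YoungDiagram}
    (t : lam.cells ≃ Fin m) (w : N) (hw : ofPermAlg k x hm (youngSymmetrizer k t) • w ≠ 0)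
    (v : Specht k t) (hv : ofPermAlg k x hm v.1 • w = 0) : v = 0 := by
  let _ : Module (MonoidAlgebra k (Equiv.Perm (Fin m))) N :=
    Module.compHom N (ofPermAlg k x hm).toRingHom
  let f : Specht k t →ₗ[MonoidAlgebra k (Equiv.Perm (Fin m))] N :=
    (LinearMap.toSpanSingleton (MonoidAlgebra k (Equiv.Perm (Fin m))) N w).comp (Specht k t).subtype
  have hf : ∀ v, f v = ofPermAlg k x hm v.1 • w := fun v => rfl
  rcases YoungDiagram.eq_bot_or_eq_top_of_specht k t (LinearMap.ker f) with h | h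
  · exact (Submodule.mem_bot (R := MonoidAlgebra k (Equiv.Perm (Fin m)))).1
      (h ▸ (LinearMap.mem_ker.2 ((hf v).trans hv)))
  · refine absurd ?_ hw
    obtain ⟨y, hy⟩ : ∃ y : Specht k t, y.1 = youngSymmetrizer k t :=
      ⟨⟨_, Submodule.mem_span_singleton_self _⟩, rfl⟩
    have h4 : y ∈ LinearMap.ker f := by rw [h]; exact Submodule.mem_top
    rw [LinearMap.mem_ker, hf, hy] at h4
    exact h4

/-- A finite-dimensional module has a standard filtration if it is killed by the diagrams of rank
less than `m`, generated by the image of `proj n m`, and free over the orbits of the left cell. -/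
theorem hasStandardFiltration_of_layer (hx : x ≠ 0) (hm : m ≤ n) (N : Type u)
    [AddCommGroup N] [Module k N] [Module (PartitionAlgebra k n x) N]
    [IsScalarTower k (PartitionAlgebra k n x) N] [FiniteDimensional k N]
    (h1 : ∀ d : PartitionDiagram n, d.rank < m → ∀ v : N, diag x d • v = 0)
    (h2 : Submodule.span (PartitionAlgebra k n x)
      (Set.range fun v : N => diag x (proj n m) • v) = ⊤)
    (h3 : ∀ w : KeyClass n m → N, ∑ c, diag x (Quotient.out c).1 • w c = 0 →
      ∀ c, diag x (proj n m) • w c = 0) : HasStandardFiltration k n x N := by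
  -- A standard submodule is split off; the three hypotheses are inherited by the quotient, whose
  -- dimension is smaller.
  induction hr : Module.finrank k N using Nat.strong_induction_on generalizing N with
  | _ r ih =>
  by_cases hN : Subsingleton N
  · exact HasStandardFiltration.of_subsingleton
  obtain ⟨u, hu⟩ : ∃ u : N, diag x (proj n m) • u ≠ 0 := by
    by_contra hcon
    push Not at hcon
    refine hN ((Submodule.subsingleton_iff (PartitionAlgebra k n x)).1
      (subsingleton_of_bot_eq_top ?_))
    rw [← h2, eq_comm, Submodule.span_eq_bot]
    rintro _ ⟨v, rfl⟩
    exact hcon v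
  let _ : Module (MonoidAlgebra k (Equiv.Perm (Fin m))) N :=
    Module.compHom N (ofPermAlg k x hm).toRingHom
  obtain ⟨lam, t, g, hg⟩ := YoungDiagram.exists_youngSymmetrizer_smul_ne_zero k (m := m) hu
  set w : N := ofPermAlg k x hm g • diag x (proj n m) • u with hw
  replace hg : ofPermAlg k x hm (youngSymmetrizer k t) • w ≠ 0 := hg
  set κ := x ^ loops (proj n m) (proj n m) with hκ
  have hκ0 : κ ≠ 0 := pow_ne_zero _ hx
  -- `S_m` commutes with `proj n m`, so all translates of `w` stay in the image of `proj n m`, on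
  -- which it acts by the scalar `κ`.
  have hproj : ∀ v : MonoidAlgebra k (Equiv.Perm (Fin m)),
      diag x (proj n m) • ofPermAlg k x hm v • w = κ • ofPermAlg k x hm v • w := by
    intro v
    rw [hw, ← mul_smul (ofPermAlg k x hm v), ← map_mul, ← mul_smul (diag x (proj n m)),
      diag_proj_mul_ofPermAlg, mul_smul _ (diag x (proj n m)), ← mul_smul (diag x (proj n m)),
      diag_proj_mul_self, smul_assoc]
    exact smul_algebra_smul_comm κ _ _
  set Ψ := standardMap x h1 hm t w with hΨ
  have hΨsum : ∀ v : KeyClass n m → Specht k t,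
      Ψ (Submodule.Quotient.mk (∑ c, CellModule.basisElem x (Quotient.out c) ⊗ₜ[k] v c)) =
        ∑ c, diag x (Quotient.out c).1 • ofPermAlg k x hm (v c).1 • w := by
    intro v
    rw [hΨ, standardMap_mk, map_sum]
    exact Finset.sum_congr rfl fun c _ => by rw [preStandardMap_tmul, ofCell_basisElem]
  -- By `h3` a relation among the representatives gives `κ • v_c w = 0` for each `c`, and then `v_c
  -- = 0` by simplicity.
  have hinj : Function.Injective Ψ := by
    rw [injective_iff_map_eq_zero]
    intro z hz
    obtain ⟨v, rfl⟩ := exists_eq_sum_out x hm t z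
    rw [hΨsum] at hz
    have hv : v = 0 := by
      funext c
      have h4 := h3 _ hz c
      rw [hproj] at h4
      exact ofPermAlg_smul_eq_zero hm t w hg (v c) ((smul_eq_zero.1 h4).resolve_left hκ0)
    rw [hv]
    simp
  have hmem : ∀ v : Specht k t, diag x (proj n m) • ofPermAlg k x hm v.1 • w ∈
      LinearMap.range Ψ := by
    intro v
    refine ⟨Submodule.Quotient.mk (CellModule.basisElem x (LeftCell.projElem hm) ⊗ₜ[k] v), ?_⟩
    rw [hΨ, standardMap_mk, preStandardMap_tmul, ofCell_basisElem]
    rfl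
  refine HasStandardFiltration.of_exact (LinearMap.range Ψ).subtype (LinearMap.range Ψ).mkQ
    (Submodule.subtype_injective _) (Submodule.mkQ_surjective _) (by simp)
    ((HasStandardFiltration.standardModule hm t).of_equiv (LinearEquiv.ofInjective Ψ hinj)) ?_
  refine ih (Module.finrank k (N ⧸ LinearMap.range Ψ)) ?_ (N ⧸ LinearMap.range Ψ) ?_ ?_ ?_ rfl
  · have h4 := LinearMap.finrank_range_add_finrank_ker ((LinearMap.range Ψ).mkQ.restrictScalars k)
    have h6 : LinearMap.range ((LinearMap.range Ψ).mkQ.restrictScalars k) = ⊤ :=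
      LinearMap.range_eq_top.2 (Submodule.mkQ_surjective (LinearMap.range Ψ))
    rw [h6, finrank_top, hr] at h4
    -- The dimension drops because the range of `Ψ` contains `κ` times the image of `w` under the
    -- Young symmetrizer.
    have h5 : 0 < Module.finrank k (LinearMap.ker ((LinearMap.range Ψ).mkQ.restrictScalars k)) := by
      rw [Module.finrank_pos_iff_exists_ne_zero]
      refine ⟨⟨diag x (proj n m) • ofPermAlg k x hm (youngSymmetrizer k t) • w, ?_⟩, ?_⟩
      · exact (Submodule.Quotient.mk_eq_zero _).2
          (hmem ⟨youngSymmetrizer k t, Submodule.mem_span_singleton_self _⟩)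
      · intro h6
        have h7 := congrArg Subtype.val h6
        simp only [hproj] at h7
        exact smul_ne_zero hκ0 hg h7
    omega
  · intro d hd v
    obtain ⟨v, rfl⟩ := Submodule.Quotient.mk_surjective _ v
    rw [← Submodule.Quotient.mk_smul, h1 d hd, Submodule.Quotient.mk_zero]
  · have h4 := congrArg (Submodule.map (LinearMap.range Ψ).mkQ) h2
    rw [Submodule.map_span, Submodule.map_top, Submodule.range_mkQ] at h4
    rw [← h4]
    congr 1
    ext v
    constructor
    · rintro ⟨v, rfl⟩
      obtain ⟨v, rfl⟩ := Submodule.Quotient.mk_surjective _ v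
      exact ⟨_, ⟨v, rfl⟩, rfl⟩
    · rintro ⟨_, ⟨v, rfl⟩, rfl⟩
      exact ⟨Submodule.Quotient.mk v, rfl⟩
  · intro f hf c
    -- A relation in the quotient lifts to an element `∑ r_c v_c w` of the range of `Ψ`. Applying
    -- `h3` to `f' c - v_c w` gives `d_m f' c = d_m v_c w`, which is again in the range.
    choose f' hf' using fun c => Submodule.Quotient.mk_surjective (LinearMap.range Ψ) (f c)
    have h4 : ∑ c, diag x (Quotient.out c).1 • f' c ∈ LinearMap.range Ψ := by
      rw [← Submodule.Quotient.mk_eq_zero, ← hf, ← Submodule.mkQ_apply, map_sum]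
      exact Finset.sum_congr rfl fun c _ => by rw [map_smul, Submodule.mkQ_apply, hf']
    obtain ⟨z, hz⟩ := h4
    obtain ⟨v, rfl⟩ := exists_eq_sum_out x hm t z
    rw [hΨsum] at hz
    have h5 := h3 (fun c => f' c - ofPermAlg k x hm (v c).1 • w) (by
      simp only [smul_sub]
      rw [Finset.sum_sub_distrib, hz, sub_self]) c
    rw [smul_sub, sub_eq_zero] at h5
    rw [← hf', ← Submodule.Quotient.mk_smul, Submodule.Quotient.mk_eq_zero, h5]
    exact hmem (v c)

end PartitionAlgebra

/-! ### The rank filtration -/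

namespace PartitionAlgebra

variable {k : Type*} [Field k] (n : ℕ) {m : ℕ} (x : k)

section RankPart

variable (M : Type*) [AddCommGroup M] [Module (PartitionAlgebra k n x) M]

/-- The submodule generated by the images of the diagrams `proj n i` with `i < m`. -/
noncomputable def rankPart (m : ℕ) : Submodule (PartitionAlgebra k n x) M :=
  Submodule.span _ {v | ∃ i < m, ∃ w : M, diag x (proj n i) • w = v}

/-- The property that in all layers of the rank filtration the orbits of the left cell act
freely. -/
def IsLayered : Prop :=
  ∀ m ≤ n, ∀ w : KeyClass n m → M, ∑ c, diag x (Quotient.out c).1 • w c ∈ rankPart n x M m →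
    ∀ c, diag x (proj n m) • w c ∈ rankPart n x M m

theorem rankPart_zero : rankPart n x M 0 = ⊥ := by
  rw [rankPart, Submodule.span_eq_bot]
  rintro _ ⟨i, hi, _⟩
  omega

theorem rankPart_succ_self : rankPart n x M (n + 1) = ⊤ := by
  rw [eq_top_iff]
  intro v _
  refine Submodule.subset_span ⟨n, n.lt_succ_self, v, ?_⟩
  rw [proj_self, ← one_def, one_smul]

theorem rankPart_mono {m m' : ℕ} (h : m ≤ m') : rankPart n x M m ≤ rankPart n x M m' :=
  Submodule.span_mono fun _ ⟨i, hi, hw⟩ => ⟨i, hi.trans_le h, hw⟩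

variable {n x M}

theorem proj_smul_mem_rankPart {i : ℕ} (hi : i < m) (v : M) :
    diag x (proj n i) • v ∈ rankPart n x M m :=
  Submodule.subset_span ⟨i, hi, v, rfl⟩

theorem map_mem_rankPart {M' : Type*} [AddCommGroup M'] [Module (PartitionAlgebra k n x) M']
    (f : M →ₗ[PartitionAlgebra k n x] M') {v : M} (hv : v ∈ rankPart n x M m) :
    f v ∈ rankPart n x M' m := by
  have : rankPart n x M m ≤ (rankPart n x M' m).comap f := by
    refine Submodule.span_le.2 ?_
    rintro _ ⟨i, hi, w, rfl⟩
    rw [SetLike.mem_coe, Submodule.mem_comap, map_smul]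
    exact proj_smul_mem_rankPart hi _
  exact this hv

/-- Homomorphisms respect the rank filtration: `f` carries the relation to `M'`, and `g` carries the
conclusion back. -/
theorem IsLayered.of_retract {M' : Type*} [AddCommGroup M'] [Module (PartitionAlgebra k n x) M']
    (f : M →ₗ[PartitionAlgebra k n x] M') (g : M' →ₗ[PartitionAlgebra k n x] M)
    (hgf : ∀ v, g (f v) = v) (h : IsLayered n x M') : IsLayered n x M := by
  intro m hm w hw c
  have h1 := h m hm (fun c => f (w c)) (by
    have := map_mem_rankPart f hw
    rw [map_sum] at this
    simpa only [map_smul] using this) c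
  have h2 := map_mem_rankPart g h1
  rwa [map_smul, hgf] at h2

variable [Module k M] [IsScalarTower k (PartitionAlgebra k n x) M]

/-- The diagram `d` factors through `proj n d.rank` up to a power of `x`, which can be divided out
since `x ≠ 0`. -/
theorem diag_smul_mem_rankPart (hx : x ≠ 0) {d : PartitionDiagram n} (hd : d.rank < m) (v : M) :
    diag x d • v ∈ rankPart n x M m := by
  obtain ⟨d₁, d₂, h⟩ := exists_factor d
  have h1 : diag x d₁ * (diag x (proj n d.rank) * diag x d₂) =
      (x ^ loops (proj n d.rank) d₂ * x ^ loops d₁ (comp (proj n d.rank) d₂)) • diag x d := by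
    rw [diag_mul_diag, mul_smul_comm, diag_mul_diag, h, smul_smul]
  have h2 : x ^ loops (proj n d.rank) d₂ * x ^ loops d₁ (comp (proj n d.rank) d₂) ≠ 0 :=
    mul_ne_zero (pow_ne_zero _ hx) (pow_ne_zero _ hx)
  have h3 : diag x d₁ • diag x (proj n d.rank) • diag x d₂ • v ∈ rankPart n x M m :=
    Submodule.smul_mem _ _ (proj_smul_mem_rankPart hd _)
  rw [← mul_smul, ← mul_smul, mul_assoc, h1, smul_assoc] at h3
  have h4 := (rankPart n x M m).smul_of_tower_mem
    (x ^ loops (proj n d.rank) d₂ * x ^ loops d₁ (comp (proj n d.rank) d₂))⁻¹ h3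
  rwa [inv_smul_smul₀ h2] at h4

theorem IsLayered.hasStandardFiltration_layer [CharZero k] (hx : x ≠ 0) (hm : m ≤ n)
    (h : IsLayered n x M) {N : Type*} [AddCommGroup N] [Module k N]
    [Module (PartitionAlgebra k n x) N] [IsScalarTower k (PartitionAlgebra k n x) N]
    [FiniteDimensional k N] (π : rankPart n x M (m + 1) →ₗ[PartitionAlgebra k n x] N)
    (hπ : Function.Surjective π) (hker : ∀ v, π v = 0 ↔ v.1 ∈ rankPart n x M m) :
    HasStandardFiltration k n x N := by
  refine hasStandardFiltration_of_layer hx hm _ ?_ ?_ ?_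
  · intro d hd v
    obtain ⟨v, rfl⟩ := hπ v
    rw [← map_smul, hker]
    exact diag_smul_mem_rankPart hx hd v.1
  · set S := Submodule.span (PartitionAlgebra k n x)
      (Set.range fun v : N => diag x (proj n m) • v) with hS
    have hsub : rankPart n x M (m + 1) ≤ (S.comap π).map (rankPart n x M (m + 1)).subtype := by
      refine Submodule.span_le.2 ?_
      rintro _ ⟨i, hi, w, rfl⟩
      refine ⟨⟨_, proj_smul_mem_rankPart hi w⟩, ?_, rfl⟩
      rw [SetLike.mem_coe, Submodule.mem_comap]
      rcases Nat.lt_succ_iff_lt_or_eq.1 hi with hi' | rfl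
      · rw [(hker _).2]
        · exact S.zero_mem
        · exact proj_smul_mem_rankPart hi' w
      -- The vector `w` need not lie in `rankPart`, so `proj n i` cannot be pulled through `π`
      -- directly. Idempotency up to a scalar exhibits `v` as a multiple of `proj n i • v`.
      · have h1 : x ^ loops (proj n i) (proj n i) ≠ 0 := pow_ne_zero _ hx
        generalize hv : (⟨_, proj_smul_mem_rankPart hi w⟩ : rankPart n x M (i + 1)) = v
        have h2 : x ^ loops (proj n i) (proj n i) • v = diag x (proj n i) • v := by
          rw [← hv]
          refine Subtype.ext ?_
          change x ^ loops (proj n i) (proj n i) • diag x (proj n i) • w =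
            diag x (proj n i) • diag x (proj n i) • w
          rw [← mul_smul (diag x (proj n i)), diag_proj_mul_self, smul_assoc]
        have h3 : π v = (x ^ loops (proj n i) (proj n i))⁻¹ • diag x (proj n i) • π v := by
          rw [eq_inv_smul_iff₀ h1, ← π.map_smul (diag x (proj n i)), ← h2]
          exact ((π.restrictScalars k).map_smul _ v).symm
        rw [h3]
        exact S.smul_of_tower_mem _ (Submodule.subset_span ⟨_, rfl⟩)
    rw [eq_top_iff]
    intro v _
    obtain ⟨v, rfl⟩ := hπ v
    obtain ⟨v', hv', hvv⟩ := hsub v.2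
    rw [Submodule.subtype_apply] at hvv
    rw [← Subtype.ext hvv]
    exact hv'
  · intro w hw c
    choose w' hw' using fun c => hπ (w c)
    rw [← hw', ← map_smul, hker]
    refine h m hm (fun c => (w' c).1) ?_ c
    have h1 : π (∑ c, diag x (Quotient.out c).1 • w' c) = 0 := by
      rw [← hw, map_sum]
      exact Finset.sum_congr rfl fun c _ => by rw [map_smul, hw']
    rw [hker, ← Submodule.subtype_apply, map_sum] at h1
    exact h1

theorem IsLayered.hasStandardFiltration_quotient [CharZero k] [FiniteDimensional k M] (hx : x ≠ 0)
    (hm : m ≤ n) (h : IsLayered n x M)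
    (P : Submodule (PartitionAlgebra k n x) (rankPart n x M (m + 1)))
    (hP : ∀ v, v ∈ P ↔ v.1 ∈ rankPart n x M m) :
    HasStandardFiltration k n x (rankPart n x M (m + 1) ⧸ P) := by
  have hfin : FiniteDimensional k (rankPart n x M (m + 1)) :=
    inferInstanceAs (FiniteDimensional k ((rankPart n x M (m + 1)).restrictScalars k))
  have hfin' : FiniteDimensional k (rankPart n x M (m + 1) ⧸ P) :=
    Module.Finite.of_surjective (P.mkQ.restrictScalars k) P.mkQ_surjective
  refine h.hasStandardFiltration_layer hx hm P.mkQ P.mkQ_surjective fun v => ?_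
  rw [Submodule.mkQ_apply, Submodule.Quotient.mk_eq_zero, hP]

theorem IsLayered.hasStandardFiltration [CharZero k] [FiniteDimensional k M] (hx : x ≠ 0)
    (h : IsLayered n x M) : HasStandardFiltration k n x M := by
  have key : ∀ m ≤ n + 1, HasStandardFiltration k n x (rankPart n x M m) := by
    intro m
    induction m with
    | zero =>
      intro _
      rw [rankPart_zero]
      exact HasStandardFiltration.of_subsingleton
    | succ m ih =>
      intro hm
      refine HasStandardFiltration.of_submodule
        ((rankPart n x M m).submoduleOf (rankPart n x M (m + 1)))
        ((ih (by omega)).of_equiv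
          (Submodule.submoduleOfEquivOfLe (rankPart_mono n x M m.le_succ)).symm) ?_
      exact h.hasStandardFiltration_quotient hx (by omega) _ fun v => Iff.rfl
  have h1 := key (n + 1) le_rfl
  rw [rankPart_succ_self] at h1
  exact h1.of_equiv Submodule.topEquiv

end RankPart

/-! ### Monomial bases -/

section Monomial

variable {n x} {M Q : Type*} [AddCommGroup M] [Module k M] [Module (PartitionAlgebra k n x) M]

/-- A basis indexed by pairs of diagrams on which diagrams act by concatenation, up to nonzero
scalars, the result being zero if the concatenation is not in the index set. -/
structure IsMonomial (x : k) [Module (PartitionAlgebra k n x) M] (B : Module.Basis Q k M)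
    (pr : Q → PartitionDiagram n × PartitionDiagram n) : Prop where
  injective : Function.Injective pr
  smul_eq : ∀ d q q', pr q' = compPair d (pr q) → ∃ c : k, c ≠ 0 ∧ diag x d • B q = c • B q'
  smul_eq_zero : ∀ d q, (∀ q', pr q' ≠ compPair d (pr q)) → diag x d • B q = 0

variable {B : Module.Basis Q k M} {pr : Q → PartitionDiagram n × PartitionDiagram n}

theorem IsMonomial.diag_smul_mem (h : IsMonomial x B pr) (d : PartitionDiagram n) (q : Q)
    {s : Set Q} (hs : ∀ q', pr q' = compPair d (pr q) → q' ∈ s) :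
    diag x d • B q ∈ Submodule.span k (B '' s) := by
  by_cases hq : ∃ q', pr q' = compPair d (pr q)
  · obtain ⟨q', hq'⟩ := hq
    obtain ⟨c, -, hc⟩ := h.smul_eq d q q' hq'
    rw [hc]
    exact Submodule.smul_mem _ _ (Submodule.subset_span ⟨q', hs q' hq', rfl⟩)
  · push Not at hq
    rw [h.smul_eq_zero d q hq]
    exact Submodule.zero_mem _

variable [IsScalarTower k (PartitionAlgebra k n x) M]

/-- Extension of a property of the action of a diagram from a spanning set to its span. -/
theorem diag_smul_mem_span {s : Set Q} {S : Submodule k M} (d : PartitionDiagram n)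
    (h : ∀ q ∈ s, diag x d • B q ∈ S) {v : M} (hv : v ∈ Submodule.span k (B '' s)) :
    diag x d • v ∈ S := by
  have : Submodule.span k (B '' s) ≤ S.comap (Algebra.lsmul k k M (diag x d)) := by
    refine Submodule.span_le.2 ?_
    rintro _ ⟨q, hq, rfl⟩
    exact h q hq
  exact this hv

theorem smul_mem_of_diag_smul_mem {S : Submodule k M} {v : M} (h : ∀ d : PartitionDiagram n, diag x d • v ∈ S)
    (p : PartitionAlgebra k n x) : p • v ∈ S := by
  have : S.mkQ.comp ((LinearMap.toSpanSingleton (PartitionAlgebra k n x) M v).restrictScalars k) =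
      0 := linear_ext fun d => (Submodule.Quotient.mk_eq_zero S).2 (h d)
  exact (Submodule.Quotient.mk_eq_zero S).1 (LinearMap.congr_fun this p)

/-- A pair in the image of `proj n i` has at most `i` live parts, and concatenation never increases
their number. Conversely `liveDiagram` fixes its pair up to a nonzero scalar, and its rank is the
live rank. -/
theorem IsMonomial.mem_rankPart_iff (h : IsMonomial x B pr) (hx : x ≠ 0) (hm : m ≤ n) (v : M) :
    v ∈ rankPart n x M m ↔ v ∈ Submodule.span k (B '' {q | liveRank (pr q) < m}) := by
  constructor
  · intro hv
    refine Submodule.span_induction ?_ ?_ ?_ ?_ hv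
    · rintro _ ⟨i, hi, w, rfl⟩
      refine diag_smul_mem_span (B := B) (s := Set.univ) _ (fun q _ => ?_)
        (by rw [Set.image_univ, B.span_eq]; trivial)
      refine h.diag_smul_mem _ q fun q' hq' => ?_
      rw [Set.mem_ofPred_eq, hq']
      exact (liveRank_compPair_le_rank _ _).trans_lt (by rwa [rank_proj (hi.le.trans hm)])
    · exact Submodule.zero_mem _
    · exact fun _ _ _ _ => Submodule.add_mem _
    · intro p v _ hv
      refine smul_mem_of_diag_smul_mem (fun d => ?_) p
      refine diag_smul_mem_span _ (fun q hq => ?_) hv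
      refine h.diag_smul_mem _ q fun q' hq' => ?_
      rw [Set.mem_ofPred_eq, hq']
      exact (liveRank_compPair_le _ _).trans_lt hq
  · intro hv
    have : Submodule.span k (B '' {q | liveRank (pr q) < m}) ≤
        (rankPart n x M m).restrictScalars k := by
      refine Submodule.span_le.2 ?_
      rintro _ ⟨q, hq, rfl⟩
      obtain ⟨c, hc0, hc⟩ := h.smul_eq (liveDiagram (pr q)) q q (compPair_liveDiagram _).symm
      have h1 := diag_smul_mem_rankPart hx (m := m) (d := liveDiagram (pr q)) hq (B q)
      rw [hc] at h1
      have h2 := (rankPart n x M m).smul_of_tower_mem c⁻¹ h1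
      rwa [inv_smul_smul₀ hc0] at h2
    exact this hv

/-- For a pair fixed by `proj n m` with `m` live parts, concatenation with an element of the left
cell gives a pair with `m` live parts. -/
theorem IsMonomial.exists_image (h : IsMonomial x B pr) (hx : x ≠ 0) (r : LeftCell n m) {q : Q}
    (hq : compPair (proj n m) (pr q) = pr q) (hl : liveRank (pr q) = m) :
    ∃ q₀, pr q₀ = compPair r.1 (pr q) ∧ liveRank (pr q₀) = m := by
  -- The reflection of `r` undoes `r` on pairs fixed by `proj n m`. Thus `r` can neither send `q` to
  -- zero nor lower its live rank.
  have hinv : compPair (r.1.comap Sum.swap) (compPair r.1 (pr q)) = pr q := by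
    rw [compPair_compPair, LeftCell.comap_swap_comp, hq]
  obtain ⟨q₀, hq₀⟩ : ∃ q₀, pr q₀ = compPair r.1 (pr q) := by
    by_contra hcon
    push Not at hcon
    have h1 := h.smul_eq_zero _ _ hcon
    obtain ⟨c, hc0, hc⟩ := h.smul_eq (proj n m) q q hq.symm
    have h2 : diag x (r.1.comap Sum.swap) • diag x r.1 • B q =
        x ^ loops (r.1.comap Sum.swap) r.1 • c • B q := by
      rw [← mul_smul, diag_mul_diag, LeftCell.comap_swap_comp, smul_assoc, hc]
    rw [h1, smul_zero] at h2
    exact smul_ne_zero (pow_ne_zero _ hx) (smul_ne_zero hc0 (B.ne_zero q)) h2.symm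
  refine ⟨q₀, hq₀, le_antisymm ?_ ?_⟩
  · rw [hq₀]
    exact (liveRank_compPair_le_rank _ _).trans r.2.1.le
  · rw [← hl, hq₀]
    conv_lhs => rw [← hinv]
    exact liveRank_compPair_le _ _

/-- A basis pair with `m` live parts occurring in `∑ r_c w_c` comes from only one orbit `c` and one
pair `q`, so its coefficient cannot cancel. -/
theorem IsMonomial.isLayered [Finite Q] (h : IsMonomial x B pr) (hx : x ≠ 0) :
    IsLayered n x M := by
  classical
  have := Fintype.ofFinite Q
  intro m hm w hw c₀
  rw [h.mem_rankPart_iff hx hm] at hw ⊢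
  -- With this scalar, replacing `w c` by `a c • proj n m • w c` leaves the sum unchanged, since
  -- `r_c` absorbs `proj n m` up to a power of `x`. The new vectors are supported on pairs fixed by
  -- `proj n m`.
  let a : KeyClass n m → k := fun c => (x ^ loops c.out.1 (proj n m))⁻¹
  have ha : ∀ c, a c ≠ 0 := fun c => inv_ne_zero (pow_ne_zero _ hx)
  have hsum : ∑ c, diag x (Quotient.out c).1 • w c =
      ∑ c, diag x (Quotient.out c).1 • a c • diag x (proj n m) • w c := by
    refine Finset.sum_congr rfl fun c _ => ?_
    rw [smul_algebra_smul_comm (a c), ← mul_smul (diag x _), diag_mul_diag, LeftCell.comp_proj,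
      smul_assoc, inv_smul_smul₀ (pow_ne_zero _ hx)]
  set u : KeyClass n m → M := fun c => a c • diag x (proj n m) • w c with hu
  have hfix : ∀ c, u c ∈ Submodule.span k (B '' {q | compPair (proj n m) (pr q) = pr q}) := by
    intro c
    refine Submodule.smul_mem _ _ (diag_smul_mem_span (B := B) (s := Set.univ) _ (fun q _ => ?_)
        (by rw [Set.image_univ, B.span_eq]; trivial))
    refine h.diag_smul_mem _ q fun q' hq' => ?_
    rw [Set.mem_ofPred_eq, hq', compPair_compPair, proj_comp_proj]
  suffices hs : u c₀ ∈ Submodule.span k (B '' {q | liveRank (pr q) < m}) by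
    have h1 := Submodule.smul_mem _ (a c₀)⁻¹ hs
    rwa [hu, inv_smul_smul₀ (ha c₀)] at h1
  rw [B.mem_span_image]
  intro q hq
  have hfq : compPair (proj n m) (pr q) = pr q := B.mem_span_image.1 (hfix c₀) hq
  rw [Set.mem_ofPred_eq]
  by_contra hlt
  -- Being fixed by `proj n m`, the pair has at most `m` live parts.
  have hl : liveRank (pr q) = m := by
    refine le_antisymm ?_ (not_lt.1 hlt)
    rw [← hfq]
    exact (liveRank_compPair_le_rank _ _).trans (rank_proj hm).le
  obtain ⟨q₀, hq₀, hl₀⟩ := h.exists_image hx (Quotient.out c₀) hfq hl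
  have hcoef : ∀ c, B.repr (diag x (Quotient.out c).1 • u c) q₀ =
      ∑ q', B.repr (u c) q' * B.repr (diag x (Quotient.out c).1 • B q') q₀ := by
    intro c
    conv_lhs => rw [← B.sum_repr (u c)]
    rw [Finset.smul_sum, map_sum, Finsupp.finsetSum_apply]
    refine Finset.sum_congr rfl fun q' _ => ?_
    rw [smul_algebra_smul_comm (B.repr (u c) q'), map_smul, Finsupp.smul_apply, smul_eq_mul]
  -- The pair of `q₀` determines the class `c` through the key, and applying the reflection of the
  -- representative then recovers `q'`.
  have huniq : ∀ c q', B.repr (u c) q' * B.repr (diag x (Quotient.out c).1 • B q') q₀ ≠ 0 →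
      c = c₀ ∧ q' = q := by
    intro c q' hne
    have h1 := left_ne_zero_of_mul hne
    have h2 := right_ne_zero_of_mul hne
    have hfq' : compPair (proj n m) (pr q') = pr q' :=
      B.mem_span_image.1 (hfix c) (Finsupp.mem_support_iff.2 h1)
    have h3 : pr q₀ = compPair (Quotient.out c).1 (pr q') := by
      by_cases hex : ∃ q₁, pr q₁ = compPair (Quotient.out c).1 (pr q')
      · obtain ⟨q₁, hq₁⟩ := hex
        obtain ⟨s, -, hs⟩ := h.smul_eq _ _ _ hq₁
        rw [hs, map_smul, B.repr_self, Finsupp.smul_apply, Finsupp.single_apply] at h2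
        by_cases h4 : q₁ = q₀
        · rw [← h4, hq₁]
        · rw [if_neg h4, smul_zero] at h2
          exact absurd rfl h2
      · push Not at hex
        rw [h.smul_eq_zero _ _ hex, map_zero] at h2
        exact absurd rfl h2
    have h4 : c = c₀ := by
      have e1 := key_eq_of_liveRank (Quotient.out c) (pr q') (by rw [← h3, hl₀])
      have e2 := key_eq_of_liveRank (Quotient.out c₀) (pr q) (by rw [← hq₀, hl₀])
      rw [← h3] at e1
      rw [← hq₀] at e2
      rw [← Quotient.out_eq c, ← Quotient.out_eq c₀]
      exact Quotient.sound (e1.trans e2.symm)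
    refine ⟨h4, h.injective ?_⟩
    subst h4
    have h5 : ∀ q'', compPair (proj n m) q'' =
        compPair ((Quotient.out c).1.comap Sum.swap) (compPair (Quotient.out c).1 q'') := by
      intro q''
      rw [compPair_compPair, LeftCell.comap_swap_comp]
    rw [← hfq', h5, ← h3, hq₀, ← h5, hfq]
  obtain ⟨s, hs0, hs⟩ := h.smul_eq _ _ _ hq₀
  -- Only one term contributes, so the coefficient is nonzero, although `q₀` has `m` live parts and
  -- the sum is supported on pairs with fewer.
  have hval : B.repr (∑ c, diag x (Quotient.out c).1 • u c) q₀ = B.repr (u c₀) q * s := by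
    rw [map_sum, Finsupp.finsetSum_apply, Finset.sum_eq_single c₀, hcoef, Finset.sum_eq_single q]
    · rw [hs, map_smul B.repr s, B.repr_self, Finsupp.smul_apply, Finsupp.single_eq_same, smul_eq_mul,
        mul_one]
    · intro q' _ hne
      by_contra hn
      exact hne (huniq c₀ q' hn).2
    · exact fun hn => absurd (Finset.mem_univ _) hn
    · intro c _ hne
      rw [hcoef]
      refine Finset.sum_eq_zero fun q' _ => ?_
      by_contra hn
      exact hne (huniq c q' hn).1
    · exact fun hn => absurd (Finset.mem_univ _) hn
  rw [hsum, B.mem_span_image] at hw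
  have h1 : q₀ ∈ (B.repr (∑ c, diag x (Quotient.out c).1 • u c)).support := by
    rw [Finsupp.mem_support_iff, hval]
    exact mul_ne_zero (Finsupp.mem_support_iff.1 hq) hs0
  exact absurd (hw h1) (by rw [Set.mem_ofPred_eq, hl₀]; exact lt_irrefl m)

end Monomial

end PartitionAlgebra

/-! ### Standard modules as direct summands of cell modules -/

namespace PartitionDiagram

variable {n i : ℕ}

theorem rank_comp_ofPerm_le (d : PartitionDiagram n) (τ : Equiv.Perm (Fin n)) :
    (comp d (ofPerm τ)).rank ≤ d.rank := by
  rw [comp_ofPerm, rank, rank]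
  refine Nat.card_le_card_of_injective (fun c => ⟨Quotient.map' (s₂ := d) (Sum.map id τ)
    (fun u v (h : d.comap (Sum.map id τ) u v) => h) c.1, ?_, ?_⟩) ?_
  · obtain ⟨_, ⟨a, rfl⟩, b, hb⟩ := c
    exact ⟨a, rfl⟩
  · obtain ⟨_, ha, b, rfl⟩ := c
    exact ⟨τ b, rfl⟩
  · rintro ⟨⟨u⟩, hu⟩ ⟨⟨v⟩, hv⟩ h
    refine Subtype.ext (Quotient.sound ?_)
    exact Quotient.exact (s := d) (congrArg Subtype.val h)

theorem comp_ofPerm_ofPerm_inv (d : PartitionDiagram n) (τ : Equiv.Perm (Fin n)) :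
    comp (comp d (ofPerm τ)) (ofPerm τ⁻¹) = d := by
  rw [(comp_loops_assoc _ _ _).1, ofPerm_mul, mul_inv_cancel]
  exact (comp_id_loops d).1

theorem rank_comp_ofPerm (d : PartitionDiagram n) (τ : Equiv.Perm (Fin n)) :
    (comp d (ofPerm τ)).rank = d.rank := by
  refine le_antisymm (rank_comp_ofPerm_le d τ) ?_
  conv_lhs => rw [← comp_ofPerm_ofPerm_inv d τ]
  exact rank_comp_ofPerm_le _ _

/-- The right action of a permutation on a left cell. -/
def LeftCell.mulPerm (hi : i ≤ n) (l : LeftCell n i) (σ : Equiv.Perm (Fin i)) : LeftCell n i :=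
  ⟨comp l.1 (ofPerm (σ.viaFintypeEmbedding (Fin.castLEEmb hi))),
    (rank_comp_ofPerm _ _).trans l.2.1, by
      obtain ⟨d, hd⟩ := l.2.2
      refine ⟨comp d (ofPerm (σ.viaFintypeEmbedding (Fin.castLEEmb hi))), ?_⟩
      rw [← hd, (comp_loops_assoc _ _ _).1, (comp_loops_assoc _ _ _).1, proj_comp_ofPerm]⟩

end PartitionDiagram

namespace PartitionAlgebra

variable {k : Type*} [Field k] {n i : ℕ} (x : k)

open Classical in
/-- The projection of the partition algebra to the cell module. -/
noncomputable def toCell : PartitionAlgebra k n x →ₗ[k] CellModule k n i x :=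
  linearLift fun d => if h : d.rank = i ∧ ∃ d', comp d' (proj n i) = d then
    CellModule.basisElem x ⟨d, h⟩ else 0

theorem toCell_diag (l : LeftCell n i) : toCell x (diag x l.1) = CellModule.basisElem x l := by
  rw [toCell, linearLift_diag, dif_pos l.2]

theorem diag_smul_basisElem (d : PartitionDiagram n) (l : LeftCell n i) :
    diag x d • CellModule.basisElem x l = CellModule.actBasis x d l := by
  rw [CellModule.smul_def, CellModule.rep, lift_diag, CellModule.act_basisElem]

theorem diag_smul_basisElem_of_rank_eq {d : PartitionDiagram n} {l l' : LeftCell n i}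
    (h : l'.1 = comp d l.1) :
    diag x d • CellModule.basisElem x l = x ^ loops d l.1 • CellModule.basisElem x l' := by
  have hr : (comp d l.1).rank = i := h ▸ l'.2.1
  rw [diag_smul_basisElem, CellModule.actBasis, dif_pos hr]
  exact congrArg _ (congrArg _ (Subtype.ext h.symm))

theorem diag_smul_basisElem_of_rank_ne {d : PartitionDiagram n} {l : LeftCell n i}
    (h : ∀ l' : LeftCell n i, l'.1 ≠ comp d l.1) :
    diag x d • CellModule.basisElem x l = 0 := by
  rw [diag_smul_basisElem, CellModule.actBasis, dif_neg]
  exact fun hr => h ⟨_, comp_mem_leftCell d l hr⟩ rfl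

/-- The right action of the group algebra of `S_i` on the cell module. -/
noncomputable def cellMul (hi : i ≤ n) : CellModule k n i x →ₗ[k]
    MonoidAlgebra k (Equiv.Perm (Fin i)) →ₗ[k] CellModule k n i x :=
  (((LinearMap.mul k (PartitionAlgebra k n x)).comp (ofCell x)).compl₂
    (ofPermAlg k x hi).toLinearMap).compr₂ (toCell x)

theorem cellMul_apply (hi : i ≤ n) (y : CellModule k n i x)
    (u : MonoidAlgebra k (Equiv.Perm (Fin i))) :
    cellMul x hi y u = toCell x (ofCell x y * ofPermAlg k x hi u) := rfl

theorem diag_mul_ofPermAlg_single (hi : i ≤ n) (l : LeftCell n i) (σ : Equiv.Perm (Fin i)) :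
    diag x l.1 * ofPermAlg k x hi (MonoidAlgebra.single σ 1) = diag x (l.mulPerm hi σ).1 := by
  rw [ofPermAlg_single, diag_mul_diag, loops_ofPerm, pow_zero, one_smul]
  rfl

theorem cellMul_basisElem_single (hi : i ≤ n) (l : LeftCell n i) (σ : Equiv.Perm (Fin i)) :
    cellMul x hi (CellModule.basisElem x l) (MonoidAlgebra.single σ 1) =
      CellModule.basisElem x (l.mulPerm hi σ) := by
  rw [cellMul_apply, ofCell_basisElem, diag_mul_ofPermAlg_single, toCell_diag]

theorem cellMul_mulPerm (hi : i ≤ n) (l : LeftCell n i) (σ : Equiv.Perm (Fin i))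
    (u : MonoidAlgebra k (Equiv.Perm (Fin i))) :
    cellMul x hi (CellModule.basisElem x (l.mulPerm hi σ)) u =
      cellMul x hi (CellModule.basisElem x l) (MonoidAlgebra.single σ 1 * u) := by
  rw [cellMul_apply, cellMul_apply, ofCell_basisElem, ofCell_basisElem,
    map_mul (ofPermAlg k x hi), ← mul_assoc, diag_mul_ofPermAlg_single]

/-- Concatenation with a permutation diagram removes no parts and preserves the rank, so the right
action respects both the scalars and the vanishing rule. -/
theorem cellMul_diag_smul (hi : i ≤ n) (d : PartitionDiagram n) (y : CellModule k n i x)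
    (u : MonoidAlgebra k (Equiv.Perm (Fin i))) :
    cellMul x hi (diag x d • y) u = diag x d • cellMul x hi y u := by
  induction u using MonoidAlgebra.induction_on with
  | add u v hu hv => rw [map_add, map_add, smul_add, hu, hv]
  | smul r u hu =>
    rw [map_smul (cellMul x hi _) r u, map_smul (cellMul x hi _) r u, hu, smul_algebra_smul_comm]
  | of σ =>
    rw [MonoidAlgebra.of_apply]
    refine LinearMap.congr_fun
      (f := ((cellMul x hi).flip (MonoidAlgebra.single σ 1)).comp
        (CellModule.rep k n i x (diag x d)))
      (g := (CellModule.rep k n i x (diag x d)).comp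
        ((cellMul x hi).flip (MonoidAlgebra.single σ 1)))
      (CellModule.linear_ext fun l => ?_) y
    rw [LinearMap.comp_apply, LinearMap.comp_apply, LinearMap.flip_apply, LinearMap.flip_apply,
      ← CellModule.smul_def, ← CellModule.smul_def, cellMul_basisElem_single]
    obtain ⟨hc, hl⟩ := comp_loops_assoc d l.1
      (ofPerm (σ.viaFintypeEmbedding (Fin.castLEEmb hi)))
    rw [loops_ofPerm, loops_ofPerm, add_zero, zero_add] at hl
    by_cases h : ∃ l' : LeftCell n i, l'.1 = comp d l.1
    · obtain ⟨l', h'⟩ := h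
      rw [diag_smul_basisElem_of_rank_eq x h', diag_smul_basisElem_of_rank_eq (l' := l'.mulPerm hi σ) x,
        map_smul, LinearMap.smul_apply, cellMul_basisElem_single, hl]
      · rfl
      · refine Eq.trans ?_ hc
        rw [← h']
        rfl
    · push Not at h
      rw [diag_smul_basisElem_of_rank_ne x h, diag_smul_basisElem_of_rank_ne, map_zero,
        LinearMap.zero_apply]
      intro l' hl'
      refine h ⟨_, comp_mem_leftCell d l ?_⟩ rfl
      rw [← rank_comp_ofPerm _ (σ.viaFintypeEmbedding (Fin.castLEEmb hi)), hc]
      exact hl' ▸ l'.2.1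

variable {lam : YoungDiagram}

/-- The bilinear map `l ⊗ v ↦ l v`. -/
noncomputable def preStandardToCell (hi : i ≤ n) (t : lam.cells ≃ Fin i) :
    CellModule k n i x ⊗[k] Specht k t →ₗ[k] CellModule k n i x :=
  TensorProduct.lift ((cellMul x hi).compl₂ ((Specht k t).subtype.restrictScalars k))

theorem preStandardToCell_tmul (hi : i ≤ n) (t : lam.cells ≃ Fin i) (y : CellModule k n i x)
    (v : Specht k t) : preStandardToCell x hi t (y ⊗ₜ v) = cellMul x hi y v.1 := rfl

theorem preStandardToCell_diag_smul (hi : i ≤ n) (t : lam.cells ≃ Fin i)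
    (d : PartitionDiagram n) (z : CellModule k n i x ⊗[k] Specht k t) :
    preStandardToCell x hi t (diag x d • z) = diag x d • preStandardToCell x hi t z := by
  induction z using TensorProduct.induction_on with
  | zero => rw [smul_zero, map_zero, smul_zero]
  | tmul y v =>
    rw [TensorProduct.smul_tmul', preStandardToCell_tmul, preStandardToCell_tmul,
      cellMul_diag_smul]
  | add z z' hz hz' => rw [smul_add, map_add, map_add, smul_add, hz, hz']

theorem preStandardToCell_balancingRelations (hi : i ≤ n) (t : lam.cells ≃ Fin i)
    (z : CellModule k n i x ⊗[k] Specht k t) (hz : z ∈ balancingRelations k x hi t) :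
    preStandardToCell x hi t z = 0 := by
  obtain ⟨l, l', σ, v, hl, rfl⟩ := hz
  have hv : (MonoidAlgebra.single σ (1 : k) • v).1 = MonoidAlgebra.single σ 1 * v.1 := rfl
  obtain rfl : l' = l.mulPerm hi σ := Subtype.ext hl
  rw [map_sub, preStandardToCell_tmul, preStandardToCell_tmul, sub_eq_zero, hv, cellMul_mulPerm]

/-- The embedding of a standard module into the cell module. -/
noncomputable def standardToCell (hi : i ≤ n) (t : lam.cells ≃ Fin i) :
    StandardModule k x hi t →ₗ[PartitionAlgebra k n x] CellModule k n i x :=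
  Submodule.liftQ _ (linearMapOfDiag (preStandardToCell x hi t)
    (preStandardToCell_diag_smul x hi t))
    (Submodule.span_le.2 (preStandardToCell_balancingRelations x hi t))

theorem standardToCell_mk (hi : i ≤ n) (t : lam.cells ≃ Fin i)
    (z : CellModule k n i x ⊗[k] Specht k t) :
    standardToCell x hi t (Submodule.Quotient.mk z) = preStandardToCell x hi t z := rfl

/-- The homomorphism `l ↦ l ⊗ e` from the cell module to a standard module. -/
noncomputable def cellToStandard (hi : i ≤ n) (t : lam.cells ≃ Fin i) (e : Specht k t) :
    CellModule k n i x →ₗ[PartitionAlgebra k n x] StandardModule k x hi t :=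
  (Submodule.mkQ _).comp (linearMapOfDiag
    ((TensorProduct.mk k (CellModule k n i x) (Specht k t)).flip e)
    fun d y => (TensorProduct.smul_tmul' (diag x d) y e).symm)

theorem cellToStandard_apply (hi : i ≤ n) (t : lam.cells ≃ Fin i) (e : Specht k t)
    (y : CellModule k n i x) :
    cellToStandard x hi t e y = Submodule.Quotient.mk (y ⊗ₜ[k] e) := rfl

/-- For a permutation this is the balancing relation `l σ ⊗ e = l ⊗ σ e`; linearity gives the rest.
-/
theorem cellToStandard_cellMul (hi : i ≤ n) (t : lam.cells ≃ Fin i) (e : Specht k t)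
    (y : CellModule k n i x) (u : MonoidAlgebra k (Equiv.Perm (Fin i))) :
    cellToStandard x hi t e (cellMul x hi y u) = cellToStandard x hi t (u • e) y := by
  induction u using MonoidAlgebra.induction_on with
  | add u v hu hv =>
    rw [map_add, map_add, hu, hv, add_smul, cellToStandard_apply, cellToStandard_apply,
      cellToStandard_apply, TensorProduct.tmul_add, Submodule.Quotient.mk_add]
  | smul r u hu =>
    rw [map_smul, LinearMap.map_smul_of_tower, hu, smul_assoc, cellToStandard_apply,
      cellToStandard_apply, TensorProduct.tmul_smul r y (u • e)]
    rfl
  | of σ =>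
    rw [MonoidAlgebra.of_apply]
    refine LinearMap.congr_fun
      (f := ((cellToStandard x hi t e).restrictScalars k).comp
        ((cellMul x hi).flip (MonoidAlgebra.single σ 1)))
      (g := (cellToStandard x hi t (MonoidAlgebra.single σ (1 : k) • e)).restrictScalars k)
      (CellModule.linear_ext fun l => ?_) y
    rw [LinearMap.comp_apply, LinearMap.flip_apply, cellMul_basisElem_single,
      LinearMap.restrictScalars_apply, LinearMap.restrictScalars_apply, cellToStandard_apply,
      cellToStandard_apply, Submodule.Quotient.eq]
    exact Submodule.subset_span ⟨l, _, σ, e, rfl, rfl⟩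

/-- By semisimplicity the Specht module is a left ideal generated by an idempotent `e`, which acts
on it as a right identity. -/
theorem exists_retraction_specht [CharZero k] (t : lam.cells ≃ Fin i) :
    ∃ e : Specht k t, ∀ v : Specht k t, v.1 • e = v := by
  obtain ⟨e, he, hs⟩ := IsSemisimpleRing.ideal_eq_span_idempotent (Specht k t)
  have hmem : e ∈ Specht k t := by
    rw [hs]
    exact Submodule.mem_span_singleton_self e
  refine ⟨⟨e, hmem⟩, fun v => Subtype.ext ?_⟩
  have hv : v.1 ∈ Submodule.span (MonoidAlgebra k (Equiv.Perm (Fin i))) {e} := hs.le v.2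
  obtain ⟨w, hw⟩ := Submodule.mem_span_singleton.1 hv
  have h1 : v.1 * e = v.1 := by
    rw [← hw, smul_eq_mul, mul_assoc, he.eq]
  exact h1

/-- The composite is `l ⊗ v ↦ l v ↦ l v ⊗ e = l ⊗ v e = l ⊗ v`. Hence the standard module is a
direct summand of the cell module. -/
theorem exists_cellToStandard_standardToCell [CharZero k] (hi : i ≤ n) (t : lam.cells ≃ Fin i) :
    ∃ e : Specht k t, ∀ z, cellToStandard x hi t e (standardToCell x hi t z) = z := by
  obtain ⟨e, he⟩ := exists_retraction_specht (k := k) t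
  refine ⟨e, fun z => ?_⟩
  obtain ⟨z, rfl⟩ := Submodule.Quotient.mk_surjective _ z
  rw [standardToCell_mk]
  refine LinearMap.congr_fun
    (f := ((cellToStandard x hi t e).restrictScalars k).comp (preStandardToCell x hi t))
    (g := (Submodule.mkQ _).restrictScalars k) (TensorProduct.ext' fun y v => ?_) z
  rw [LinearMap.comp_apply, LinearMap.restrictScalars_apply, preStandardToCell_tmul,
    cellToStandard_cellMul, he]
  rfl

end PartitionAlgebra

/-! ### Tensor products of standard modules -/

namespace PartitionAlgebra

variable {k : Type*} [Field k] (n : ℕ) {i j : ℕ} (a b : k)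

/-- The basis of the tensor product of two cell modules. -/
noncomputable def cellTensorBasis (i j : ℕ) : Module.Basis (LeftCell n i × LeftCell n j) k
    (TensorRep n a b (CellModule k n i a) (CellModule k n j b)) :=
  Module.Basis.tensorProduct (M := CellModule k n i a) (N := CellModule k n j b)
    (Module.Basis.ofRepr (LinearEquiv.refl k (LeftCell n i →₀ k)))
    (Module.Basis.ofRepr (LinearEquiv.refl k (LeftCell n j →₀ k)))

theorem cellTensorBasis_apply (q : LeftCell n i × LeftCell n j) :
    cellTensorBasis n a b i j q =
      TensorRep.tmul n a b (CellModule.basisElem a q.1) (CellModule.basisElem b q.2) :=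
  Module.Basis.tensorProduct_apply' (M := CellModule k n i a) (N := CellModule k n j b) _ _ q

variable {n a b}

/-- The scalar is `a ^ r * b ^ s` with the two numbers of removed parts, nonzero as `a` and `b` are.
If the rank drops in either factor, the tensor vanishes, as does the pair from the index set. -/
theorem cellTensorBasis_isMonomial (ha : a ≠ 0) (hb : b ≠ 0) :
    IsMonomial (a * b) (cellTensorBasis n a b i j) fun q => (q.1.1, q.2.1) where
  injective q q' h := Prod.ext (Subtype.ext (Prod.ext_iff.1 h).1) (Subtype.ext (Prod.ext_iff.1 h).2)
  smul_eq d q q' h := by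
    refine ⟨a ^ loops d q.1.1 * b ^ loops d q.2.1,
      mul_ne_zero (pow_ne_zero _ ha) (pow_ne_zero _ hb), ?_⟩
    rw [cellTensorBasis_apply, cellTensorBasis_apply, TensorRep.diag_smul_tmul,
      diag_smul_basisElem_of_rank_eq a (Prod.ext_iff.1 h).1,
      diag_smul_basisElem_of_rank_eq b (Prod.ext_iff.1 h).2]
    exact TensorProduct.smul_tmul_smul _ _ (CellModule.basisElem a q'.1)
      (CellModule.basisElem b q'.2)
  smul_eq_zero d q h := by
    rw [cellTensorBasis_apply, TensorRep.diag_smul_tmul]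
    by_cases h1 : ∃ l : LeftCell n i, l.1 = comp d q.1.1
    · obtain ⟨l, hl⟩ := h1
      rw [diag_smul_basisElem_of_rank_ne b fun l' hl' => h (l, l') (Prod.ext hl hl')]
      exact TensorProduct.tmul_zero _ (diag a d • CellModule.basisElem a q.1)
    · push Not at h1
      rw [diag_smul_basisElem_of_rank_ne a h1]
      exact TensorProduct.zero_tmul _ (diag b d • CellModule.basisElem b q.2)

/-- The tensor product is a retract of the tensor product of two cell modules, which is layered
because its basis is monomial. -/
theorem hasStandardFiltration_tensorRep_standardModule [CharZero k] (ha : a ≠ 0) (hb : b ≠ 0)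
    (hi : i ≤ n) (hj : j ≤ n) {lam mu : YoungDiagram} (t : lam.cells ≃ Fin i)
    (u : mu.cells ≃ Fin j) :
    HasStandardFiltration k n (a * b)
      (TensorRep n a b (StandardModule k a hi t) (StandardModule k b hj u)) := by
  obtain ⟨e, he⟩ := exists_cellToStandard_standardToCell a hi t
  obtain ⟨f, hf⟩ := exists_cellToStandard_standardToCell b hj u
  have hret : ∀ z, TensorRep.map n a b (cellToStandard a hi t e) (cellToStandard b hj u f)
      (TensorRep.map n a b (standardToCell a hi t) (standardToCell b hj u) z) = z := by
    intro z
    induction z using TensorRep.induction_on with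
    | zero => rw [map_zero, map_zero]
    | tmul v w => rw [TensorRep.map_tmul, TensorRep.map_tmul, he, hf]
    | add z z' hz hz' => rw [map_add, map_add, hz, hz']
  have hfin : FiniteDimensional k (TensorRep n a b (CellModule k n i a) (CellModule k n j b)) :=
    (cellTensorBasis n a b i j).finiteDimensional_of_finite
  have hfin' : FiniteDimensional k
      (TensorRep n a b (StandardModule k a hi t) (StandardModule k b hj u)) :=
    Module.Finite.of_surjective ((TensorRep.map n a b (cellToStandard a hi t e)
      (cellToStandard b hj u f)).restrictScalars k) fun z => ⟨_, hret z⟩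
  exact IsLayered.hasStandardFiltration (mul_ne_zero ha hb) (IsLayered.of_retract _ _ hret
    ((cellTensorBasis_isMonomial ha hb).isLayered (mul_ne_zero ha hb)))

end PartitionAlgebra

theorem mainTheorem7 {k : Type*} [Field k] [IsAlgClosed k] [CharZero k] (n : ℕ) (a b : k)
    (ha : a ≠ 0) (hb : b ≠ 0)
    (X : Type*) [AddCommGroup X] [Module k X] [Module (PartitionAlgebra k n a) X]
    [IsScalarTower k (PartitionAlgebra k n a) X]
    (Y : Type*) [AddCommGroup Y] [Module k Y] [Module (PartitionAlgebra k n b) Y]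
    [IsScalarTower k (PartitionAlgebra k n b) Y]
    (hX : HasStandardFiltration k n a X) (hY : HasStandardFiltration k n b Y) :
    letI : Module (PartitionAlgebra k n (a * b)) (X ⊗[k] Y) :=
      PartitionAlgebra.tensorModule n a b X Y
    HasStandardFiltration k n (a * b) (X ⊗[k] Y) :=
  PartitionAlgebra.hasStandardFiltration_tensorRep_left n a b
    (fun _ hi _ t => PartitionAlgebra.hasStandardFiltration_tensorRep_right n a b
      (fun _ hj _ u =>
        PartitionAlgebra.hasStandardFiltration_tensorRep_standardModule ha hb hi hj t u) hY) hX
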